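/- Let $N\ge 2$, $\nu\ge 1$, let $\Omega\subseteq\mathbb R^N$ be open, let $E,F$ be finite-dimensional complex normed spaces and let $A(x,D)=\sum_{|\alpha|\le\nu}a_\alpha(x)\partial^\alpha$ be a linear differential operator from $E$ to $F$ with smooth coefficients $a_\alpha:\Omega\to\mathrm{Hom}_{\mathbb C}(E,F)$. Let $A^*(x,D)v=\sum_{|\alpha|\le\nu}(-1)^{|\alpha|}\partial^\alpha(a_\alpha^*v)$ be its formal adjoint, so that $\int A\varphi\cdot\bar v=\int\varphi\cdot\overline{A^*v}$ for $\varphi\in C_c^\infty(\Omega;E)$, $v\in C_c^\infty(\Omega;F^*)$; here $E^*,F^*$ are the spaces of conjugate-linear functionals with the dual norm, $a_\alpha^*v=v\circ a_\alpha$, and $\bar v\cdot z=\overline{v(z)}$. For an open set $U\subseteq\Omega$, $k\in\mathbb N$ and $1\le p\le\infty$, let $W^{k,p}(U;E)$ be the space of $g\in L^p(U;E)$ whose weak derivatives of order $k$ belong to $L^p(U;E)$, with the seminorm $\|g\|_{W^{k,p}}=\sum_{|\alpha|=k}\|\partial^\alpha g\|_{L^p(U)}$. For $g\in L^1(U;E)$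 let $$\|D_{\mathcal A}g\|=\sup\Big\{\Big|\int_U g\,\overline{A^*(\cdot,D)v}\Big| : v\in C_c^\infty(U;F^*),\ \|v\|_\infty\le 1\Big\},$$ and let $BV_{\mathcal A,c}(U)$ be the set of $g\in W^{\nu-1,1}(U;E)$ with compact support in $U$ and $\|D_{\mathcal A}g\|<\infty$. Suppose that the open set $U\subseteq\Omega$ has the following two properties. 1. There is $C>0$ with $\|u\|_{W^{\nu-1,N/(N-1)}}\le C\|A(x,D)u\|_{L^1}$ for all $u\in C_c^\infty(U;E)$. 2. There are $0<\beta<1$, a smooth function $\psi:\mathbb R^N\to\mathbb C$ with $\psi=1$ on $U$, and $C>0$ such that $\sum_{|\alpha|=\nu-1}\|\Lambda_{1-\beta}\partial^\alpha\varphi\|_{L^1(\mathbb R^N)}\le C\|A(x,D)\varphi\|_{L^1}$ for all $\varphi\in C_c^\infty(U;E)$, where $\Lambda_\gamma f(x)=\psi(x)\int_{\mathbb R^N}e^{2\pi i x\cdot\xi}(1+4\pi^2|\xi|^2)^{\gamma/2}\hat f(\xi)\,d\xi$ and $\hat f(\xi)=\int_{\mathbb R^N}e^{-2\pi i x\cdot\xi}f(x)\,dx$.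 Let $(g_i)_{i\in\mathbb N}\subseteq BV_{\mathcal A,c}(U)$ be a sequence for which there is a compact set $K\subset U$ with $\operatorname{supp}g_i\subseteq K$ for all $i$, and suppose that $\sup_i\|D_{\mathcal A}g_i\|<\infty$. Then there are $g\in BV_{\mathcal A,c}(U)$ and a subsequence $(g_{i_k})$ with $\|g_{i_k}-g\|_{W^{\nu-1,1}}\to0$ as $k\to\infty$. -/

import Mathlib

open MeasureTheory Filter Topology TopologicalSpace
open scoped ENNReal NNReal ContDiff FourierTransform ComplexConjugate

noncomputable section

namespace DiffOpBV

/-- The multi-indices `α ∈ ℕ^N` of length `|α| = k`. -/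
def multiIndices (N k : ℕ) : Finset (Fin N → ℕ) :=
  Finset.piAntidiag Finset.univ k

/-- The partial derivative `∂ᵢ f` of a function on `ℝ^N`. -/
def partialDeriv {N : ℕ} {G : Type*} [NormedAddCommGroup G] [NormedSpace ℝ G]
    (i : Fin N) (f : EuclideanSpace ℝ (Fin N) → G) : EuclideanSpace ℝ (Fin N) → G :=
  fun x => fderiv ℝ f x (EuclideanSpace.single i 1)

/-- The classical derivative `∂^α f = ∂₁^{α₁} ⋯ ∂_N^{α_N} f` of a smooth function. -/
def multiDeriv {N : ℕ} {G : Type*} [NormedAddCommGroup G] [NormedSpace ℝ G]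
    (α : Fin N → ℕ) (f : EuclideanSpace ℝ (Fin N) → G) : EuclideanSpace ℝ (Fin N) → G :=
  (List.finRange N).foldr (fun i h => (partialDeriv i)^[α i] h) f

/-- A linear differential operator `A(x,D) = ∑_{|α| ≤ ν} a_α(x) ∂^α` of order (at most) `ν` from
`E` to `F`, with smooth coefficients in the open set `Ω`. Only the values of `a_α`, `|α| ≤ ν`,
on `Ω` matter. -/
structure DiffOp {N : ℕ} (Ω : Opens (EuclideanSpace ℝ (Fin N))) (ν : ℕ)
    (E F : Type*) [NormedAddCommGroup E] [NormedSpace ℂ E]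
    [NormedAddCommGroup F] [NormedSpace ℂ F] where
  /-- the coefficients `a_α` -/
  coeff : (Fin N → ℕ) → EuclideanSpace ℝ (Fin N) → (E →L[ℂ] F)
  smooth : ∀ α, ∑ i, α i ≤ ν → ContDiffOn ℝ ∞ (coeff α) Ω

/-- The conjugate dual of `G`: conjugate-linear functionals with the dual norm. If `v` has values
here, then `z ↦ conj (v z)`, that is `v̄`, is a linear functional of the same norm, so the pairing
`v̄ · z` is `conj (v z)`. -/
abbrev ConjDual (G : Type*) [NormedAddCommGroup G] [NormedSpace ℂ G] : Type _ :=
  G →SL[starRingEnd ℂ] ℂ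

section

variable {N ν : ℕ} {Ω : Opens (EuclideanSpace ℝ (Fin N))}
  {E F : Type*} [NormedAddCommGroup E] [NormedSpace ℂ E]
  [NormedAddCommGroup F] [NormedSpace ℂ F]

/-- `A(x,D)φ` for a smooth `φ`. -/
def DiffOp.apply (A : DiffOp Ω ν E F) (φ : EuclideanSpace ℝ (Fin N) → E) :
    EuclideanSpace ℝ (Fin N) → F :=
  fun x => ∑ k ∈ Finset.range (ν + 1), ∑ α ∈ multiIndices N k,
    A.coeff α x (multiDeriv α φ x)

/-- The formal adjoint `A^*(x,D)v = ∑_{|α| ≤ ν} (-1)^{|α|} ∂^α (a_α^* v)`, determined by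
`∫ A φ · v̄ = ∫ φ · conj (A^* v)`; here `a_α(x)^*` maps `v ∈ F^*` to `v ∘ a_α(x) ∈ E^*`. -/
def DiffOp.adjoint (A : DiffOp Ω ν E F) (v : EuclideanSpace ℝ (Fin N) → ConjDual F) :
    EuclideanSpace ℝ (Fin N) → ConjDual E :=
  fun x => ∑ k ∈ Finset.range (ν + 1), ∑ α ∈ multiIndices N k,
    (-1 : ℂ) ^ k • multiDeriv α (fun y => (v y).comp (A.coeff α y)) x

/-- The total `𝒜`-variation in `U`,
`‖D_𝒜 g‖ = sup {|∫_U g conj (A^* v)| : v ∈ C_c^∞(U; F^*), ‖v‖_∞ ≤ 1}`. -/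
def DiffOp.variation (A : DiffOp Ω ν E F) (U : Opens (EuclideanSpace ℝ (Fin N)))
    (g : EuclideanSpace ℝ (Fin N) → E) : ℝ≥0∞ :=
  ⨆ (v : TestFunction U (ConjDual F) ⊤) (_ : ∀ x, ‖v x‖ ≤ 1),
    ‖∫ x in (U : Set (EuclideanSpace ℝ (Fin N))), conj (A.adjoint v x (g x))‖ₑ

/-- `h` is the weak derivative `∂^α g` in `U`. -/
def IsWeakDeriv (U : Opens (EuclideanSpace ℝ (Fin N))) (α : Fin N → ℕ)
    (g h : EuclideanSpace ℝ (Fin N) → E) : Prop :=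
  LocallyIntegrableOn g U ∧ LocallyIntegrableOn h U ∧
    ∀ φ : TestFunction U ℂ ⊤,
      ∫ x in (U : Set (EuclideanSpace ℝ (Fin N))), multiDeriv α φ x • g x =
        (-1 : ℂ) ^ (∑ i, α i) • ∫ x in (U : Set (EuclideanSpace ℝ (Fin N))), φ x • h x

/-- `g ∈ W^{k,p}(U; E)`: both `g` and its weak derivatives of order exactly `k` are in `L^p`. -/
def MemSobolev (k : ℕ) (p : ℝ≥0∞) (U : Opens (EuclideanSpace ℝ (Fin N)))
    (g : EuclideanSpace ℝ (Fin N) → E) : Prop :=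
  MemLp g p (volume.restrict (U : Set (EuclideanSpace ℝ (Fin N)))) ∧
    ∀ α ∈ multiIndices N k, ∃ h : EuclideanSpace ℝ (Fin N) → E,
      IsWeakDeriv U α g h ∧
        MemLp h p (volume.restrict (U : Set (EuclideanSpace ℝ (Fin N))))

/-- The homogeneous seminorm `‖g‖_{W^{k,p}(U)} = ∑_{|α| = k} ‖∂^α g‖_{L^p(U)}`. Weak derivatives
are unique almost everywhere, so the infimum is over one value; it is `∞` if there is no weak
derivative. -/
def sobolevSeminorm (k : ℕ) (p : ℝ≥0∞) (U : Opens (EuclideanSpace ℝ (Fin N)))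
    (g : EuclideanSpace ℝ (Fin N) → E) : ℝ≥0∞ :=
  ∑ α ∈ multiIndices N k,
    ⨅ (h : EuclideanSpace ℝ (Fin N) → E) (_ : IsWeakDeriv U α g h),
      eLpNorm h p (volume.restrict (U : Set (EuclideanSpace ℝ (Fin N))))

/-- `supp g ⊆ K` for the class of `g` in `L¹_loc(U)` and a closed set `K`: `g` vanishes almost
everywhere in `U \ K`. -/
def SuppIn (U : Opens (EuclideanSpace ℝ (Fin N))) (K : Set (EuclideanSpace ℝ (Fin N)))
    (g : EuclideanSpace ℝ (Fin N) → E) : Prop :=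
  ∀ᵐ x ∂(volume.restrict (U : Set (EuclideanSpace ℝ (Fin N)))), x ∉ K → g x = 0

/-- `g ∈ BV_{𝒜,c}(U)`: `g ∈ W^{ν-1,1}(U; E)` has compact support in `U` and finite
`𝒜`-variation. -/
structure DiffOp.MemBVc (A : DiffOp Ω ν E F) (U : Opens (EuclideanSpace ℝ (Fin N)))
    (g : EuclideanSpace ℝ (Fin N) → E) : Prop where
  memSobolev : MemSobolev (ν - 1) 1 U g
  compactSupp : ∃ K : Set (EuclideanSpace ℝ (Fin N)), IsCompact K ∧ K ⊆ U ∧ SuppIn U K g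
  variation_lt_top : A.variation U g < ⊤

/-- `U` supports the Sobolev-Gagliardo-Nirenberg inequality
`‖u‖_{W^{ν-1,N/(N-1)}} ≤ C ‖A(x,D)u‖_{L¹}` for all `u ∈ C_c^∞(U; E)`. -/
def DiffOp.SupportsSGN (A : DiffOp Ω ν E F) (U : Opens (EuclideanSpace ℝ (Fin N))) : Prop :=
  ∃ C : ℝ≥0, ∀ u : TestFunction U E ⊤,
    ∑ α ∈ multiIndices N (ν - 1),
        eLpNorm (multiDeriv α u) (ENNReal.ofReal ((N : ℝ) / ((N : ℝ) - 1))) volume ≤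
      C * eLpNorm (A.apply u) 1 volume

/-- The operator `Λ_γ` with symbol `ψ(x) (1 + 4π²|ξ|²)^{γ/2}`, of order `γ`:
`Λ_γ f(x) = ψ(x) ∫ e^{2πi x·ξ} (1 + 4π²|ξ|²)^{γ/2} f̂(ξ) dξ`. -/
def besselOp (ψ : EuclideanSpace ℝ (Fin N) → ℂ) (γ : ℝ)
    (f : EuclideanSpace ℝ (Fin N) → E) : EuclideanSpace ℝ (Fin N) → E :=
  fun x => ψ x • 𝓕⁻ (fun ξ : EuclideanSpace ℝ (Fin N) =>
    (1 + 4 * Real.pi ^ 2 * ‖ξ‖ ^ 2) ^ (γ / 2) • 𝓕 f ξ) x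

/-- `U` supports the fractional estimate
`∑_{|α| = ν-1} ‖∂^α φ‖_{1-β,1} ≤ C ‖A(x,D)φ‖_{L¹}` for all `φ ∈ C_c^∞(U; E)`, where
`‖f‖_{γ,1} = ‖Λ_γ f‖_{L¹(ℝ^N)}` is formed with some smooth `ψ` that is `1` on `U`.
Compact support of `ψ` is not asked for, so that `U` may be unbounded. -/
def DiffOp.SupportsFractional (A : DiffOp Ω ν E F) (U : Opens (EuclideanSpace ℝ (Fin N)))
    (β : ℝ) : Prop :=
  ∃ ψ : EuclideanSpace ℝ (Fin N) → ℂ, ContDiff ℝ ∞ ψ ∧ (∀ x ∈ U, ψ x = 1) ∧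
    ∃ C : ℝ≥0, ∀ φ : TestFunction U E ⊤,
      ∑ α ∈ multiIndices N (ν - 1), eLpNorm (besselOp ψ (1 - β) (multiDeriv α φ)) 1 volume ≤
        C * eLpNorm (A.apply φ) 1 volume

end

end DiffOpBV

end

noncomputable section

namespace DiffOpBV

/-!
A compactly supported `g` of finite `𝒜`-variation is mollified to `u = ρ_ε ⋆ g`. Friedrichs'
commutator `A (ρ_ε ⋆ g) - ρ_ε ⋆ A g` tends to `0` in `L¹`, because `g ∈ W^{ν-1,1}` and in each of
its terms the one remaining derivative can be moved to `ρ_ε`, whose singularity is compensated by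
the Lipschitz bound on the coefficients. Hence `‖A u‖_{L¹}` exceeds the `𝒜`-variation of `g` by as
little as we please, and it is enough to find a convergent subsequence for smooth functions `u_i`
supported in a fixed compact set with `‖A u_i‖_{L¹}` bounded.

For `f = ∂^α u_i` with `|α| = ν - 1`, the fractional estimate bounds `(1 - Δ)^s f`, where
`s = (1 - β) / 2`, in `L¹(U)`. Averaging the `L¹` contraction of the heat semigroup over time (a
Kato inequality) gives `‖f‖_{L¹} ≤ ‖(1 - Δ)^s f‖_{L¹(U)}`, and off the support of `f` the
Gaussian decay of the heat kernel bounds `(1 - Δ)^s f` by `‖f‖_{L¹}`, so the bound extends to the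
whole space. In `f = Γ(s)⁻¹ ∫₀^∞ t^(s-1) e^(-t(1-Δ)) (1 - Δ)^s f dt` the part `t ≤ δ` is of size
`δ^s` in `L¹`, and the part `t > δ` is Lipschitz with a constant depending only on `δ`; by
Arzelà–Ascoli the `f` are totally bounded in `L¹`. The Poincaré inequality transfers this to
the `u_i`, and the limit has finite `𝒜`-variation because the variation is lower
semicontinuous under `L¹` convergence.
-/

local notation "𝔼" N => EuclideanSpace ℝ (Fin N)
local notation:67 ρ:68 "⋆" f:67 => convolution ρ f (ContinuousLinearMap.lsmul ℝ ℝ) volume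

/-! ### Iterated partial derivatives -/

section IteratedDerivatives

variable {N : ℕ} {G : Type*} [NormedAddCommGroup G] [NormedSpace ℝ G]

theorem contDiff_partialDeriv {f : (𝔼 N) → G} (hf : ContDiff ℝ ∞ f) (i : Fin N) :
    ContDiff ℝ ∞ (partialDeriv i f) :=
  (hf.fderiv_right (m := ∞) (by simp)).clm_apply contDiff_const

theorem tsupport_partialDeriv_subset (f : (𝔼 N) → G) (i : Fin N) :
    tsupport (partialDeriv i f) ⊆ tsupport f :=
  tsupport_fderiv_apply_subset ℝ _

theorem partialDeriv_congr {f g : (𝔼 N) → G} {x : 𝔼 N} (h : f =ᶠ[𝓝 x] g) (i : Fin N) :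
    partialDeriv i f =ᶠ[𝓝 x] partialDeriv i g :=
  (h.fderiv (𝕜 := ℝ)).mono fun y hy => by simp only [partialDeriv, hy]

theorem partialDeriv_comm {f : (𝔼 N) → G} (hf : ContDiff ℝ ∞ f) (i j : Fin N) :
    partialDeriv i (partialDeriv j f) = partialDeriv j (partialDeriv i f) := by
  have second_fderiv (i j : Fin N) (x : 𝔼 N) : partialDeriv i (partialDeriv j f) x =
      fderiv ℝ (fderiv ℝ f) x (EuclideanSpace.single i 1) (EuclideanSpace.single j 1) := by
    have h : DifferentiableAt ℝ (fderiv ℝ f) x :=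
      ((hf.fderiv_right (m := ∞) (by simp)).differentiable (by simp)) x
    unfold partialDeriv
    rw [fderiv_clm_apply h (differentiableAt_const _)]
    simp
  ext1 x
  rw [second_fderiv, second_fderiv]
  refine (hf.contDiffAt.isSymmSndFDerivAt ?_).eq _ _
  rw [minSmoothness_of_isRCLikeNormedField]
  exact WithTop.coe_le_coe.2 (le_top : (2 : ℕ∞) ≤ ⊤)

/-- The iterated partial derivative along a list of coordinate directions. Lists make induction on
the order of differentiation available, which multi-indices do not. -/
def listDeriv (L : List (Fin N)) (f : (𝔼 N) → G) : (𝔼 N) → G :=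
  L.foldr partialDeriv f

@[simp] theorem listDeriv_nil (f : (𝔼 N) → G) : listDeriv [] f = f := rfl

@[simp] theorem listDeriv_cons (i : Fin N) (L : List (Fin N)) (f : (𝔼 N) → G) :
    listDeriv (i :: L) f = partialDeriv i (listDeriv L f) := rfl

theorem listDeriv_append (L L' : List (Fin N)) (f : (𝔼 N) → G) :
    listDeriv (L ++ L') f = listDeriv L (listDeriv L' f) := by
  simp [listDeriv]

theorem contDiff_listDeriv {f : (𝔼 N) → G} (hf : ContDiff ℝ ∞ f) (L : List (Fin N)) :
    ContDiff ℝ ∞ (listDeriv L f) := by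
  induction L with
  | nil => exact hf
  | cons i L ih => exact contDiff_partialDeriv ih i

theorem tsupport_listDeriv_subset (f : (𝔼 N) → G) (L : List (Fin N)) :
    tsupport (listDeriv L f) ⊆ tsupport f := by
  induction L with
  | nil => exact subset_rfl
  | cons i L ih => exact (tsupport_partialDeriv_subset _ i).trans ih

theorem hasCompactSupport_listDeriv {f : (𝔼 N) → G} (hf : HasCompactSupport f)
    (L : List (Fin N)) : HasCompactSupport (listDeriv L f) :=
  hf.mono' ((subset_tsupport _).trans (tsupport_listDeriv_subset f L))

theorem hasCompactSupport_partialDeriv {f : (𝔼 N) → G} (hf : HasCompactSupport f) (i : Fin N) :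
    HasCompactSupport (partialDeriv i f) :=
  hasCompactSupport_listDeriv hf [i]

theorem listDeriv_congr {f g : (𝔼 N) → G} {x : 𝔼 N} (h : f =ᶠ[𝓝 x] g) (L : List (Fin N)) :
    listDeriv L f =ᶠ[𝓝 x] listDeriv L g := by
  induction L with
  | nil => exact h
  | cons i L ih => exact partialDeriv_congr ih i

theorem listDeriv_perm {f : (𝔼 N) → G} (hf : ContDiff ℝ ∞ f) {L L' : List (Fin N)}
    (h : L.Perm L') : listDeriv L f = listDeriv L' f := by
  induction h with
  | nil => rfl
  | cons i _ ih => simp [ih]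
  | swap i j L => exact partialDeriv_comm (contDiff_listDeriv hf L) j i
  | trans _ _ ih₁ ih₂ => exact ih₁.trans ih₂

theorem listDeriv_clm_comp {G' : Type*} [NormedAddCommGroup G'] [NormedSpace ℝ G']
    (T : G →L[ℝ] G') {f : (𝔼 N) → G} (hf : ContDiff ℝ ∞ f) (L : List (Fin N)) :
    listDeriv L (fun x => T (f x)) = fun x => T (listDeriv L f x) := by
  induction L with
  | nil => rfl
  | cons i L ih =>
    rw [listDeriv_cons, ih]
    ext1 x
    have hT := T.hasFDerivAt.comp x
      ((contDiff_listDeriv hf L).differentiable (by simp) x).hasFDerivAt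
    exact congrArg (fun D => D (EuclideanSpace.single i 1)) hT.fderiv

theorem listDeriv_sub {f g : (𝔼 N) → G} (hf : ContDiff ℝ ∞ f) (hg : ContDiff ℝ ∞ g)
    (L : List (Fin N)) : listDeriv L (f - g) = listDeriv L f - listDeriv L g := by
  induction L with
  | nil => rfl
  | cons i L ih =>
    rw [listDeriv_cons, ih]
    ext1 x
    exact congrArg (fun D => D (EuclideanSpace.single i 1))
      (fderiv_sub ((contDiff_listDeriv hf L).differentiable (by simp) x)
        ((contDiff_listDeriv hg L).differentiable (by simp) x))

theorem partialDeriv_comp_sub_left {f : (𝔼 N) → G} (hf : ContDiff ℝ ∞ f) (x : 𝔼 N) (i : Fin N) :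
    partialDeriv i (fun y => f (x - y)) = fun y => -partialDeriv i f (x - y) := by
  ext1 y
  have hsub : HasFDerivAt (fun y => x - y) (-ContinuousLinearMap.id ℝ (𝔼 N)) y := by
    simpa using (hasFDerivAt_id y).const_sub x
  have hcomp := (hf.differentiable (by simp) (x - y)).hasFDerivAt.comp y hsub
  simpa [partialDeriv, Function.comp_def] using
    congrArg (fun D => D (EuclideanSpace.single i 1)) hcomp.fderiv

theorem listDeriv_comp_sub_left {f : (𝔼 N) → G} (hf : ContDiff ℝ ∞ f) (x : 𝔼 N) (L : List (Fin N)) :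
    listDeriv L (fun y => f (x - y)) = fun y => (-1 : ℝ) ^ L.length • listDeriv L f (x - y) := by
  induction L with
  | nil => simp
  | cons i L ih =>
    have hsmul (c : ℝ) {f : (𝔼 N) → G} (hf : ContDiff ℝ ∞ f) :
        partialDeriv i (fun y => c • f y) = fun y => c • partialDeriv i f y :=
      listDeriv_clm_comp (c • ContinuousLinearMap.id ℝ G) hf [i]
    have hL := contDiff_listDeriv hf L
    have hLx : ContDiff ℝ ∞ fun y => listDeriv L f (x - y) :=
      hL.comp (contDiff_const.sub contDiff_id)
    rw [listDeriv_cons, ih, hsmul _ hLx, partialDeriv_comp_sub_left hL]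
    ext1 y
    rw [List.length_cons, pow_succ, mul_neg_one, neg_smul, smul_neg, listDeriv_cons]

/-- The list of directions in the multi-index `α`. -/
def multiList (α : Fin N → ℕ) : List (Fin N) :=
  (List.finRange N).flatMap fun i => List.replicate (α i) i

theorem count_multiList (α : Fin N → ℕ) (i : Fin N) : (multiList α).count i = α i := by
  have hcount : (List.count i ∘ fun j => List.replicate (α j) j) =
      fun j => if j = i then α i else 0 := by
    ext j
    by_cases h : j = i
    · simp [h]
    · simp [h, List.count_replicate]
  rw [multiList, List.count_flatMap, hcount, ← Fin.sum_univ_def]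
  simp

theorem length_multiList (α : Fin N → ℕ) : (multiList α).length = ∑ i, α i := by
  rw [multiList, List.length_flatMap, ← Fin.sum_univ_def]
  simp

theorem multiDeriv_eq_listDeriv (α : Fin N → ℕ) (f : (𝔼 N) → G) :
    multiDeriv α f = listDeriv (multiList α) f := by
  unfold multiDeriv multiList
  induction List.finRange N with
  | nil => rfl
  | cons i l ih =>
    rw [List.foldr_cons, List.flatMap_cons, listDeriv_append, ← ih]
    generalize List.foldr _ f l = h
    induction α i with
    | zero => rfl
    | succ n ihn => rw [Function.iterate_succ_apply', ihn, List.replicate_succ, listDeriv_cons]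

theorem listDeriv_eq_multiDeriv {f : (𝔼 N) → G} (hf : ContDiff ℝ ∞ f) (L : List (Fin N)) :
    listDeriv L f = multiDeriv (fun i => L.count i) f := by
  rw [multiDeriv_eq_listDeriv]
  exact listDeriv_perm hf
    (List.perm_iff_count.2 fun i => (count_multiList (fun i => L.count i) i).symm)

theorem mem_multiIndices {k : ℕ} {α : Fin N → ℕ} : α ∈ multiIndices N k ↔ ∑ i, α i = k := by
  simp [multiIndices]

theorem count_mem_multiIndices (L : List (Fin N)) :
    (fun i => L.count i) ∈ multiIndices N L.length := by
  rw [mem_multiIndices]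
  simpa using Multiset.sum_count_eq_card (s := Finset.univ) (m := (L : Multiset (Fin N)))
    (by simp)

theorem contDiff_multiDeriv {f : (𝔼 N) → G} (hf : ContDiff ℝ ∞ f) (α : Fin N → ℕ) :
    ContDiff ℝ ∞ (multiDeriv α f) := by
  rw [multiDeriv_eq_listDeriv]
  exact contDiff_listDeriv hf _

theorem tsupport_multiDeriv_subset (f : (𝔼 N) → G) (α : Fin N → ℕ) :
    tsupport (multiDeriv α f) ⊆ tsupport f := by
  rw [multiDeriv_eq_listDeriv]
  exact tsupport_listDeriv_subset f _

theorem hasCompactSupport_multiDeriv {f : (𝔼 N) → G} (hf : HasCompactSupport f) (α : Fin N → ℕ) :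
    HasCompactSupport (multiDeriv α f) :=
  hf.mono' ((subset_tsupport _).trans (tsupport_multiDeriv_subset f α))

end IteratedDerivatives

section IntegrationByParts

variable {N : ℕ} {G₁ G₂ W : Type*} [NormedAddCommGroup G₁] [NormedSpace ℝ G₁]
  [NormedAddCommGroup G₂] [NormedSpace ℝ G₂] [NormedAddCommGroup W] [NormedSpace ℝ W]

theorem integrable_bilin_of_hasCompactSupport (B : G₁ →L[ℝ] G₂ →L[ℝ] W) {f : (𝔼 N) → G₁}
    {g : (𝔼 N) → G₂} (hf : Continuous f) (hg : Continuous g) (hgc : HasCompactSupport g) :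
    Integrable fun x => B (f x) (g x) := by
  refine ((B.continuous.comp hf).clm_apply hg).integrable_of_hasCompactSupport
    (hgc.mono fun x hx hgx => hx ?_)
  simp [hgx]

theorem integral_bilin_partialDeriv (B : G₁ →L[ℝ] G₂ →L[ℝ] W) {f : (𝔼 N) → G₁} {g : (𝔼 N) → G₂}
    (hf : ContDiff ℝ ∞ f) (hg : ContDiff ℝ ∞ g) (hgc : HasCompactSupport g) (i : Fin N) :
    ∫ x, B (f x) (partialDeriv i g x) = -∫ x, B (partialDeriv i f x) (g x) :=
  integral_bilinear_fderiv_right_eq_neg_left_of_integrable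
    (integrable_bilin_of_hasCompactSupport B (contDiff_partialDeriv hf i).continuous
      hg.continuous hgc)
    (integrable_bilin_of_hasCompactSupport B hf.continuous
      (contDiff_partialDeriv hg i).continuous (hasCompactSupport_partialDeriv hgc i))
    (integrable_bilin_of_hasCompactSupport B hf.continuous hg.continuous hgc)
    (fun x _ => hf.differentiable (by simp) x) (fun x _ => hg.differentiable (by simp) x)

theorem integral_bilin_listDeriv (B : G₁ →L[ℝ] G₂ →L[ℝ] W) {f : (𝔼 N) → G₁} {g : (𝔼 N) → G₂}
    (hf : ContDiff ℝ ∞ f) (hg : ContDiff ℝ ∞ g) (hgc : HasCompactSupport g) (L : List (Fin N)) :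
    ∫ x, B (f x) (listDeriv L g x) = (-1 : ℝ) ^ L.length • ∫ x, B (listDeriv L f x) (g x) := by
  induction L generalizing f with
  | nil => simp
  | cons i L ih =>
    have hcons : listDeriv (i :: L) f = listDeriv L (partialDeriv i f) := by
      rw [listDeriv_perm hf (List.perm_append_singleton i L).symm, listDeriv_append]
      rfl
    rw [listDeriv_cons, integral_bilin_partialDeriv B hf (contDiff_listDeriv hg L)
      (hasCompactSupport_listDeriv hgc L), ih (contDiff_partialDeriv hf i), hcons]
    simp [pow_succ]

theorem integral_bilin_multiDeriv (B : G₁ →L[ℝ] G₂ →L[ℝ] W) {f : (𝔼 N) → G₁} {g : (𝔼 N) → G₂}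
    (hf : ContDiff ℝ ∞ f) (hg : ContDiff ℝ ∞ g) (hgc : HasCompactSupport g) (α : Fin N → ℕ) :
    ∫ x, B (f x) (multiDeriv α g x) =
      (-1 : ℝ) ^ (∑ i, α i) • ∫ x, B (multiDeriv α f x) (g x) := by
  rw [multiDeriv_eq_listDeriv, multiDeriv_eq_listDeriv, ← length_multiList]
  exact integral_bilin_listDeriv B hf hg hgc _

end IntegrationByParts

/-! ### Convolution with scalar kernels -/

section Convolution

variable {N : ℕ} {G : Type*} [NormedAddCommGroup G] [NormedSpace ℝ G]

theorem lintegral_lintegral_mul_enorm_sub {H : Type*} [NormedAddCommGroup H]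
    {k : (𝔼 N) → ℝ≥0∞} (hk : AEMeasurable k) {f : (𝔼 N) → H} (hf : AEStronglyMeasurable f) :
    ∫⁻ x, ∫⁻ t, k t * ‖f (x - t)‖ₑ = (∫⁻ t, k t) * ∫⁻ x, ‖f x‖ₑ := by
  have hmeas : AEMeasurable (fun p : (𝔼 N) × (𝔼 N) => k p.2 * ‖f (p.1 - p.2)‖ₑ)
      (volume.prod volume) :=
    hk.comp_snd.mul (hf.comp_quasiMeasurePreserving
      (quasiMeasurePreserving_sub_of_right_invariant volume volume)).enorm
  have hinner (t : 𝔼 N) : ∫⁻ x, k t * ‖f (x - t)‖ₑ = k t * ∫⁻ x, ‖f x‖ₑ := by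
    have hf_sub : AEStronglyMeasurable (fun x => f (x - t)) := hf.comp_quasiMeasurePreserving
      (measurePreserving_sub_right volume t).quasiMeasurePreserving
    rw [lintegral_const_mul'' _ hf_sub.enorm, lintegral_sub_right_eq_self (fun x => ‖f x‖ₑ)]
  rw [lintegral_lintegral_swap hmeas]
  simp only [hinner]
  exact lintegral_mul_const'' _ hk

theorem lintegral_enorm_integral_le {H : Type*} [NormedAddCommGroup H]
    {k : (𝔼 N) → ℝ≥0∞} (hk : AEMeasurable k) {f : (𝔼 N) → H}
    (hf : AEStronglyMeasurable f) {T : (𝔼 N) → (𝔼 N) → G}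
    (hT : ∀ x t, ‖T x t‖ₑ ≤ k t * ‖f (x - t)‖ₑ) :
    ∫⁻ x, ‖∫ t, T x t‖ₑ ≤ (∫⁻ t, k t) * ∫⁻ x, ‖f x‖ₑ := by
  rw [← lintegral_lintegral_mul_enorm_sub hk hf]
  exact lintegral_mono fun x => (enorm_integral_le_lintegral_enorm _).trans
    (lintegral_mono fun t => hT x t)

variable {ρ : (𝔼 N) → ℝ}

theorem lintegral_enorm_convolution_le (hρ : AEStronglyMeasurable ρ) {f : (𝔼 N) → G}
    (hf : AEStronglyMeasurable f) :
    ∫⁻ x, ‖(ρ ⋆ f) x‖ₑ ≤ (∫⁻ x, ‖ρ x‖ₑ) * ∫⁻ x, ‖f x‖ₑ :=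
  lintegral_enorm_integral_le hρ.enorm hf fun x t => (enorm_smul (ρ t) (f (x - t))).le

theorem convolution_sub (hρ : Continuous ρ) (hρc : HasCompactSupport ρ) {f g : (𝔼 N) → G}
    (hf : LocallyIntegrable f) (hg : LocallyIntegrable g) : ρ ⋆ (f - g) = ρ ⋆ f - ρ ⋆ g := by
  ext1 x
  simp only [convolution_def, Pi.sub_apply, map_sub]
  exact integral_sub (hρc.convolutionExists_left _ hρ hf x)
    (hρc.convolutionExists_left _ hρ hg x)

theorem contDiff_convolution (hρ : ContDiff ℝ ∞ ρ) (hρc : HasCompactSupport ρ) {f : (𝔼 N) → G}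
    (hf : LocallyIntegrable f) : ContDiff ℝ ∞ (ρ ⋆ f) :=
  hρc.contDiff_convolution_left (n := ⊤) _ hρ hf

theorem partialDeriv_convolution_left [CompleteSpace G] (hρ : ContDiff ℝ ∞ ρ)
    (hρc : HasCompactSupport ρ) {f : (𝔼 N) → G} (hf : LocallyIntegrable f) (j : Fin N) :
    partialDeriv j (ρ ⋆ f) = partialDeriv j ρ ⋆ f := by
  ext1 x
  have hderiv := hρc.hasFDerivAt_convolution_left (ContinuousLinearMap.lsmul ℝ ℝ)
    (hρ.of_le (by simp)) hf x
  have hint := (hρc.fderiv ℝ).convolutionExists_left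
    ((ContinuousLinearMap.lsmul ℝ ℝ).precompL (𝔼 N)) (hρ.continuous_fderiv (by simp)) hf x
  rw [partialDeriv, hderiv.fderiv, convolution_def, ContinuousLinearMap.integral_apply hint]
  rfl

theorem partialDeriv_convolution_right [CompleteSpace G] (hρ : LocallyIntegrable ρ)
    {f : (𝔼 N) → G} (hf : ContDiff ℝ ∞ f) (hfc : HasCompactSupport f) (j : Fin N) :
    partialDeriv j (ρ ⋆ f) = ρ ⋆ partialDeriv j f := by
  ext1 x
  have hderiv := hfc.hasFDerivAt_convolution_right (ContinuousLinearMap.lsmul ℝ ℝ)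
    hρ (hf.of_le (by simp)) x
  have hint := (hfc.fderiv ℝ).convolutionExists_right
    ((ContinuousLinearMap.lsmul ℝ ℝ).precompR (𝔼 N)) hρ (hf.continuous_fderiv (by simp)) x
  rw [partialDeriv, hderiv.fderiv, convolution_def, ContinuousLinearMap.integral_apply hint]
  rfl

theorem listDeriv_convolution_left [CompleteSpace G] (hρ : ContDiff ℝ ∞ ρ)
    (hρc : HasCompactSupport ρ) {f : (𝔼 N) → G} (hf : LocallyIntegrable f) (L : List (Fin N)) :
    listDeriv L (ρ ⋆ f) = listDeriv L ρ ⋆ f := by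
  induction L with
  | nil => rfl
  | cons i L ih =>
    rw [listDeriv_cons, ih, partialDeriv_convolution_left (contDiff_listDeriv hρ L)
      (hasCompactSupport_listDeriv hρc L) hf, listDeriv_cons]

theorem listDeriv_convolution_right [CompleteSpace G] (hρ : LocallyIntegrable ρ)
    {f : (𝔼 N) → G} (hf : ContDiff ℝ ∞ f) (hfc : HasCompactSupport f) (L : List (Fin N)) :
    listDeriv L (ρ ⋆ f) = ρ ⋆ listDeriv L f := by
  induction L with
  | nil => rfl
  | cons i L ih =>
    rw [listDeriv_cons, ih, partialDeriv_convolution_right hρ (contDiff_listDeriv hf L)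
      (hasCompactSupport_listDeriv hfc L), listDeriv_cons]

theorem tsupport_convolution_subset_cthickening {ε : ℝ}
    (hρ : Function.support ρ ⊆ Metric.closedBall 0 ε)
    {f : (𝔼 N) → G} {K : Set (𝔼 N)} (hf : Function.support f ⊆ K) :
    tsupport (ρ ⋆ f) ⊆ Metric.cthickening ε K := by
  refine closure_minimal (fun x hx => ?_) Metric.isClosed_cthickening
  obtain ⟨t, ht, y, hy, rfl⟩ := support_convolution_subset _ hx
  refine Metric.mem_cthickening_of_dist_le _ y ε K (hf hy) ?_
  simpa [dist_eq_norm] using hρ ht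

theorem norm_convolution_le (hρ : ∀ x, 0 ≤ ρ x) (hρ_int : ∫ x, ρ x = 1) {f : (𝔼 N) → G} {M : ℝ}
    (hf : ∀ x, ‖f x‖ ≤ M) (x : 𝔼 N) : ‖(ρ ⋆ f) x‖ ≤ M := by
  have hle : ‖(ρ ⋆ f) x‖ ≤ ∫ t, ρ t * M := by
    refine norm_integral_le_of_norm_le ((integrable_of_integral_eq_one hρ_int).mul_const M)
      (.of_forall fun t => ?_)
    rw [ContinuousLinearMap.lsmul_apply, norm_smul, Real.norm_of_nonneg (hρ t)]
    exact mul_le_mul_of_nonneg_left (hf _) (hρ t)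
  rwa [integral_mul_const, hρ_int, one_mul] at hle

section Symmetry

variable {G₁ G₂ W : Type*} [NormedAddCommGroup G₁] [NormedSpace ℝ G₁]
  [NormedAddCommGroup G₂] [NormedSpace ℝ G₂] [NormedAddCommGroup W] [NormedSpace ℝ W]

theorem integrable_prod_smul_bilin (B : G₁ →L[ℝ] G₂ →L[ℝ] W) (hρ : Continuous ρ)
    (hρc : HasCompactSupport ρ) {v : (𝔼 N) → G₁} {f : (𝔼 N) → G₂} (hv : Integrable v)
    (hf : Integrable f) :
    Integrable (fun p : (𝔼 N) × (𝔼 N) => ρ (p.1 - p.2) • B (v p.1) (f p.2))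
      (volume.prod volume) := by
  obtain ⟨R, hR⟩ := hρ.bounded_above_of_compact_support hρc
  refine ((hv.norm.mul_prod hf.norm).const_mul (R * ‖B‖)).mono' ?_ (.of_forall fun p => ?_)
  · exact (hρ.comp (continuous_fst.sub continuous_snd)).aestronglyMeasurable.smul
      (isBoundedBilinearMap_apply.continuous.comp_aestronglyMeasurable
        ((B.continuous.comp_aestronglyMeasurable hv.aestronglyMeasurable.comp_fst).prodMk
          hf.aestronglyMeasurable.comp_snd))
  · rw [norm_smul]
    calc ‖ρ (p.1 - p.2)‖ * ‖B (v p.1) (f p.2)‖ ≤ R * (‖B‖ * ‖v p.1‖ * ‖f p.2‖) := by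
          gcongr
          · exact (norm_nonneg _).trans (hR 0)
          · exact hR _
          · exact B.le_opNorm₂ _ _
      _ = R * ‖B‖ * (‖v p.1‖ * ‖f p.2‖) := by ring

theorem integral_bilin_convolution_comm [CompleteSpace G₁] [CompleteSpace G₂] [CompleteSpace W]
    (B : G₁ →L[ℝ] G₂ →L[ℝ] W) (hρ : Continuous ρ) (hρc : HasCompactSupport ρ)
    (hρ_even : ∀ x, ρ (-x) = ρ x) {v : (𝔼 N) → G₁} {f : (𝔼 N) → G₂} (hv : Integrable v)
    (hf : Integrable f) : ∫ x, B (v x) ((ρ ⋆ f) x) = ∫ x, B ((ρ ⋆ v) x) (f x) := by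
  have hright (x : 𝔼 N) : B (v x) ((ρ ⋆ f) x) = ∫ y, ρ (x - y) • B (v x) (f y) := by
    rw [convolution_eq_swap, ← ContinuousLinearMap.integral_comp_comm _
      (hρc.convolutionExists_left _ hρ hf.locallyIntegrable x).integrable_swap]
    simp
  have hleft (y : 𝔼 N) : B ((ρ ⋆ v) y) (f y) = ∫ x, ρ (x - y) • B (v x) (f y) := by
    rw [convolution_eq_swap, ← ContinuousLinearMap.flip_apply,
      ← ContinuousLinearMap.integral_comp_comm _
        (hρc.convolutionExists_left _ hρ hv.locallyIntegrable y).integrable_swap]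
    refine integral_congr_ae (.of_forall fun x => ?_)
    simp [← hρ_even (x - y)]
  simp only [hright, hleft]
  exact integral_integral_swap (integrable_prod_smul_bilin B hρ hρc hv hf)

end Symmetry

end Convolution

section Mollifier

variable {N : ℕ}

/-- The standard family of mollifiers `ρ_ε(x) = ε^{-N} ρ(x / ε)`, where `ρ` is an even bump
function supported in the unit ball. Meaningful for `ε > 0`. -/
def mollifier (N : ℕ) (ε : ℝ) : (𝔼 N) → ℝ :=
  fun x => (ε ^ N)⁻¹ *
    (⟨1 / 2, 1, by norm_num, by norm_num⟩ : ContDiffBump (0 : 𝔼 N)).normed volume (ε⁻¹ • x)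

theorem mollifier_eq_scale (ε : ℝ) (x : 𝔼 N) :
    mollifier N ε x = (ε ^ N)⁻¹ * mollifier N 1 (ε⁻¹ • x) := by
  simp [mollifier]

theorem contDiff_mollifier (ε : ℝ) : ContDiff ℝ ∞ (mollifier N ε) :=
  contDiff_const.mul ((ContDiffBump.contDiff_normed _).comp (contDiff_const_smul _))

theorem mollifier_neg (ε : ℝ) (x : 𝔼 N) : mollifier N ε (-x) = mollifier N ε x := by
  simp only [mollifier, smul_neg, ContDiffBump.normed_neg]

variable {ε : ℝ}

theorem mollifier_nonneg (hε : 0 < ε) (x : 𝔼 N) : 0 ≤ mollifier N ε x :=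
  mul_nonneg (by positivity) (ContDiffBump.nonneg_normed _ _)

theorem tsupport_mollifier_subset (hε : 0 < ε) :
    tsupport (mollifier N ε) ⊆ Metric.closedBall 0 ε := by
  refine closure_minimal (fun x hx => ?_) Metric.isClosed_closedBall
  have hmem : ε⁻¹ • x ∈ Metric.ball (0 : 𝔼 N) 1 := by
    have := Function.mem_support.2 (right_ne_zero_of_mul hx)
    rwa [ContDiffBump.support_normed_eq] at this
  rw [mem_ball_zero_iff, norm_smul, norm_inv, Real.norm_of_nonneg hε.le, inv_mul_lt_iff₀ hε,
    mul_one] at hmem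
  exact mem_closedBall_zero_iff.2 hmem.le

theorem hasCompactSupport_mollifier (hε : 0 < ε) : HasCompactSupport (mollifier N ε) :=
  (isCompact_closedBall 0 ε).of_isClosed_subset (isClosed_tsupport _)
    (tsupport_mollifier_subset hε)

theorem integral_mollifier (hε : 0 < ε) : ∫ x, mollifier N ε x = 1 := by
  simp only [mollifier]
  rw [integral_const_mul, Measure.integral_comp_inv_smul_of_nonneg _ _ hε.le,
    ContDiffBump.integral_normed]
  simp [hε.ne']

theorem lintegral_enorm_mollifier (hε : 0 < ε) : ∫⁻ x, ‖mollifier N ε x‖ₑ = 1 := by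
  rw [← ofReal_integral_norm_eq_lintegral_enorm
    (integrable_of_integral_eq_one (integral_mollifier hε))]
  simp [Real.norm_of_nonneg (mollifier_nonneg hε _), integral_mollifier hε]

theorem partialDeriv_mollifier (j : Fin N) (x : 𝔼 N) : partialDeriv j (mollifier N ε) x =
    (ε ^ N)⁻¹ * (ε⁻¹ * partialDeriv j (mollifier N 1) (ε⁻¹ • x)) := by
  have hscale : HasFDerivAt (fun x : 𝔼 N => ε⁻¹ • x) (ε⁻¹ • ContinuousLinearMap.id ℝ (𝔼 N)) x :=
    (hasFDerivAt_id x).const_smul ε⁻¹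
  have hcomp := (((contDiff_mollifier 1).differentiable (by simp) _).hasFDerivAt.comp x
    hscale).const_mul (ε ^ N)⁻¹
  rw [partialDeriv, funext (mollifier_eq_scale ε)]
  simpa [partialDeriv, Function.comp_def] using
    congrArg (fun D => D (EuclideanSpace.single j 1)) hcomp.fderiv

theorem integral_norm_mul_partialDeriv_mollifier (hε : 0 < ε) (j : Fin N) :
    ∫ x, ‖x‖ * ‖partialDeriv j (mollifier N ε) x‖ =
      ∫ x, ‖x‖ * ‖partialDeriv j (mollifier N 1) x‖ := by
  have hscale (x : 𝔼 N) : ‖x‖ * ‖partialDeriv j (mollifier N ε) x‖ = (ε ^ N)⁻¹ *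
      (‖ε⁻¹ • x‖ * ‖partialDeriv j (mollifier N 1) (ε⁻¹ • x)‖) := by
    rw [partialDeriv_mollifier, norm_mul, norm_mul, norm_smul,
      Real.norm_of_nonneg (by positivity : 0 ≤ (ε ^ N)⁻¹)]
    ring
  simp only [hscale]
  rw [integral_const_mul, Measure.integral_comp_inv_smul_of_nonneg volume
    (fun x => ‖x‖ * ‖partialDeriv j (mollifier N 1) x‖) hε.le]
  simp [hε.ne']

theorem exists_lintegral_enorm_mul_partialDeriv_mollifier_le (N : ℕ) :
    ∃ C : ℝ≥0, ∀ ε > 0, ∀ j : Fin N,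
      ∫⁻ x, ‖x‖ₑ * ‖partialDeriv j (mollifier N ε) x‖ₑ ≤ C := by
  have hint (ε : ℝ) (hε : 0 < ε) (j : Fin N) :
      Integrable fun x => ‖x‖ * ‖partialDeriv j (mollifier N ε) x‖ :=
    (continuous_norm.mul (contDiff_partialDeriv
      (contDiff_mollifier ε) j).continuous.norm).integrable_of_hasCompactSupport
      (hasCompactSupport_partialDeriv (hasCompactSupport_mollifier hε) j).norm.mul_left
  let c (j : Fin N) : ℝ := ∫ x, ‖x‖ * ‖partialDeriv j (mollifier N 1) x‖
  refine ⟨∑ j, (c j).toNNReal, fun ε hε j => ?_⟩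
  calc ∫⁻ x, ‖x‖ₑ * ‖partialDeriv j (mollifier N ε) x‖ₑ
      = ENNReal.ofReal (c j) := by
        rw [show c j = _ from (integral_norm_mul_partialDeriv_mollifier hε j).symm]
        simpa only [norm_mul, norm_norm, enorm_mul, enorm_norm] using
          (ofReal_integral_norm_eq_lintegral_enorm (hint ε hε j)).symm
    _ ≤ ((∑ j, (c j).toNNReal : ℝ≥0) : ℝ≥0∞) :=
        ENNReal.coe_le_coe.2 (Finset.single_le_sum (f := fun j => (c j).toNNReal)
          (fun _ _ => zero_le) (Finset.mem_univ j))

variable {G : Type*} [NormedAddCommGroup G] [NormedSpace ℝ G]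

theorem lintegral_enorm_mollifier_convolution_le (hε : 0 < ε) {f : (𝔼 N) → G}
    (hf : AEStronglyMeasurable f) : ∫⁻ x, ‖(mollifier N ε ⋆ f) x‖ₑ ≤ ∫⁻ x, ‖f x‖ₑ := by
  simpa only [lintegral_enorm_mollifier hε, one_mul] using
    lintegral_enorm_convolution_le (contDiff_mollifier ε).continuous.aestronglyMeasurable hf

theorem contDiff_mollifier_convolution (hε : 0 < ε) {f : (𝔼 N) → G} (hf : LocallyIntegrable f) :
    ContDiff ℝ ∞ (mollifier N ε ⋆ f) :=
  contDiff_convolution (contDiff_mollifier ε) (hasCompactSupport_mollifier hε) hf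

theorem tsupport_mollifier_convolution_subset (hε : 0 < ε) {f : (𝔼 N) → G} {K : Set (𝔼 N)}
    (hf : Function.support f ⊆ K) :
    tsupport (mollifier N ε ⋆ f) ⊆ Metric.cthickening ε K :=
  tsupport_convolution_subset_cthickening
    ((subset_tsupport _).trans (tsupport_mollifier_subset hε)) hf

variable [CompleteSpace G]

theorem eventually_norm_mollifier_convolution_sub_le {φ : (𝔼 N) → G} (hφ : UniformContinuous φ)
    {r : ℝ} (hr : 0 < r) : ∀ᶠ ε in 𝓝[>] 0, ∀ x, ‖(mollifier N ε ⋆ φ) x - φ x‖ ≤ r := by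
  obtain ⟨δ, hδ, hφδ⟩ := Metric.uniformContinuous_iff.1 hφ r hr
  filter_upwards [Ioo_mem_nhdsGT hδ] with ε hε x
  rw [← dist_eq_norm]
  refine dist_convolution_le (R := δ) hr.le (fun t ht => ?_) (mollifier_nonneg hε.1)
    (integral_mollifier hε.1) hφ.continuous.aestronglyMeasurable fun y hy => (hφδ hy).le
  exact Metric.closedBall_subset_ball hε.2 (tsupport_mollifier_subset hε.1 (subset_tsupport _ ht))

theorem tendsto_lintegral_mollifier_convolution_sub_of_continuous {φ : (𝔼 N) → G}
    (hφ : Continuous φ) (hφc : HasCompactSupport φ) :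
    Tendsto (fun ε => ∫⁻ x, ‖(mollifier N ε ⋆ φ) x - φ x‖ₑ) (𝓝[>] 0) (𝓝 0) := by
  let K := Metric.cthickening 1 (tsupport φ)
  have hK : IsCompact K := IsCompact.cthickening hφc
  rw [ENNReal.tendsto_nhds_zero]
  intro η hη
  obtain ⟨r, hr, hrη⟩ :=
    ENNReal.exists_nnreal_pos_mul_lt (hK.measure_lt_top (μ := volume)).ne hη.ne'
  filter_upwards [eventually_norm_mollifier_convolution_sub_le (r := r)
    (hφc.uniformContinuous_of_continuous hφ) hr, Ioo_mem_nhdsGT one_pos] with ε hε hε1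
  refine le_trans ?_ hrη.le
  rw [← setLIntegral_const, ← lintegral_indicator hK.measurableSet]
  refine lintegral_mono fun x => ?_
  by_cases hx : x ∈ K
  · rw [Set.indicator_of_mem hx]
    exact enorm_le_coe.2 (hε x)
  · have hφx : φ x = 0 :=
      image_eq_zero_of_notMem_tsupport fun h => hx (Metric.self_subset_cthickening _ h)
    have hconv : (mollifier N ε ⋆ φ) x = 0 := image_eq_zero_of_notMem_tsupport fun h =>
      hx (Metric.cthickening_mono hε1.2.le _
        (tsupport_mollifier_convolution_subset hε1.1 (subset_tsupport φ) h))
    simp [hφx, hconv]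

theorem tendsto_lintegral_mollifier_convolution_sub {f : (𝔼 N) → G} (hf : Integrable f) :
    Tendsto (fun ε => ∫⁻ x, ‖(mollifier N ε ⋆ f) x - f x‖ₑ) (𝓝[>] 0) (𝓝 0) := by
  rw [ENNReal.tendsto_nhds_zero]
  intro η hη
  have hη3 : η / 3 ≠ 0 := by simp [hη.ne']
  obtain ⟨φ, hφc, hφ, hφ_cont, hφ_int⟩ := hf.exists_hasCompactSupport_lintegral_sub_le hη3
  filter_upwards [ENNReal.tendsto_nhds_zero.1
    (tendsto_lintegral_mollifier_convolution_sub_of_continuous hφ_cont hφc) _ hη3.bot_lt,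
    self_mem_nhdsWithin] with ε hε (hε0 : 0 < ε)
  have hsub : AEStronglyMeasurable (f - φ) := (hf.sub hφ_int).aestronglyMeasurable
  have hconv : AEStronglyMeasurable (mollifier N ε ⋆ (f - φ)) :=
    (contDiff_mollifier_convolution hε0
      (hf.sub hφ_int).locallyIntegrable).continuous.aestronglyMeasurable
  have hsplit (x : 𝔼 N) : (mollifier N ε ⋆ f) x - f x =
      (mollifier N ε ⋆ (f - φ)) x + ((mollifier N ε ⋆ φ) x - φ x) - (f - φ) x := by
    rw [convolution_sub (contDiff_mollifier ε).continuous (hasCompactSupport_mollifier hε0)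
      hf.locallyIntegrable hφ_int.locallyIntegrable]
    simp only [Pi.sub_apply]
    abel
  calc ∫⁻ x, ‖(mollifier N ε ⋆ f) x - f x‖ₑ
      ≤ ∫⁻ x, (‖(mollifier N ε ⋆ (f - φ)) x‖ₑ + ‖(mollifier N ε ⋆ φ) x - φ x‖ₑ +
          ‖(f - φ) x‖ₑ) := lintegral_mono fun x => by
        rw [hsplit]
        exact enorm_sub_le.trans (by gcongr; exact enorm_add_le _ _)
    _ = (∫⁻ x, ‖(mollifier N ε ⋆ (f - φ)) x‖ₑ) + (∫⁻ x, ‖(mollifier N ε ⋆ φ) x - φ x‖ₑ) +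
          ∫⁻ x, ‖(f - φ) x‖ₑ := by
        rw [lintegral_add_right' _ hsub.enorm, lintegral_add_left' hconv.enorm]
    _ ≤ η / 3 + η / 3 + η / 3 := by
        gcongr
        · exact (lintegral_enorm_mollifier_convolution_le hε0 hsub).trans hφ
        · exact hφ
    _ = η := ENNReal.add_thirds η

end Mollifier

/-! ### Commutators of convolution and multiplication -/

theorem enorm_sub_sub_le_of_lipschitzWith {N : ℕ} {G : Type*} [NormedAddCommGroup G]
    {a : (𝔼 N) → G} {L : ℝ≥0} (ha : LipschitzWith L a)
    (x t : 𝔼 N) : ‖a x - a (x - t)‖ₑ ≤ L * ‖t‖ₑ := by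
  simpa [edist_eq_enorm_sub] using ha x (x - t)

section Commutator

variable {N : ℕ} {G G' : Type*} [NormedAddCommGroup G] [NormedSpace ℝ G]
  [NormedAddCommGroup G'] [NormedSpace ℝ G'] {ρ : (𝔼 N) → ℝ}

/-- The commutator `a (ρ ⋆ f) - ρ ⋆ (a f)` of multiplication by `a` and convolution with `ρ`. -/
def convComm (ρ : (𝔼 N) → ℝ) (a : (𝔼 N) → G →L[ℝ] G') (f : (𝔼 N) → G) : (𝔼 N) → G' :=
  fun x => a x ((ρ ⋆ f) x) - (ρ ⋆ fun y => a y (f y)) x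

theorem continuous_convComm (hρ : Continuous ρ) (hρc : HasCompactSupport ρ)
    {a : (𝔼 N) → G →L[ℝ] G'} (ha : Continuous a) {f : (𝔼 N) → G} (hf : Continuous f) :
    Continuous (convComm ρ a f) :=
  (ha.clm_apply (hρc.continuous_convolution_left _ hρ hf.locallyIntegrable)).sub
    (hρc.continuous_convolution_left _ hρ (ha.clm_apply hf).locallyIntegrable)

theorem convComm_sub (hρ : Continuous ρ) (hρc : HasCompactSupport ρ)
    {a : (𝔼 N) → G →L[ℝ] G'} (ha : Continuous a) {f g : (𝔼 N) → G} (hf : Continuous f)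
    (hg : Continuous g) :
    convComm ρ a (f - g) = convComm ρ a f - convComm ρ a g := by
  have hsub : (fun y => a y ((f - g) y)) = (fun y => a y (f y)) - fun y => a y (g y) :=
    funext fun y => map_sub (a y) (f y) (g y)
  ext x
  rw [convComm, hsub, convolution_sub hρ hρc hf.locallyIntegrable hg.locallyIntegrable,
    convolution_sub hρ hρc (ha.clm_apply hf).locallyIntegrable (ha.clm_apply hg).locallyIntegrable]
  simp only [Pi.sub_apply, map_sub, convComm]
  abel

variable [CompleteSpace G] [CompleteSpace G']

theorem convComm_eq_integral (hρ : Continuous ρ) (hρc : HasCompactSupport ρ)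
    {a : (𝔼 N) → G →L[ℝ] G'} (ha : Continuous a) {f : (𝔼 N) → G} (hf : Continuous f) (x : 𝔼 N) :
    convComm ρ a f x = ∫ t, (ρ t • (a x - a (x - t))) (f (x - t)) := by
  have hint := hρc.convolutionExists_left (ContinuousLinearMap.lsmul ℝ ℝ) hρ
    (hf.locallyIntegrable (μ := volume)) x
  have hint' := hρc.convolutionExists_left (ContinuousLinearMap.lsmul ℝ ℝ) hρ
    ((ha.clm_apply hf).locallyIntegrable (μ := volume)) x
  rw [convComm, convolution_def, convolution_def, ← ContinuousLinearMap.integral_comp_comm _ hint,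
    ← integral_sub ((a x).integrable_comp hint) hint']
  simp [smul_sub]

theorem lintegral_convComm_le (hρ : Continuous ρ) (hρc : HasCompactSupport ρ)
    {a : (𝔼 N) → G →L[ℝ] G'} {L : ℝ≥0} (ha : LipschitzWith L a) {f : (𝔼 N) → G}
    (hf : Continuous f) :
    ∫⁻ x, ‖convComm ρ a f x‖ₑ ≤ L * (∫⁻ t, ‖t‖ₑ * ‖ρ t‖ₑ) * ∫⁻ x, ‖f x‖ₑ := by
  have hk : Measurable fun t : 𝔼 N => ‖t‖ₑ * ‖ρ t‖ₑ :=
    continuous_enorm.measurable.mul hρ.enorm.measurable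
  simp only [convComm_eq_integral hρ hρc ha.continuous hf]
  rw [← lintegral_const_mul _ hk]
  refine lintegral_enorm_integral_le (hk.const_mul _).aemeasurable hf.aestronglyMeasurable
    fun x t => ?_
  refine (ContinuousLinearMap.le_opENorm _ _).trans ?_
  rw [enorm_smul, ← mul_assoc, mul_comm ‖ρ t‖ₑ]
  gcongr
  exact enorm_sub_sub_le_of_lipschitzWith ha x t

theorem convComm_partialDeriv_eq_integral (hρ : ContDiff ℝ ∞ ρ) (hρc : HasCompactSupport ρ)
    {a : (𝔼 N) → G →L[ℝ] G'} (ha : ContDiff ℝ ∞ a) {f : (𝔼 N) → G} (hf : ContDiff ℝ ∞ f)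
    (j : Fin N) (x : 𝔼 N) :
    convComm ρ a (partialDeriv j f) x = ∫ t,
      (partialDeriv j ρ t • (a x - a (x - t)) + ρ t • partialDeriv j a (x - t)) (f (x - t)) := by
  have hf_sub : ContDiff ℝ ∞ fun t => f (x - t) := hf.comp (contDiff_const.sub contDiff_id)
  have ha_sub : ContDiff ℝ ∞ fun t => a (x - t) := ha.comp (contDiff_const.sub contDiff_id)
  have ha_diff : ContDiff ℝ ∞ fun t => a x - a (x - t) := contDiff_const.sub ha_sub
  have hderiv (t : 𝔼 N) : partialDeriv j (fun t => ρ t • (a x - a (x - t))) t =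
      partialDeriv j ρ t • (a x - a (x - t)) + ρ t • partialDeriv j a (x - t) := by
    have ha_deriv : fderiv ℝ (fun t => a x - a (x - t)) t (EuclideanSpace.single j 1) =
        partialDeriv j a (x - t) := by
      rw [fderiv_const_sub, neg_apply]
      exact neg_eq_iff_eq_neg.2 (congrFun (partialDeriv_comp_sub_left ha x j) t)
    rw [partialDeriv, fderiv_fun_smul (hρ.differentiable (by simp) t)
      (ha_diff.differentiable (by simp) t)]
    simp [ha_deriv, partialDeriv, add_comm]
  have hprod : ContDiff ℝ ∞ fun t => ρ t • (a x - a (x - t)) := hρ.smul ha_diff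
  have hprodc : HasCompactSupport fun t => ρ t • (a x - a (x - t)) := hρc.smul_right
  have hparts := integral_bilin_partialDeriv (ContinuousLinearMap.id ℝ (G →L[ℝ] G')).flip
    hf_sub hprod hprodc j
  rw [convComm_eq_integral hρ.continuous hρc ha.continuous (contDiff_partialDeriv hf j).continuous]
  simp only [partialDeriv_comp_sub_left hf, hderiv, ContinuousLinearMap.flip_apply,
    ContinuousLinearMap.id_apply, map_neg, neg_apply, integral_neg, neg_neg] at hparts
  exact hparts.symm

/-- Integrating by parts, the derivative falls on `ρ`, whose singularity is compensated by the
Lipschitz continuity of `a`. -/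
theorem lintegral_convComm_partialDeriv_le (hρ : ContDiff ℝ ∞ ρ) (hρc : HasCompactSupport ρ)
    {a : (𝔼 N) → G →L[ℝ] G'} {L : ℝ≥0} (ha : LipschitzWith L a) (ha_smooth : ContDiff ℝ ∞ a)
    {f : (𝔼 N) → G} (hf : ContDiff ℝ ∞ f) (j : Fin N) :
    ∫⁻ x, ‖convComm ρ a (partialDeriv j f) x‖ₑ ≤
      L * ((∫⁻ t, ‖t‖ₑ * ‖partialDeriv j ρ t‖ₑ) + ∫⁻ t, ‖ρ t‖ₑ) * ∫⁻ x, ‖f x‖ₑ := by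
  have hk : Measurable fun t : 𝔼 N => ‖t‖ₑ * ‖partialDeriv j ρ t‖ₑ :=
    continuous_enorm.measurable.mul (contDiff_partialDeriv hρ j).continuous.enorm.measurable
  have hkρ : Measurable fun t : 𝔼 N => ‖t‖ₑ * ‖partialDeriv j ρ t‖ₑ + ‖ρ t‖ₑ :=
    hk.add hρ.continuous.enorm.measurable
  have ha_deriv (y : 𝔼 N) : ‖partialDeriv j a y‖ₑ ≤ L := by
    refine enorm_le_coe.2 ((ContinuousLinearMap.le_opNorm _ _).trans ?_)
    simpa using norm_fderiv_le_of_lipschitz ℝ ha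
  simp only [convComm_partialDeriv_eq_integral hρ hρc ha_smooth hf]
  rw [← lintegral_add_left hk, ← lintegral_const_mul _ hkρ]
  refine lintegral_enorm_integral_le (hkρ.const_mul _).aemeasurable
    hf.continuous.aestronglyMeasurable fun x t => ?_
  refine (ContinuousLinearMap.le_opENorm _ _).trans ?_
  gcongr
  calc ‖partialDeriv j ρ t • (a x - a (x - t)) + ρ t • partialDeriv j a (x - t)‖ₑ
      ≤ ‖partialDeriv j ρ t‖ₑ * ‖a x - a (x - t)‖ₑ + ‖ρ t‖ₑ * ‖partialDeriv j a (x - t)‖ₑ := by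
        simpa only [enorm_smul] using enorm_add_le (partialDeriv j ρ t • (a x - a (x - t)))
          (ρ t • partialDeriv j a (x - t))
    _ ≤ ‖partialDeriv j ρ t‖ₑ * (L * ‖t‖ₑ) + ‖ρ t‖ₑ * L := by
        gcongr
        · exact enorm_sub_sub_le_of_lipschitzWith ha x t
        · exact ha_deriv _
    _ = L * (‖t‖ₑ * ‖partialDeriv j ρ t‖ₑ + ‖ρ t‖ₑ) := by ring

theorem lintegral_convComm_mollifier_le {ε : ℝ} (hε : 0 < ε) {a : (𝔼 N) → G →L[ℝ] G'} {L : ℝ≥0}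
    (ha : LipschitzWith L a) {f : (𝔼 N) → G} (hf : Continuous f) :
    ∫⁻ x, ‖convComm (mollifier N ε) a f x‖ₑ ≤ L * ENNReal.ofReal ε * ∫⁻ x, ‖f x‖ₑ := by
  have hmoment : ∫⁻ t : 𝔼 N, ‖t‖ₑ * ‖mollifier N ε t‖ₑ ≤ ENNReal.ofReal ε := by
    rw [← mul_one (ENNReal.ofReal ε), ← lintegral_enorm_mollifier (N := N) hε,
      ← lintegral_const_mul _ (contDiff_mollifier ε).continuous.enorm.measurable]
    refine lintegral_mono fun t => ?_
    by_cases ht : t ∈ tsupport (mollifier N ε)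
    · gcongr
      rw [← ofReal_norm]
      exact ENNReal.ofReal_le_ofReal (by simpa using tsupport_mollifier_subset hε ht)
    · simp [image_eq_zero_of_notMem_tsupport ht]
  refine (lintegral_convComm_le (contDiff_mollifier ε).continuous
    (hasCompactSupport_mollifier hε) ha hf).trans ?_
  gcongr

end Commutator

section Poincare

variable {N : ℕ} {G : Type*} [NormedAddCommGroup G] [NormedSpace ℝ G] [CompleteSpace G]
  {R : ℝ} {f : (𝔼 N) → G}

theorem enorm_le_lintegral_partialDeriv (hf : ContDiff ℝ ∞ f)
    (hs : tsupport f ⊆ Metric.closedBall 0 R) (j : Fin N) (x : 𝔼 N) :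
    ‖f x‖ₑ ≤ ∫⁻ t in Set.Ioc 0 (2 * R + 1),
      ‖partialDeriv j f (x + t • EuclideanSpace.single j 1)‖ₑ := by
  set e : 𝔼 N := EuclideanSpace.single j 1
  by_cases hx : x ∈ Metric.closedBall (0 : 𝔼 N) R
  swap
  · simp [image_eq_zero_of_notMem_tsupport fun h => hx (hs h)]
  rw [mem_closedBall_zero_iff] at hx
  have hR : 0 ≤ R := (norm_nonneg x).trans hx
  have hend : f (x + (2 * R + 1) • e) = 0 := by
    refine image_eq_zero_of_notMem_tsupport fun h => ?_
    have hnorm := norm_sub_le (x + (2 * R + 1) • e) x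
    rw [add_sub_cancel_left, norm_smul, PiLp.norm_single, norm_one, mul_one,
      Real.norm_of_nonneg (by linarith)] at hnorm
    linarith [mem_closedBall_zero_iff.1 (hs h)]
  have hderiv (t : ℝ) : HasDerivAt (fun t : ℝ => f (x + t • e)) (partialDeriv j f (x + t • e)) t :=
    (hf.differentiable (by simp) (x + t • e)).hasFDerivAt.comp_hasDerivAt t
      (by simpa using ((hasDerivAt_id t).smul_const e).const_add x)
  have hcont : Continuous fun t : ℝ => partialDeriv j f (x + t • e) :=
    (contDiff_partialDeriv hf j).continuous.comp (by fun_prop)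
  have hftc := intervalIntegral.integral_eq_sub_of_hasDerivAt (a := 0) (b := 2 * R + 1)
    (fun t _ => hderiv t) (hcont.intervalIntegrable _ _)
  rw [hend, zero_smul, add_zero, zero_sub, intervalIntegral.integral_of_le (by linarith)] at hftc
  rw [← enorm_neg, ← hftc]
  exact enorm_integral_le_lintegral_enorm _

theorem lintegral_enorm_le_partialDeriv (hf : ContDiff ℝ ∞ f)
    (hs : tsupport f ⊆ Metric.closedBall 0 R) (j : Fin N) :
    ∫⁻ x, ‖f x‖ₑ ≤ ENNReal.ofReal (2 * R + 1) * ∫⁻ x, ‖partialDeriv j f x‖ₑ := by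
  have hmeas : Measurable fun p : (𝔼 N) × ℝ =>
      ‖partialDeriv j f (p.1 + p.2 • EuclideanSpace.single j 1)‖ₑ :=
    ((contDiff_partialDeriv hf j).continuous.comp (by fun_prop)).enorm.measurable
  refine (lintegral_mono (enorm_le_lintegral_partialDeriv hf hs j)).trans_eq ?_
  rw [lintegral_lintegral_swap hmeas.aemeasurable]
  simp only [lintegral_add_right_eq_self fun x => ‖partialDeriv j f x‖ₑ]
  rw [setLIntegral_const, Real.volume_Ioc, sub_zero, mul_comm]

theorem lintegral_enorm_listDeriv_le (hf : ContDiff ℝ ∞ f)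
    (hs : tsupport f ⊆ Metric.closedBall 0 R) (j : Fin N) (L : List (Fin N)) (n : ℕ) :
    ∫⁻ x, ‖listDeriv L f x‖ₑ ≤
      ENNReal.ofReal (2 * R + 1) ^ n * ∫⁻ x, ‖listDeriv (List.replicate n j ++ L) f x‖ₑ := by
  induction n with
  | zero => simp
  | succ n ih =>
    refine ih.trans ?_
    rw [pow_succ, mul_assoc]
    gcongr
    exact lintegral_enorm_le_partialDeriv (contDiff_listDeriv hf _)
      ((tsupport_listDeriv_subset f _).trans hs) j

/-- The homogeneous seminorm `∑_{|α| = k} ‖∂^α f‖_{L¹}` of a smooth function. -/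
def derivSum (k : ℕ) (f : (𝔼 N) → G) : ℝ≥0∞ :=
  ∑ α ∈ multiIndices N k, ∫⁻ x, ‖multiDeriv α f x‖ₑ

theorem lintegral_enorm_listDeriv_le_derivSum [NeZero N] (hf : ContDiff ℝ ∞ f)
    (hs : tsupport f ⊆ Metric.closedBall 0 R) {L : List (Fin N)} {k : ℕ} (hL : L.length ≤ k) :
    ∫⁻ x, ‖listDeriv L f x‖ₑ ≤ ENNReal.ofReal (2 * R + 1) ^ (k - L.length) * derivSum k f := by
  refine (lintegral_enorm_listDeriv_le hf hs 0 L (k - L.length)).trans ?_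
  gcongr
  set L' := List.replicate (k - L.length) 0 ++ L
  have hL' : L'.length = k := by simp [L', hL]
  rw [listDeriv_eq_multiDeriv hf]
  exact Finset.single_le_sum (f := fun α => ∫⁻ x, ‖multiDeriv α f x‖ₑ) (fun _ _ => zero_le)
    (hL' ▸ count_mem_multiIndices L')

end Poincare

/-! ### The formal adjoint -/

section Adjoint

variable {N ν : ℕ} {Ω : Opens (𝔼 N)}
  {E F : Type*} [NormedAddCommGroup E] [NormedSpace ℂ E]
  [NormedAddCommGroup F] [NormedSpace ℂ F]

/-- The pairing `(y, z) ↦ conj (y z)` of the conjugate dual with `E`, as a real bilinear map. -/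
def conjPairing (E : Type*) [NormedAddCommGroup E] [NormedSpace ℂ E] :
    ConjDual E →L[ℝ] E →L[ℝ] ℂ :=
  LinearMap.mkContinuous₂
    (LinearMap.mk₂ ℝ (fun (y : ConjDual E) (z : E) => conj (y z))
      (fun y y' z => by simp)
      (fun c y z => by rw [← Complex.coe_smul, smul_apply]; simp)
      (fun y z z' => by simp)
      (fun c y z => by rw [← Complex.coe_smul, map_smulₛₗ]; simp)) 1
    (fun y z => by simpa using y.le_opNorm z)

theorem conjPairing_apply (y : ConjDual E) (z : E) : conjPairing E y z = conj (y z) := rfl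

theorem norm_conjPairing_le (y : ConjDual E) (z : E) : ‖conjPairing E y z‖ ≤ ‖y‖ * ‖z‖ := by
  simpa [conjPairing_apply] using y.le_opNorm z

theorem isBoundedBilinearMap_conjDual_comp :
    IsBoundedBilinearMap ℝ fun p : ConjDual F × (E →L[ℂ] F) => p.1.comp p.2 where
  add_left _ _ _ := by ext; simp
  smul_left _ _ _ := by ext; simp
  add_right _ _ _ := by ext; simp
  smul_right c v a := by
    ext z
    change v (c • a z) = c • v (a z)
    rw [← Complex.coe_smul, map_smulₛₗ]
    simp
  bound := ⟨1, one_pos, fun v a => by simpa using ContinuousLinearMap.opNorm_comp_le v a⟩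

theorem tsupport_conjDual_comp_subset (v : (𝔼 N) → ConjDual F) (a : (𝔼 N) → E →L[ℂ] F) :
    (tsupport fun y => (v y).comp (a y)) ⊆ tsupport v :=
  closure_mono fun y hy hvy => hy (by simp [hvy])

theorem DiffOp.adjoint_eq (A : DiffOp Ω ν E F) (v : (𝔼 N) → ConjDual F) (x : 𝔼 N) :
    A.adjoint v x = ∑ k ∈ Finset.range (ν + 1), ∑ α ∈ multiIndices N k,
      (-1 : ℝ) ^ k • multiDeriv α (fun y => (v y).comp (A.coeff α y)) x := by
  refine Finset.sum_congr rfl fun k _ => Finset.sum_congr rfl fun α _ => ?_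
  ext z
  simp

theorem sum_le_of_mem_multiIndices {α : Fin N → ℕ} {k : ℕ} (hk : k ∈ Finset.range (ν + 1))
    (hα : α ∈ multiIndices N k) : ∑ i, α i ≤ ν := by
  rw [mem_multiIndices.1 hα]
  exact Finset.mem_range_succ_iff.1 hk

theorem DiffOp.contDiff_comp_coeff (A : DiffOp Ω ν E F) {α : Fin N → ℕ} (hα : ∑ i, α i ≤ ν)
    {v : (𝔼 N) → ConjDual F} (hv : ContDiff ℝ ∞ v) (hvs : tsupport v ⊆ Ω) :
    ContDiff ℝ ∞ fun y => (v y).comp (A.coeff α y) :=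
  ContMDiff.contDiff <| contMDiff_of_tsupport fun x hx => ContDiffAt.contMDiffAt <|
    (isBoundedBilinearMap_conjDual_comp (E := E) (F := F)).contDiff.contDiffAt.comp x
      (hv.contDiffAt.prodMk ((A.smooth α hα).contDiffAt
        (Ω.isOpen.mem_nhds (hvs (tsupport_conjDual_comp_subset v _ hx)))))

theorem DiffOp.contDiff_adjoint (A : DiffOp Ω ν E F) {v : (𝔼 N) → ConjDual F}
    (hv : ContDiff ℝ ∞ v) (hvs : tsupport v ⊆ Ω) : ContDiff ℝ ∞ (A.adjoint v) := by
  rw [show A.adjoint v = _ from funext (A.adjoint_eq v)]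
  exact ContDiff.sum fun k hk => ContDiff.sum fun α hα => (contDiff_multiDeriv
    (A.contDiff_comp_coeff (sum_le_of_mem_multiIndices hk hα) hv hvs) α).const_smul _

theorem DiffOp.tsupport_adjoint_subset (A : DiffOp Ω ν E F) (v : (𝔼 N) → ConjDual F) :
    tsupport (A.adjoint v) ⊆ tsupport v := by
  refine closure_minimal (fun x hx => ?_) (isClosed_tsupport v)
  by_contra hxv
  refine hx ?_
  rw [A.adjoint_eq]
  refine Finset.sum_eq_zero fun k _ => Finset.sum_eq_zero fun α _ => ?_
  rw [image_eq_zero_of_notMem_tsupport fun h => hxv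
    (tsupport_conjDual_comp_subset v _ (tsupport_multiDeriv_subset _ α h))]
  exact smul_zero (A := ConjDual E) ((-1 : ℝ) ^ k)

theorem DiffOp.tsupport_apply_subset (A : DiffOp Ω ν E F) (w : (𝔼 N) → E) :
    tsupport (A.apply w) ⊆ tsupport w := by
  refine closure_minimal (fun x hx => ?_) (isClosed_tsupport w)
  by_contra h
  refine hx (Finset.sum_eq_zero fun k _ => Finset.sum_eq_zero fun α _ => ?_)
  rw [image_eq_zero_of_notMem_tsupport fun h' => h (tsupport_multiDeriv_subset w α h'), map_zero]

theorem DiffOp.integral_conjPairing_comp_coeff (A : DiffOp Ω ν E F) {k : ℕ} {α : Fin N → ℕ}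
    (hk : k ∈ Finset.range (ν + 1)) (hα : α ∈ multiIndices N k) {v : (𝔼 N) → ConjDual F}
    (hv : ContDiff ℝ ∞ v) (hvs : tsupport v ⊆ Ω) {w : (𝔼 N) → E} (hw : ContDiff ℝ ∞ w)
    (hwc : HasCompactSupport w) :
    ∫ x, conjPairing E ((v x).comp (A.coeff α x)) (multiDeriv α w x) =
      ∫ x, conjPairing E ((-1 : ℝ) ^ k • multiDeriv α (fun y => (v y).comp (A.coeff α y)) x)
        (w x) := by
  have hva := A.contDiff_comp_coeff (sum_le_of_mem_multiIndices hk hα) hv hvs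
  simp only [map_smul, smul_apply, integral_smul]
  rw [integral_bilin_multiDeriv _ hva hw hwc, mem_multiIndices.1 hα]

theorem DiffOp.integral_conjPairing_apply (A : DiffOp Ω ν E F) {v : (𝔼 N) → ConjDual F}
    (hv : ContDiff ℝ ∞ v) (hvs : tsupport v ⊆ Ω) {w : (𝔼 N) → E}
    (hw : ContDiff ℝ ∞ w) (hwc : HasCompactSupport w) :
    ∫ x, conjPairing F (v x) (A.apply w x) = ∫ x, conjPairing E (A.adjoint v x) (w x) := by
  have hva {k : ℕ} (hk : k ∈ Finset.range (ν + 1)) {α : Fin N → ℕ} (hα : α ∈ multiIndices N k) :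
      ContDiff ℝ ∞ fun y => (v y).comp (A.coeff α y) :=
    A.contDiff_comp_coeff (sum_le_of_mem_multiIndices hk hα) hv hvs
  have happly (x : 𝔼 N) : conjPairing F (v x) (A.apply w x) = ∑ k ∈ Finset.range (ν + 1),
      ∑ α ∈ multiIndices N k, conjPairing E ((v x).comp (A.coeff α x)) (multiDeriv α w x) := by
    simp [DiffOp.apply, conjPairing_apply]
  have hadj (x : 𝔼 N) : conjPairing E (A.adjoint v x) (w x) = ∑ k ∈ Finset.range (ν + 1),
      ∑ α ∈ multiIndices N k, conjPairing E
        ((-1 : ℝ) ^ k • multiDeriv α (fun y => (v y).comp (A.coeff α y)) x) (w x) := by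
    simp only [A.adjoint_eq, map_sum, FunLike.coe_sum, Finset.sum_apply]
  have happly_int (k) (hk : k ∈ Finset.range (ν + 1)) (α) (hα : α ∈ multiIndices N k) :
      Integrable fun x => conjPairing E ((v x).comp (A.coeff α x)) (multiDeriv α w x) :=
    integrable_bilin_of_hasCompactSupport _ (hva hk hα).continuous
      (contDiff_multiDeriv hw α).continuous (hasCompactSupport_multiDeriv hwc α)
  have hadj_int (k) (hk : k ∈ Finset.range (ν + 1)) (α) (hα : α ∈ multiIndices N k) :
      Integrable fun x => conjPairing E
        ((-1 : ℝ) ^ k • multiDeriv α (fun y => (v y).comp (A.coeff α y)) x) (w x) :=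
    integrable_bilin_of_hasCompactSupport _
      ((contDiff_multiDeriv (hva hk hα) α).const_smul ((-1 : ℝ) ^ k)).continuous hw.continuous hwc
  simp only [happly, hadj]
  rw [integral_finsetSum _ fun k hk => integrable_finsetSum _ (happly_int k hk),
    integral_finsetSum _ fun k hk => integrable_finsetSum _ (hadj_int k hk)]
  refine Finset.sum_congr rfl fun k hk => ?_
  rw [integral_finsetSum _ (happly_int k hk), integral_finsetSum _ (hadj_int k hk)]
  exact Finset.sum_congr rfl fun α hα => A.integral_conjPairing_comp_coeff hk hα hv hvs hw hwc

end Adjoint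

section Pairing

variable {N : ℕ} {G₁ G₂ W : Type*} [NormedAddCommGroup G₁] [NormedSpace ℝ G₁]
  [NormedAddCommGroup G₂] [NormedSpace ℝ G₂] [NormedAddCommGroup W] [NormedSpace ℝ W]
  {μ : Measure (𝔼 N)}

theorem integrable_bilin_of_norm_le (B : G₁ →L[ℝ] G₂ →L[ℝ] W) {v : (𝔼 N) → G₁} {M : ℝ}
    (hv : Continuous v) (hM : ∀ x, ‖v x‖ ≤ M) {f : (𝔼 N) → G₂} (hf : Integrable f μ) :
    Integrable (fun x => B (v x) (f x)) μ := by
  refine (hf.norm.const_mul (‖B‖ * M)).mono' ?_ (.of_forall fun x => ?_)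
  · exact isBoundedBilinearMap_apply.continuous.comp_aestronglyMeasurable
      ((B.continuous.comp hv).aestronglyMeasurable.prodMk hf.aestronglyMeasurable)
  · exact (B.le_opNorm₂ _ _).trans (by gcongr; exact hM x)

theorem tendsto_integral_bilin (B : G₁ →L[ℝ] G₂ →L[ℝ] W) {v : (𝔼 N) → G₁} (hv : Continuous v)
    (hvc : HasCompactSupport v) {ι : Type*} {l : Filter ι} {f : ι → (𝔼 N) → G₂} {g : (𝔼 N) → G₂}
    (hf : ∀ᶠ m in l, Integrable (f m) μ) (hg : Integrable g μ)
    (h : Tendsto (fun m => ∫⁻ x, ‖f m x - g x‖ₑ ∂μ) l (𝓝 0)) :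
    Tendsto (fun m => ∫ x, B (v x) (f m x) ∂μ) l (𝓝 (∫ x, B (v x) (g x) ∂μ)) := by
  obtain ⟨M, hM⟩ := hv.bounded_above_of_compact_support hvc
  have hM0 : 0 ≤ M := (norm_nonneg _).trans (hM 0)
  refine tendsto_integral_of_L1 _ (integrable_bilin_of_norm_le B hv hM hg).aestronglyMeasurable
    (hf.mono fun m hfm => integrable_bilin_of_norm_le B hv hM hfm) ?_
  have hlim := ENNReal.Tendsto.const_mul (a := ENNReal.ofReal (‖B‖ * M)) h
    (Or.inr ENNReal.ofReal_ne_top)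
  rw [mul_zero] at hlim
  refine tendsto_of_tendsto_of_tendsto_of_le_of_le' tendsto_const_nhds hlim
    (.of_forall fun _ => zero_le) (hf.mono fun m hfm => ?_)
  have hmeas : AEMeasurable (fun x => ‖f m x - g x‖ₑ) μ :=
    (hfm.sub hg).aestronglyMeasurable.enorm
  rw [← lintegral_const_mul'' _ hmeas]
  refine lintegral_mono fun x => ?_
  rw [← map_sub, ← ofReal_norm, ← ofReal_norm, ← ENNReal.ofReal_mul (by positivity)]
  refine ENNReal.ofReal_le_ofReal ((B.le_opNorm₂ _ _).trans ?_)
  gcongr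
  exact hM x

end Pairing

section Duality

open scoped Manifold in
theorem exists_smooth_cutoff {N : ℕ} {U : Opens (𝔼 N)} {K : Set (𝔼 N)} (hK : IsCompact K)
    (hKU : K ⊆ U) :
    ∃ χ : (𝔼 N) → ℝ, ContDiff ℝ ∞ χ ∧ HasCompactSupport χ ∧ tsupport χ ⊆ U ∧
      (∀ x, χ x ∈ Set.Icc 0 1) ∧ ∀ x ∈ K, ∀ᶠ y in 𝓝 x, χ y = 1 := by
  obtain ⟨δ, hδ, hδU⟩ := hK.exists_cthickening_subset_open U.isOpen hKU
  have hK_int : K ⊆ interior (Metric.cthickening δ K) :=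
    (Metric.self_subset_thickening hδ K).trans
      (interior_maximal (Metric.thickening_subset_cthickening δ K) Metric.isOpen_thickening)
  obtain ⟨χ, hχ1, hχ0, hχ01⟩ := exists_contMDiffMap_one_nhds_of_subset_interior (n := ⊤)
    𝓘(ℝ, 𝔼 N) hK.isClosed hK_int
  have hχs : tsupport χ ⊆ Metric.cthickening δ K :=
    closure_minimal (fun x hx => by_contra fun h => hx (hχ0 x h)) Metric.isClosed_cthickening
  exact ⟨χ, χ.contMDiff.contDiff, hK.cthickening.of_isClosed_subset (isClosed_tsupport _) hχs,
    hχs.trans hδU, hχ01, eventually_nhdsSet_iff_forall.1 hχ1⟩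

variable {N : ℕ} {F : Type*} [NormedAddCommGroup F] [NormedSpace ℂ F]

theorem exists_conjPairing_eq_norm (z : F) :
    ∃ y : ConjDual F, ‖y‖ ≤ 1 ∧ conjPairing F y z = ‖z‖ := by
  obtain ⟨e, he, hez⟩ := exists_dual_vector'' ℂ z
  refine ⟨((starL ℂ : ℂ ≃L⋆[ℂ] ℂ) : ℂ →L⋆[ℂ] ℂ).comp e, ?_, by simp [conjPairing_apply, hez]⟩
  refine ContinuousLinearMap.opNorm_le_bound _ zero_le_one fun w => ?_
  simpa using e.le_of_opNorm_le he w

open scoped Manifold in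
theorem exists_contDiff_forall_mem_of_convex {G : Type*} [NormedAddCommGroup G] [NormedSpace ℝ G]
    {t : (𝔼 N) → Set G} (ht : ∀ x, Convex ℝ (t x)) (ht_loc : ∀ x, ∃ c, ∀ᶠ y in 𝓝 x, c ∈ t y) :
    ∃ w : (𝔼 N) → G, ContDiff ℝ ∞ w ∧ ∀ x, w x ∈ t x := by
  obtain ⟨w, hw⟩ := exists_contMDiffMap_forall_mem_convex_of_local_const (n := ⊤) 𝓘(ℝ, 𝔼 N)
    ht ht_loc
  exact ⟨w, w.contMDiff.contDiff, hw⟩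

theorem exists_contDiff_norm_sub_le_re_conjPairing {f : (𝔼 N) → F} (hf : Continuous f)
    (hfc : HasCompactSupport f) {r : ℝ} (hr : 0 < r) :
    ∃ v : (𝔼 N) → ConjDual F, ContDiff ℝ ∞ v ∧ HasCompactSupport v ∧ (∀ x, ‖v x‖ ≤ 1) ∧
      ∀ x, (tsupport f).indicator (fun x => ‖f x‖ - r) x ≤ (conjPairing F (v x) (f x)).re := by
  obtain ⟨w, hw, hwf⟩ := exists_contDiff_forall_mem_of_convex
    (t := fun x => Metric.closedBall (0 : ConjDual F) 1 ∩
      {y | ‖f x‖ - r ≤ (conjPairing F y (f x)).re})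
    (fun x => (convex_closedBall 0 1).inter (convex_halfSpace_ge
      (Complex.reLm ∘ₗ ((conjPairing F).flip (f x)).toLinearMap).isLinear _))
    (fun x => by
      obtain ⟨y, hy1, hy⟩ := exists_conjPairing_eq_norm (f x)
      refine ⟨y, ?_⟩
      have hlt : ‖f x‖ - r < (conjPairing F y (f x)).re := by simp [hy, hr]
      filter_upwards [(hf.norm.sub continuous_const).continuousAt.eventually_lt
        (Complex.continuous_re.comp ((conjPairing F y).continuous.comp hf)).continuousAt hlt]
        with x' hx'
      exact ⟨mem_closedBall_zero_iff.2 hy1, hx'.le⟩)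
  obtain ⟨χ, hχ, hχc, -, hχ01, hχ1⟩ := exists_smooth_cutoff (U := ⊤) hfc (Set.subset_univ _)
  have hχw1 (x : 𝔼 N) : ‖χ x • w x‖ ≤ 1 := by
    rw [norm_smul, Real.norm_of_nonneg (hχ01 x).1]
    exact mul_le_one₀ (hχ01 x).2 (norm_nonneg _) (mem_closedBall_zero_iff.1 (hwf x).1)
  have hχwf (x : 𝔼 N) : (tsupport f).indicator (fun x => ‖f x‖ - r) x ≤
      (conjPairing F (χ x • w x) (f x)).re := by
    by_cases hx : x ∈ tsupport f
    · rw [Set.indicator_of_mem hx, (hχ1 x hx).self_of_nhds, one_smul]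
      exact (hwf x).2
    · rw [Set.indicator_of_notMem hx, image_eq_zero_of_notMem_tsupport hx, map_zero,
        Complex.zero_re]
  exact ⟨fun x => χ x • w x, hχ.smul hw, hχc.smul_right (f' := w), hχw1, hχwf⟩

theorem lintegral_enorm_le_of_forall_conjPairing {f : (𝔼 N) → F} (hf : Continuous f)
    (hfc : HasCompactSupport f) {M : ℝ≥0∞}
    (hM : ∀ v : (𝔼 N) → ConjDual F, ContDiff ℝ ∞ v → HasCompactSupport v → (∀ x, ‖v x‖ ≤ 1) →
      ‖∫ x, conjPairing F (v x) (f x)‖ₑ ≤ M) : ∫⁻ x, ‖f x‖ₑ ≤ M := by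
  rcases eq_or_ne M ⊤ with rfl | hM_top
  · exact le_top
  have hf_int : Integrable fun x => ‖f x‖ := (hf.integrable_of_hasCompactSupport hfc).norm
  have hS : volume (tsupport f) ≠ ⊤ := hfc.measure_lt_top.ne
  have hbound {r : ℝ} (hr : 0 < r) :
      ∫ x, ‖f x‖ ≤ M.toReal + volume.real (tsupport f) * r := by
    obtain ⟨v, hv, hvc, hv1, hvf⟩ := exists_contDiff_norm_sub_le_re_conjPairing hf hfc hr
    have hvf_int : Integrable fun x => conjPairing F (v x) (f x) :=
      integrable_bilin_of_hasCompactSupport _ hv.continuous hf hfc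
    have hr_int : IntegrableOn (fun _ => r) (tsupport f) := integrableOn_const hS
    have hsub_int : IntegrableOn (fun x => ‖f x‖ - r) (tsupport f) :=
      hf_int.integrableOn.sub hr_int
    have hset : ∫ x in tsupport f, ‖f x‖ = ∫ x, ‖f x‖ :=
      setIntegral_eq_integral_of_forall_compl_eq_zero fun x hx => by
        simp [image_eq_zero_of_notMem_tsupport hx]
    have hle : ∫ x in tsupport f, (‖f x‖ - r) ≤ M.toReal := by
      calc ∫ x in tsupport f, (‖f x‖ - r)
          = ∫ x, (tsupport f).indicator (fun x => ‖f x‖ - r) x :=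
            (integral_indicator (isClosed_tsupport f).measurableSet).symm
        _ ≤ ∫ x, (conjPairing F (v x) (f x)).re :=
            integral_mono (hsub_int.integrable_indicator (isClosed_tsupport f).measurableSet)
              hvf_int.re hvf
        _ = (∫ x, conjPairing F (v x) (f x)).re := integral_re hvf_int
        _ ≤ ‖∫ x, conjPairing F (v x) (f x)‖ := Complex.re_le_norm _
        _ ≤ M.toReal := by
            rw [← toReal_enorm]
            exact ENNReal.toReal_mono hM_top (hM v hv hvc hv1)
    rw [integral_sub hf_int.integrableOn hr_int, setIntegral_const, hset, smul_eq_mul] at hle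
    linarith
  have hlim : Tendsto (fun r => M.toReal + volume.real (tsupport f) * r) (𝓝[>] 0)
      (𝓝 M.toReal) := by
    refine Tendsto.mono_left ?_ nhdsWithin_le_nhds
    exact (Continuous.tendsto' (by fun_prop) _ _ (by simp))
  have hle : ∫ x, ‖f x‖ ≤ M.toReal :=
    ge_of_tendsto hlim (eventually_mem_nhdsWithin.mono fun r hr => hbound hr)
  rw [← ofReal_integral_norm_eq_lintegral_enorm (hf.integrable_of_hasCompactSupport hfc)]
  exact ENNReal.ofReal_le_of_le_toReal hle

end Duality

/-! ### Friedrichs mollification -/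

section Friedrichs

variable {N k ν : ℕ} {E F : Type*} [NormedAddCommGroup E] [NormedSpace ℂ E]
  [NormedAddCommGroup F] [NormedSpace ℂ F]

theorem DiffOp.contDiff_coeff (A : DiffOp (⊤ : Opens (𝔼 N)) ν E F) {α : Fin N → ℕ}
    (hα : ∑ i, α i ≤ ν) : ContDiff ℝ ∞ (A.coeff α) :=
  contDiffOn_univ.1 (A.smooth α hα)

theorem DiffOp.contDiff_apply (A : DiffOp (⊤ : Opens (𝔼 N)) ν E F) {w : (𝔼 N) → E}
    (hw : ContDiff ℝ ∞ w) : ContDiff ℝ ∞ (A.apply w) :=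
  ContDiff.sum fun _ hj => ContDiff.sum fun α hα =>
    isBoundedBilinearMap_apply.contDiff.comp₂ (ContinuousLinearMap.restrictScalarsL ℂ E F ℝ ℝ
      |>.contDiff.comp (A.contDiff_coeff (sum_le_of_mem_multiIndices hj hα)))
      (contDiff_multiDeriv hw α)

theorem DiffOp.hasCompactSupport_apply {Ω : Opens (𝔼 N)} (A : DiffOp Ω ν E F) {w : (𝔼 N) → E}
    (hw : HasCompactSupport w) : HasCompactSupport (A.apply w) :=
  hw.of_isClosed_subset (isClosed_tsupport _) (A.tsupport_apply_subset w)

/-- The coefficient `a_α` with values regarded as real-linear maps. -/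
def DiffOp.realCoeff {Ω : Opens (𝔼 N)} (A : DiffOp Ω ν E F) (α : Fin N → ℕ) :
    (𝔼 N) → E →L[ℝ] F :=
  fun x => (A.coeff α x).restrictScalars ℝ

/-- The coefficients of `A` are globally Lipschitz, as the Friedrichs commutator estimates
require. -/
def DiffOp.HasLipschitzCoeff {Ω : Opens (𝔼 N)} (A : DiffOp Ω ν E F) : Prop :=
  ∀ α, ∑ i, α i ≤ ν → ∃ L, LipschitzWith L (A.realCoeff α)

theorem DiffOp.contDiff_realCoeff (A : DiffOp (⊤ : Opens (𝔼 N)) ν E F) {α : Fin N → ℕ}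
    (hα : ∑ i, α i ≤ ν) : ContDiff ℝ ∞ (A.realCoeff α) :=
  (ContinuousLinearMap.restrictScalarsL ℂ E F ℝ ℝ).contDiff.comp (A.contDiff_coeff hα)

/-- The Friedrichs commutator `A(x,D)(ρ ⋆ w) - ρ ⋆ A(x,D)w`. -/
def DiffOp.commutator {Ω : Opens (𝔼 N)} (A : DiffOp Ω ν E F) (ρ : (𝔼 N) → ℝ) (w : (𝔼 N) → E) :
    (𝔼 N) → F :=
  A.apply (ρ ⋆ w) - ρ ⋆ A.apply w

variable [CompleteSpace E] [CompleteSpace F]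

theorem multiDeriv_convolution_right {ρ : (𝔼 N) → ℝ} (hρ : LocallyIntegrable ρ) {w : (𝔼 N) → E}
    (hw : ContDiff ℝ ∞ w) (hwc : HasCompactSupport w) (α : Fin N → ℕ) :
    multiDeriv α (ρ ⋆ w) = ρ ⋆ multiDeriv α w := by
  rw [multiDeriv_eq_listDeriv, listDeriv_convolution_right hρ hw hwc, multiDeriv_eq_listDeriv]

omit [CompleteSpace F] in
theorem DiffOp.commutator_eq_sum (A : DiffOp (⊤ : Opens (𝔼 N)) ν E F) {ρ : (𝔼 N) → ℝ}
    (hρ : Continuous ρ) (hρc : HasCompactSupport ρ) {w : (𝔼 N) → E} (hw : ContDiff ℝ ∞ w)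
    (hwc : HasCompactSupport w) (x : 𝔼 N) :
    A.commutator ρ w x = ∑ j ∈ Finset.range (ν + 1), ∑ α ∈ multiIndices N j,
      convComm ρ (A.realCoeff α) (multiDeriv α w) x := by
  have hterm_cont (j) (hj : j ∈ Finset.range (ν + 1)) (α) (hα : α ∈ multiIndices N j) :
      Continuous fun y => A.coeff α y (multiDeriv α w y) :=
    (A.contDiff_coeff (sum_le_of_mem_multiIndices hj hα)).continuous.clm_apply
      (contDiff_multiDeriv hw α).continuous
  have hterm_int (j) (hj : j ∈ Finset.range (ν + 1)) (α) (hα : α ∈ multiIndices N j) :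
      Integrable fun t => ρ t • A.coeff α (x - t) (multiDeriv α w (x - t)) :=
    hρc.convolutionExists_left (ContinuousLinearMap.lsmul ℝ ℝ) hρ
      (hterm_cont j hj α hα).locallyIntegrable x
  have hconv : (ρ ⋆ A.apply w) x = ∑ j ∈ Finset.range (ν + 1), ∑ α ∈ multiIndices N j,
      (ρ ⋆ fun y => A.coeff α y (multiDeriv α w y)) x := by
    simp only [convolution_def, ContinuousLinearMap.lsmul_apply, DiffOp.apply, Finset.smul_sum]
    rw [integral_finsetSum _ fun j hj => integrable_finsetSum _ (hterm_int j hj)]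
    exact Finset.sum_congr rfl fun j hj => integral_finsetSum _ (hterm_int j hj)
  simp only [DiffOp.commutator, Pi.sub_apply, hconv, DiffOp.apply, convComm,
    Finset.sum_sub_distrib, multiDeriv_convolution_right hρ.locallyIntegrable hw hwc]
  rfl

omit [CompleteSpace F] in
theorem DiffOp.lintegral_commutator_le_sum (A : DiffOp (⊤ : Opens (𝔼 N)) ν E F) {ρ : (𝔼 N) → ℝ}
    (hρ : Continuous ρ) (hρc : HasCompactSupport ρ) {w : (𝔼 N) → E} (hw : ContDiff ℝ ∞ w)
    (hwc : HasCompactSupport w) :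
    ∫⁻ x, ‖A.commutator ρ w x‖ₑ ≤ ∑ j ∈ Finset.range (ν + 1), ∑ α ∈ multiIndices N j,
      ∫⁻ x, ‖convComm ρ (A.realCoeff α) (multiDeriv α w) x‖ₑ := by
  have hmeas (j) (hj : j ∈ Finset.range (ν + 1)) (α) (hα : α ∈ multiIndices N j) :
      Measurable fun x => ‖convComm ρ (A.realCoeff α) (multiDeriv α w) x‖ₑ :=
    (continuous_convComm hρ hρc
      (A.contDiff_realCoeff (sum_le_of_mem_multiIndices hj hα)).continuous
      (contDiff_multiDeriv hw α).continuous).enorm.measurable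
  calc ∫⁻ x, ‖A.commutator ρ w x‖ₑ
      ≤ ∫⁻ x, ∑ j ∈ Finset.range (ν + 1), ∑ α ∈ multiIndices N j,
          ‖convComm ρ (A.realCoeff α) (multiDeriv α w) x‖ₑ := by
        refine lintegral_mono fun x => ?_
        rw [A.commutator_eq_sum hρ hρc hw hwc]
        exact (enorm_sum_le _ _).trans (Finset.sum_le_sum fun j _ => enorm_sum_le _ _)
    _ = _ := by
        rw [lintegral_finsetSum' _ fun j hj =>
          (Finset.measurable_fun_sum _ (hmeas j hj)).aemeasurable]
        exact Finset.sum_congr rfl fun j hj =>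
          lintegral_finsetSum' _ fun α hα => (hmeas j hj α hα).aemeasurable

omit [CompleteSpace F] in
theorem DiffOp.commutator_sub (A : DiffOp (⊤ : Opens (𝔼 N)) ν E F) {ρ : (𝔼 N) → ℝ}
    (hρ : Continuous ρ) (hρc : HasCompactSupport ρ) {w w' : (𝔼 N) → E} (hw : ContDiff ℝ ∞ w)
    (hw' : ContDiff ℝ ∞ w') (hwc : HasCompactSupport w) (hwc' : HasCompactSupport w') :
    A.commutator ρ (w - w') = A.commutator ρ w - A.commutator ρ w' := by
  ext x
  rw [Pi.sub_apply, A.commutator_eq_sum hρ hρc (w := w - w') (hw.sub hw') (hwc.sub hwc'),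
    A.commutator_eq_sum hρ hρc hw hwc, A.commutator_eq_sum hρ hρc hw' hwc',
    ← Finset.sum_sub_distrib]
  refine Finset.sum_congr rfl fun j hj => ?_
  rw [← Finset.sum_sub_distrib]
  refine Finset.sum_congr rfl fun α hα => ?_
  rw [multiDeriv_eq_listDeriv, listDeriv_sub hw hw', convComm_sub hρ hρc
    (A.contDiff_realCoeff (sum_le_of_mem_multiIndices hj hα)).continuous
    (contDiff_listDeriv hw _).continuous (contDiff_listDeriv hw' _).continuous,
    ← multiDeriv_eq_listDeriv, ← multiDeriv_eq_listDeriv]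
  rfl

theorem exists_lintegral_convComm_listDeriv_le [NeZero N] {a : (𝔼 N) → E →L[ℝ] F} {C : ℝ≥0}
    (ha : LipschitzWith C a) (ha_smooth : ContDiff ℝ ∞ a) (R : ℝ) {L : List (Fin N)}
    (hL : L.length ≤ k + 1) :
    ∃ C' : ℝ≥0, ∀ ε ∈ Set.Ioc 0 1, ∀ w : (𝔼 N) → E, ContDiff ℝ ∞ w →
      tsupport w ⊆ Metric.closedBall 0 R →
      ∫⁻ x, ‖convComm (mollifier N ε) a (listDeriv L w) x‖ₑ ≤ C' * derivSum k w := by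
  obtain ⟨C₀, hC₀⟩ := exists_lintegral_enorm_mul_partialDeriv_mollifier_le N
  cases L with
  | nil =>
    refine ⟨C * (2 * R + 1).toNNReal ^ k, fun ε hε w hw hwR => ?_⟩
    calc ∫⁻ x, ‖convComm (mollifier N ε) a w x‖ₑ
        ≤ C * ENNReal.ofReal ε * ∫⁻ x, ‖w x‖ₑ :=
          lintegral_convComm_mollifier_le hε.1 ha hw.continuous
      _ ≤ C * 1 * (ENNReal.ofReal (2 * R + 1) ^ k * derivSum k w) := by
          gcongr
          · exact ENNReal.ofReal_le_one.2 hε.2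
          · exact lintegral_enorm_listDeriv_le_derivSum hw hwR (L := []) k.zero_le
      _ = _ := by push_cast [ENNReal.ofReal]; ring
  | cons j L =>
    refine ⟨C * (C₀ + 1) * (2 * R + 1).toNNReal ^ (k - L.length), fun ε hε w hw hwR => ?_⟩
    have hLk : L.length ≤ k := Nat.le_of_succ_le_succ hL
    calc ∫⁻ x, ‖convComm (mollifier N ε) a (partialDeriv j (listDeriv L w)) x‖ₑ
        ≤ C * ((∫⁻ t, ‖t‖ₑ * ‖partialDeriv j (mollifier N ε) t‖ₑ) + ∫⁻ t, ‖mollifier N ε t‖ₑ) *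
            ∫⁻ x, ‖listDeriv L w x‖ₑ :=
          lintegral_convComm_partialDeriv_le (contDiff_mollifier ε)
            (hasCompactSupport_mollifier hε.1) ha ha_smooth (contDiff_listDeriv hw L) j
      _ ≤ C * (C₀ + 1) * (ENNReal.ofReal (2 * R + 1) ^ (k - L.length) * derivSum k w) := by
          gcongr
          · exact hC₀ ε hε.1 j
          · exact (lintegral_enorm_mollifier hε.1).le
          · exact lintegral_enorm_listDeriv_le_derivSum hw hwR hLk
      _ = _ := by push_cast [ENNReal.ofReal]; ring

theorem DiffOp.exists_lintegral_commutator_le [NeZero N]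
    (A : DiffOp (⊤ : Opens (𝔼 N)) (k + 1) E F) (hA : A.HasLipschitzCoeff) (R : ℝ) :
    ∃ C : ℝ≥0, ∀ ε ∈ Set.Ioc 0 1, ∀ w : (𝔼 N) → E, ContDiff ℝ ∞ w →
      tsupport w ⊆ Metric.closedBall 0 R →
      ∫⁻ x, ‖A.commutator (mollifier N ε) w x‖ₑ ≤ C * derivSum k w := by
  have hterm (α : Fin N → ℕ) (hα : ∑ i, α i ≤ k + 1) : ∃ C : ℝ≥0, ∀ ε ∈ Set.Ioc 0 1,
      ∀ w : (𝔼 N) → E, ContDiff ℝ ∞ w → tsupport w ⊆ Metric.closedBall 0 R →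
      ∫⁻ x, ‖convComm (mollifier N ε) (A.realCoeff α) (multiDeriv α w) x‖ₑ ≤
        C * derivSum k w := by
    obtain ⟨L, hL⟩ := hA α hα
    simp only [multiDeriv_eq_listDeriv]
    exact exists_lintegral_convComm_listDeriv_le hL (A.contDiff_realCoeff hα) R
      ((length_multiList α).trans_le hα)
  choose! C hC using hterm
  refine ⟨∑ j ∈ Finset.range (k + 1 + 1), ∑ α ∈ multiIndices N j, C α, fun ε hε w hw hwR => ?_⟩
  have hwc : HasCompactSupport w :=
    (isCompact_closedBall 0 R).of_isClosed_subset (isClosed_tsupport w) hwR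
  refine (A.lintegral_commutator_le_sum (contDiff_mollifier ε).continuous
    (hasCompactSupport_mollifier hε.1) hw hwc).trans ?_
  push_cast
  simp only [Finset.sum_mul]
  gcongr with j hj α hα
  exact hC α (sum_le_of_mem_multiIndices hj hα) ε hε w hw hwR

theorem DiffOp.tendsto_lintegral_commutator (A : DiffOp (⊤ : Opens (𝔼 N)) ν E F)
    (hA : A.HasLipschitzCoeff) {w : (𝔼 N) → E} (hw : ContDiff ℝ ∞ w) (hwc : HasCompactSupport w) :
    Tendsto (fun ε => ∫⁻ x, ‖A.commutator (mollifier N ε) w x‖ₑ) (𝓝[>] 0) (𝓝 0) := by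
  choose! L hL using hA
  have hlim : Tendsto (fun ε : ℝ => ∑ j ∈ Finset.range (ν + 1), ∑ α ∈ multiIndices N j,
      L α * ENNReal.ofReal ε * ∫⁻ x, ‖multiDeriv α w x‖ₑ) (𝓝[>] 0) (𝓝 0) := by
    have hterm (α : Fin N → ℕ) : Tendsto (fun ε : ℝ =>
        L α * ENNReal.ofReal ε * ∫⁻ x, ‖multiDeriv α w x‖ₑ) (𝓝[>] 0) (𝓝 0) := by
      have hint : ∫⁻ x, ‖multiDeriv α w x‖ₑ ≠ ⊤ :=
        ((contDiff_multiDeriv hw α).continuous.integrable_of_hasCompactSupport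
          (hasCompactSupport_multiDeriv hwc α)).2.ne
      have hε : Tendsto ENNReal.ofReal (𝓝[>] 0) (𝓝 0) := by
        simpa using (ENNReal.continuous_ofReal.tendsto 0).mono_left nhdsWithin_le_nhds
      simpa using ENNReal.Tendsto.mul_const
        (ENNReal.Tendsto.const_mul hε (.inr ENNReal.coe_ne_top)) (.inr hint)
    simpa using tendsto_finsetSum (Finset.range (ν + 1)) fun j _ =>
      tendsto_finsetSum (multiIndices N j) fun α _ => hterm α
  refine tendsto_of_tendsto_of_tendsto_of_le_of_le' tendsto_const_nhds hlim
    (.of_forall fun _ => zero_le) (eventually_mem_nhdsWithin.mono fun ε hε => ?_)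
  refine (A.lintegral_commutator_le_sum (contDiff_mollifier ε).continuous
    (hasCompactSupport_mollifier hε) hw hwc).trans ?_
  gcongr with j hj α hα
  exact lintegral_convComm_mollifier_le hε (hL α (sum_le_of_mem_multiIndices hj hα))
    (contDiff_multiDeriv hw α).continuous

omit [CompleteSpace E] in
theorem derivSum_sub_le {f f' : (𝔼 N) → E} (hf : ContDiff ℝ ∞ f)
    (hf' : ContDiff ℝ ∞ f') {h : (Fin N → ℕ) → (𝔼 N) → E}
    (hh : ∀ α ∈ multiIndices N k, AEStronglyMeasurable (h α)) :
    derivSum k (f - f') ≤ (∑ α ∈ multiIndices N k, ∫⁻ x, ‖multiDeriv α f x - h α x‖ₑ) +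
      ∑ α ∈ multiIndices N k, ∫⁻ x, ‖multiDeriv α f' x - h α x‖ₑ := by
  rw [derivSum, ← Finset.sum_add_distrib]
  gcongr with α hα
  simp only [multiDeriv_eq_listDeriv, listDeriv_sub hf hf', Pi.sub_apply, ← edist_eq_enorm_sub]
  exact lintegral_edist_triangle (contDiff_listDeriv hf _).continuous.aestronglyMeasurable
    (hh α hα)

omit [CompleteSpace F] in
theorem DiffOp.continuous_commutator (A : DiffOp (⊤ : Opens (𝔼 N)) ν E F) {ρ : (𝔼 N) → ℝ}
    (hρ : Continuous ρ) (hρc : HasCompactSupport ρ) {w : (𝔼 N) → E} (hw : ContDiff ℝ ∞ w)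
    (hwc : HasCompactSupport w) : Continuous (A.commutator ρ w) := by
  rw [funext (A.commutator_eq_sum hρ hρc hw hwc)]
  exact continuous_finsetSum _ fun j hj => continuous_finsetSum _ fun α hα =>
    continuous_convComm hρ hρc
      (A.contDiff_realCoeff (sum_le_of_mem_multiIndices hj hα)).continuous
      (contDiff_multiDeriv hw α).continuous

theorem DiffOp.eventually_lintegral_commutator_le [NeZero N]
    (A : DiffOp (⊤ : Opens (𝔼 N)) (k + 1) E F) (hA : A.HasLipschitzCoeff) {ι : Type*}
    {l : Filter ι} [l.NeBot] {w : ι → (𝔼 N) → E} {R : ℝ}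
    (hw : ∀ᶠ m in l, ContDiff ℝ ∞ (w m) ∧ tsupport (w m) ⊆ Metric.closedBall 0 R)
    {h : (Fin N → ℕ) → (𝔼 N) → E} (hh : ∀ α ∈ multiIndices N k, AEStronglyMeasurable (h α))
    (hwh : ∀ α ∈ multiIndices N k,
      Tendsto (fun m => ∫⁻ x, ‖multiDeriv α (w m) x - h α x‖ₑ) l (𝓝 0))
    {η : ℝ≥0∞} (hη : η ≠ 0) :
    ∀ᶠ ε in 𝓝[>] 0, ∀ᶠ m in l, ∫⁻ x, ‖A.commutator (mollifier N ε) (w m) x‖ₑ ≤ η := by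
  obtain ⟨C, hC⟩ := A.exists_lintegral_commutator_le hA R
  have herr : Tendsto (fun m => C * ∑ α ∈ multiIndices N k,
      ∫⁻ x, ‖multiDeriv α (w m) x - h α x‖ₑ) l (𝓝 0) := by
    simpa using ENNReal.Tendsto.const_mul (tendsto_finsetSum _ hwh) (.inr ENNReal.coe_ne_top)
  have hη3 : 0 < η / 3 := ENNReal.div_pos hη (by simp)
  have hclose : ∀ᶠ m in l, (ContDiff ℝ ∞ (w m) ∧ tsupport (w m) ⊆ Metric.closedBall 0 R) ∧
      C * ∑ α ∈ multiIndices N k, ∫⁻ x, ‖multiDeriv α (w m) x - h α x‖ₑ ≤ η / 3 :=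
    hw.and (herr.eventually_le_const hη3)
  obtain ⟨n, ⟨hn, hnR⟩, hnη⟩ := hclose.exists
  have hcs {m : ι} (hm : tsupport (w m) ⊆ Metric.closedBall 0 R) : HasCompactSupport (w m) :=
    (isCompact_closedBall 0 R).of_isClosed_subset (isClosed_tsupport _) hm
  filter_upwards [Ioc_mem_nhdsGT one_pos,
    (A.tendsto_lintegral_commutator hA hn (hcs hnR)).eventually_le_const hη3] with ε hε hεn
  filter_upwards [hclose] with m ⟨⟨hm, hmR⟩, hmη⟩
  have hρ : Continuous (mollifier N ε) := (contDiff_mollifier ε).continuous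
  have hρc := hasCompactSupport_mollifier (N := N) hε.1
  have hdiff : ∫⁻ x, ‖A.commutator (mollifier N ε) (w m - w n) x‖ₑ ≤ η / 3 + η / 3 :=
    calc ∫⁻ x, ‖A.commutator (mollifier N ε) (w m - w n) x‖ₑ ≤ C * derivSum k (w m - w n) :=
          hC ε hε _ (hm.sub hn) ((tsupport_sub _ _).trans (Set.union_subset hmR hnR))
      _ ≤ _ := by
          grw [derivSum_sub_le hm hn hh, mul_add, hmη, hnη]
  calc ∫⁻ x, ‖A.commutator (mollifier N ε) (w m) x‖ₑ
      ≤ ∫⁻ x, ‖A.commutator (mollifier N ε) (w m - w n) x‖ₑ +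
          ‖A.commutator (mollifier N ε) (w n) x‖ₑ := by
        refine lintegral_mono fun x => ?_
        rw [A.commutator_sub hρ hρc hm hn (hcs hmR) (hcs hnR), Pi.sub_apply]
        simpa using enorm_add_le (A.commutator (mollifier N ε) (w m) x -
          A.commutator (mollifier N ε) (w n) x) (A.commutator (mollifier N ε) (w n) x)
    _ ≤ η / 3 + η / 3 + η / 3 := by
        rw [lintegral_add_right _ (A.continuous_commutator hρ hρc hn (hcs hnR)).enorm.measurable]
        gcongr
    _ = η := ENNReal.add_thirds η

omit [CompleteSpace E] [CompleteSpace F] in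
theorem DiffOp.enorm_integral_conjPairing_adjoint_le {Ω U : Opens (𝔼 N)} (A : DiffOp Ω ν E F)
    (g : (𝔼 N) → E) {v : (𝔼 N) → ConjDual F} (hv : ContDiff ℝ ∞ v) (hvc : HasCompactSupport v)
    (hvU : tsupport v ⊆ U) (hv1 : ∀ x, ‖v x‖ ≤ 1) :
    ‖∫ x in (U : Set (𝔼 N)), conjPairing E (A.adjoint v x) (g x)‖ₑ ≤ A.variation U g :=
  le_iSup₂_of_le (ι := TestFunction U (ConjDual F) ⊤) ⟨v, hv, hvc, hvU⟩ hv1 le_rfl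

omit [CompleteSpace F] in
theorem DiffOp.integral_conjPairing_apply_convolution (A : DiffOp (⊤ : Opens (𝔼 N)) ν E F)
    {ρ : (𝔼 N) → ℝ} (hρ : ContDiff ℝ ∞ ρ) (hρc : HasCompactSupport ρ)
    (hρ_even : ∀ x, ρ (-x) = ρ x) {v : (𝔼 N) → ConjDual F} (hv : ContDiff ℝ ∞ v)
    (hvc : HasCompactSupport v) {g : (𝔼 N) → E} (hg : Integrable g) (hgc : HasCompactSupport g) :
    ∫ x, conjPairing F (v x) (A.apply (ρ ⋆ g) x) =
      ∫ x, conjPairing E ((ρ ⋆ A.adjoint v) x) (g x) := by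
  have hv_top : tsupport v ⊆ (⊤ : Opens (𝔼 N)) := Set.subset_univ _
  rw [A.integral_conjPairing_apply hv hv_top (contDiff_convolution hρ hρc hg.locallyIntegrable)
    (hρc.convolution _ hgc), integral_bilin_convolution_comm _ hρ.continuous hρc hρ_even
    ((A.contDiff_adjoint hv hv_top).continuous.integrable_of_hasCompactSupport
      (hvc.of_isClosed_subset (isClosed_tsupport _) (A.tsupport_adjoint_subset v))) hg]

theorem DiffOp.integral_conjPairing_commutator (A : DiffOp (⊤ : Opens (𝔼 N)) ν E F)
    {ρ : (𝔼 N) → ℝ} (hρ : ContDiff ℝ ∞ ρ) (hρc : HasCompactSupport ρ)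
    (hρ_even : ∀ x, ρ (-x) = ρ x) {v : (𝔼 N) → ConjDual F} (hv : ContDiff ℝ ∞ v)
    (hvc : HasCompactSupport v) {w : (𝔼 N) → E} (hw : ContDiff ℝ ∞ w) (hwc : HasCompactSupport w) :
    ∫ x, conjPairing F (v x) (A.commutator ρ w x) =
      (∫ x, conjPairing E ((ρ ⋆ A.adjoint v) x) (w x)) -
        ∫ x, conjPairing E (A.adjoint (ρ ⋆ v) x) (w x) := by
  have hw_int : Integrable w := hw.continuous.integrable_of_hasCompactSupport hwc
  have hv_int : Integrable v := hv.continuous.integrable_of_hasCompactSupport hvc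
  have hAw_int : Integrable (A.apply w) :=
    (A.contDiff_apply hw).continuous.integrable_of_hasCompactSupport (A.hasCompactSupport_apply hwc)
  have hint {f : (𝔼 N) → F} (hf : ContDiff ℝ ∞ f) :
      Integrable fun x => conjPairing F (v x) (f x) :=
    integrable_bilin_of_hasCompactSupport (conjPairing F).flip hf.continuous hv.continuous hvc
  calc ∫ x, conjPairing F (v x) (A.commutator ρ w x)
      = (∫ x, conjPairing F (v x) (A.apply (ρ ⋆ w) x)) -
          ∫ x, conjPairing F (v x) ((ρ ⋆ A.apply w) x) := by
        simp only [DiffOp.commutator, Pi.sub_apply, map_sub]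
        exact integral_sub
          (hint (A.contDiff_apply (contDiff_convolution hρ hρc hw_int.locallyIntegrable)))
          (hint (contDiff_convolution hρ hρc hAw_int.locallyIntegrable))
    _ = _ := by
        rw [A.integral_conjPairing_apply_convolution hρ hρc hρ_even hv hvc hw_int hwc,
          integral_bilin_convolution_comm _ hρ.continuous hρc hρ_even hv_int hAw_int,
          A.integral_conjPairing_apply (contDiff_convolution hρ hρc hv_int.locallyIntegrable)
            (Set.subset_univ _) hw hwc]

theorem DiffOp.enorm_integral_conjPairing_commutator_le (A : DiffOp (⊤ : Opens (𝔼 N)) ν E F)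
    {ρ : (𝔼 N) → ℝ} (hρ : ContDiff ℝ ∞ ρ) (hρc : HasCompactSupport ρ)
    (hρ_even : ∀ x, ρ (-x) = ρ x) {v : (𝔼 N) → ConjDual F} (hv : ContDiff ℝ ∞ v)
    (hvc : HasCompactSupport v) (hv1 : ∀ x, ‖v x‖ ≤ 1) {g : (𝔼 N) → E} (hg : Integrable g)
    {ι : Type*} {l : Filter ι} [l.NeBot] {w : ι → (𝔼 N) → E}
    (hw : ∀ᶠ m in l, ContDiff ℝ ∞ (w m) ∧ HasCompactSupport (w m))
    (hwg : Tendsto (fun m => ∫⁻ x, ‖w m x - g x‖ₑ) l (𝓝 0)) {η : ℝ≥0∞}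
    (hη : ∀ᶠ m in l, ∫⁻ x, ‖A.commutator ρ (w m) x‖ₑ ≤ η) :
    ‖(∫ x, conjPairing E ((ρ ⋆ A.adjoint v) x) (g x)) -
      ∫ x, conjPairing E (A.adjoint (ρ ⋆ v) x) (g x)‖ₑ ≤ η := by
  have hρv : ContDiff ℝ ∞ (ρ ⋆ v) := contDiff_convolution hρ hρc hv.continuous.locallyIntegrable
  have hadj {v : (𝔼 N) → ConjDual F} (hv : ContDiff ℝ ∞ v) : Continuous (A.adjoint v) :=
    (A.contDiff_adjoint hv (Set.subset_univ _)).continuous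
  have hadjc {v : (𝔼 N) → ConjDual F} (hvc : HasCompactSupport v) :
      HasCompactSupport (A.adjoint v) :=
    hvc.of_isClosed_subset (isClosed_tsupport _) (A.tsupport_adjoint_subset v)
  have hw_int : ∀ᶠ m in l, Integrable (w m) :=
    hw.mono fun m hm => hm.1.continuous.integrable_of_hasCompactSupport hm.2
  have hlim := (tendsto_integral_bilin (conjPairing E)
    (contDiff_convolution hρ hρc (hadj hv).locallyIntegrable).continuous
    (hρc.convolution _ (hadjc hvc)) hw_int hg hwg).sub
    (tendsto_integral_bilin (conjPairing E) (hadj hρv) (hadjc (hρc.convolution _ hvc)) hw_int hg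
      hwg)
  refine le_of_tendsto ((continuous_enorm.tendsto _).comp hlim) ?_
  filter_upwards [hw, hη] with m ⟨hm, hmc⟩ hmη
  rw [Function.comp_apply, ← A.integral_conjPairing_commutator hρ hρc hρ_even hv hvc hm hmc]
  refine (enorm_integral_le_lintegral_enorm _).trans (le_trans (lintegral_mono fun x => ?_) hmη)
  rw [enorm_le_iff_norm_le]
  exact (norm_conjPairing_le _ _).trans (mul_le_of_le_one_left (norm_nonneg _) (hv1 x))

theorem DiffOp.lintegral_apply_mollifier_convolution_le (A : DiffOp (⊤ : Opens (𝔼 N)) ν E F)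
    {ε : ℝ} (hε : 0 < ε) {g : (𝔼 N) → E} (hg : Integrable g) (hgc : HasCompactSupport g)
    {ι : Type*} {l : Filter ι} [l.NeBot] {w : ι → (𝔼 N) → E}
    (hw : ∀ᶠ m in l, ContDiff ℝ ∞ (w m) ∧ HasCompactSupport (w m))
    (hwg : Tendsto (fun m => ∫⁻ x, ‖w m x - g x‖ₑ) l (𝓝 0)) {η : ℝ≥0∞}
    (hη : ∀ᶠ m in l, ∫⁻ x, ‖A.commutator (mollifier N ε) (w m) x‖ₑ ≤ η) :
    ∫⁻ x, ‖A.apply (mollifier N ε ⋆ g) x‖ₑ ≤ A.variation ⊤ g + η := by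
  have hρ : ContDiff ℝ ∞ (mollifier N ε) := contDiff_mollifier ε
  have hρc : HasCompactSupport (mollifier N ε) := hasCompactSupport_mollifier hε
  refine lintegral_enorm_le_of_forall_conjPairing
    (A.contDiff_apply (contDiff_mollifier_convolution hε hg.locallyIntegrable)).continuous
    (A.hasCompactSupport_apply (hρc.convolution _ hgc)) fun v hv hvc hv1 => ?_
  have hvar : ‖∫ x, conjPairing E (A.adjoint (mollifier N ε ⋆ v) x) (g x)‖ₑ ≤ A.variation ⊤ g := by
    simpa using A.enorm_integral_conjPairing_adjoint_le (U := ⊤) g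
      (contDiff_mollifier_convolution hε hv.continuous.locallyIntegrable)
      (hρc.convolution _ hvc) (Set.subset_univ _)
      (norm_convolution_le (mollifier_nonneg hε) (integral_mollifier hε) hv1)
  have hcomm := A.enorm_integral_conjPairing_commutator_le hρ hρc (mollifier_neg ε) hv hvc hv1 hg
    hw hwg hη
  rw [A.integral_conjPairing_apply_convolution hρ hρc (mollifier_neg ε) hv hvc hg hgc]
  refine le_trans ?_ ((enorm_add_le _ _).trans (add_le_add hvar hcomm))
  rw [add_sub_cancel]

omit [CompleteSpace E] in
theorem IsWeakDeriv.integral_multiDeriv_smul {U : Opens (𝔼 N)} {α : Fin N → ℕ} {g h : (𝔼 N) → E}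
    (hgh : IsWeakDeriv U α g h) {φ : (𝔼 N) → ℂ} (hφ : ContDiff ℝ ∞ φ) (hφc : HasCompactSupport φ)
    (hφU : tsupport φ ⊆ U) :
    ∫ x in (U : Set (𝔼 N)), multiDeriv α φ x • g x =
      (-1 : ℂ) ^ (∑ i, α i) • ∫ x in (U : Set (𝔼 N)), φ x • h x :=
  hgh.2.2 ⟨φ, hφ, hφc, hφU⟩

theorem IsWeakDeriv.multiDeriv_convolution {α : Fin N → ℕ} {g h : (𝔼 N) → E}
    (hgh : IsWeakDeriv ⊤ α g h) {ρ : (𝔼 N) → ℝ} (hρ : ContDiff ℝ ∞ ρ)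
    (hρc : HasCompactSupport ρ) : multiDeriv α (ρ ⋆ g) = ρ ⋆ h := by
  ext1 x
  have hρx : ContDiff ℝ ∞ fun y => ρ (x - y) := hρ.comp (contDiff_const.sub contDiff_id)
  have hderiv (y : 𝔼 N) : multiDeriv α (fun y => (ρ (x - y) : ℂ)) y =
      (-1 : ℂ) ^ (∑ i, α i) * (listDeriv (multiList α) ρ (x - y) : ℝ) := by
    have := congrFun (listDeriv_clm_comp Complex.ofRealCLM hρx (multiList α)) y
    rw [multiDeriv_eq_listDeriv]
    simpa [listDeriv_comp_sub_left hρ, length_multiList] using this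
  have htest := hgh.integral_multiDeriv_smul (Complex.ofRealCLM.contDiff.comp hρx)
    ((hρc.comp_homeomorph (Homeomorph.subLeft x)).comp_left Complex.ofReal_zero)
    (Set.subset_univ _)
  simp only [Function.comp_def, Complex.ofRealCLM_apply, hderiv, mul_smul, Complex.coe_smul,
    integral_smul, Opens.coe_top, Measure.restrict_univ] at htest
  rw [multiDeriv_eq_listDeriv, listDeriv_convolution_left hρ hρc
    (locallyIntegrableOn_univ.1 hgh.1), convolution_eq_swap, convolution_eq_swap]
  exact smul_right_injective E (pow_ne_zero (∑ i, α i) (by norm_num : (-1 : ℂ) ≠ 0)) htest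

theorem DiffOp.eventually_lintegral_apply_mollifier_convolution_le [NeZero N]
    (A : DiffOp (⊤ : Opens (𝔼 N)) (k + 1) E F) (hA : A.HasLipschitzCoeff) {g : (𝔼 N) → E}
    (hg : Integrable g) (hgc : HasCompactSupport g) {h : (Fin N → ℕ) → (𝔼 N) → E}
    (hgh : ∀ α ∈ multiIndices N k, IsWeakDeriv ⊤ α g (h α))
    (hh : ∀ α ∈ multiIndices N k, Integrable (h α)) {η : ℝ≥0∞} (hη : η ≠ 0) :
    ∀ᶠ ε in 𝓝[>] 0, ∫⁻ x, ‖A.apply (mollifier N ε ⋆ g) x‖ₑ ≤ A.variation ⊤ g + η := by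
  obtain ⟨R, hR⟩ := (hgc.cthickening (r := 1)).isBounded.subset_closedBall (0 : 𝔼 N)
  have hw : ∀ᶠ ε in 𝓝[>] 0, ContDiff ℝ ∞ (mollifier N ε ⋆ g) ∧
      tsupport (mollifier N ε ⋆ g) ⊆ Metric.closedBall 0 R := by
    filter_upwards [Ioc_mem_nhdsGT one_pos] with ε hε
    exact ⟨contDiff_mollifier_convolution hε.1 hg.locallyIntegrable,
      ((tsupport_mollifier_convolution_subset hε.1 (subset_tsupport g)).trans
        (Metric.cthickening_mono hε.2 _)).trans hR⟩
  have hwh (α) (hα : α ∈ multiIndices N k) : Tendsto (fun ε =>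
      ∫⁻ x, ‖multiDeriv α (mollifier N ε ⋆ g) x - h α x‖ₑ) (𝓝[>] 0) (𝓝 0) := by
    refine (tendsto_lintegral_mollifier_convolution_sub (hh α hα)).congr' ?_
    filter_upwards [self_mem_nhdsWithin] with ε hε
    rw [(hgh α hα).multiDeriv_convolution (contDiff_mollifier ε) (hasCompactSupport_mollifier hε)]
  have hw' : ∀ᶠ ε in 𝓝[>] 0, ContDiff ℝ ∞ (mollifier N ε ⋆ g) ∧
      HasCompactSupport (mollifier N ε ⋆ g) := hw.mono fun ε hε =>
    ⟨hε.1, (isCompact_closedBall 0 R).of_isClosed_subset (isClosed_tsupport _) hε.2⟩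
  filter_upwards [self_mem_nhdsWithin, A.eventually_lintegral_commutator_le hA hw
    (fun α hα => (hh α hα).aestronglyMeasurable) hwh hη] with ε hε hεη
  exact A.lintegral_apply_mollifier_convolution_le hε hg hgc hw'
    (tendsto_lintegral_mollifier_convolution_sub hg) hεη

end Friedrichs

/-! ### Localization -/

section Localization

variable {N k ν : ℕ} {Ω U : Opens (𝔼 N)}
  {E F : Type*} [NormedAddCommGroup E] [NormedSpace ℂ E]
  [NormedAddCommGroup F] [NormedSpace ℂ F]

/-- The operator `χ A`. It is defined on the whole space because `χ` is supported in `Ω`. -/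
def DiffOp.cutoff (A : DiffOp Ω ν E F) {χ : (𝔼 N) → ℝ} (hχ : ContDiff ℝ ∞ χ)
    (hχΩ : tsupport χ ⊆ Ω) : DiffOp (⊤ : Opens (𝔼 N)) ν E F where
  coeff α x := χ x • A.coeff α x
  smooth α hα := ContDiff.contDiffOn <| ContMDiff.contDiff <| contMDiff_of_tsupport fun _ hx =>
    ContDiffAt.contMDiffAt <| hχ.contDiffAt.smul ((A.smooth α hα).contDiffAt
      (Ω.isOpen.mem_nhds (hχΩ (tsupport_smul_subset_left χ (A.coeff α) hx))))

variable {χ : (𝔼 N) → ℝ} (hχ : ContDiff ℝ ∞ χ) (hχΩ : tsupport χ ⊆ Ω)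

theorem DiffOp.cutoff_adjoint (A : DiffOp Ω ν E F) (v : (𝔼 N) → ConjDual F) :
    (A.cutoff hχ hχΩ).adjoint v = A.adjoint fun x => χ x • v x := by
  have hcomp (α : Fin N → ℕ) : (fun y => (v y).comp ((A.cutoff hχ hχΩ).coeff α y)) =
      fun y => (χ y • v y).comp (A.coeff α y) := by
    ext y z
    change v y (χ y • A.coeff α y z) = χ y • v y (A.coeff α y z)
    rw [← Complex.coe_smul, map_smulₛₗ]
    simp
  unfold DiffOp.adjoint
  simp only [hcomp]

theorem DiffOp.cutoff_apply (A : DiffOp Ω ν E F) {u : (𝔼 N) → E}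
    (hu : ∀ x ∈ tsupport u, χ x = 1) : (A.cutoff hχ hχΩ).apply u = A.apply u := by
  ext1 x
  refine Finset.sum_congr rfl fun k _ => Finset.sum_congr rfl fun α _ => ?_
  by_cases hx : x ∈ tsupport u
  · simp [DiffOp.cutoff, hu x hx]
  · simp [image_eq_zero_of_notMem_tsupport fun h => hx (tsupport_multiDeriv_subset u α h)]

theorem DiffOp.hasLipschitzCoeff_cutoff (A : DiffOp Ω ν E F) (hχc : HasCompactSupport χ) :
    (A.cutoff hχ hχΩ).HasLipschitzCoeff := fun α hα =>
  ContDiff.lipschitzWith_of_hasCompactSupport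
    (hχc.mono fun x hx hχx => hx (by ext; simp [DiffOp.realCoeff, DiffOp.cutoff, hχx]))
    ((A.cutoff hχ hχΩ).contDiff_realCoeff hα) (by simp)

section SuppIn

variable {K : Set (𝔼 N)} {g : (𝔼 N) → E}

omit [NormedSpace ℂ E] in
theorem SuppIn.indicator_ae_eq (hg : SuppIn U K g) : K.indicator g =ᵐ[volume.restrict U] g := by
  filter_upwards [hg] with x hx
  by_cases hxK : x ∈ K
  · exact Set.indicator_of_mem hxK g
  · rw [Set.indicator_of_notMem hxK, hx hxK]

omit [NormedSpace ℂ E] in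
theorem SuppIn.setIntegral_eq_integral_indicator {W : Type*} [NormedAddCommGroup W]
    [NormedSpace ℝ W] (hg : SuppIn U K g) (hKU : K ⊆ U) (T : (𝔼 N) → E → W)
    (hT : ∀ x, T x 0 = 0) :
    ∫ x in (U : Set (𝔼 N)), T x (g x) = ∫ x, T x (K.indicator g x) := by
  calc ∫ x in (U : Set (𝔼 N)), T x (g x)
      = ∫ x in (U : Set (𝔼 N)), T x (K.indicator g x) := by
        refine integral_congr_ae ?_
        filter_upwards [hg.indicator_ae_eq] with x hx
        rw [hx]
    _ = ∫ x, T x (K.indicator g x) :=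
        setIntegral_eq_integral_of_forall_compl_eq_zero fun x hx => by
          rw [Set.indicator_of_notMem fun h => hx (hKU h), hT]

theorem DiffOp.variation_cutoff_indicator_le (A : DiffOp Ω ν E F) (hχc : HasCompactSupport χ)
    (hχU : tsupport χ ⊆ U) (hχ01 : ∀ x, χ x ∈ Set.Icc 0 1) (hg : SuppIn U K g) (hKU : K ⊆ U) :
    (A.cutoff hχ hχΩ).variation ⊤ (K.indicator g) ≤ A.variation U g := by
  refine iSup₂_le fun v hv1 => ?_
  have hχv1 (x : 𝔼 N) : ‖χ x • v x‖ ≤ 1 := by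
    rw [norm_smul, Real.norm_of_nonneg (hχ01 x).1]
    exact mul_le_one₀ (hχ01 x).2 (norm_nonneg _) (hv1 x)
  have hle := A.enorm_integral_conjPairing_adjoint_le g (hχ.smul v.contDiff)
    (hχc.smul_right (f' := v)) ((tsupport_smul_subset_left χ v).trans hχU) hχv1
  rw [hg.setIntegral_eq_integral_indicator hKU (fun x => conjPairing E _)
    fun x => map_zero _] at hle
  simpa [DiffOp.cutoff_adjoint, conjPairing_apply, ← Pi.smul_def'] using hle

variable {α : Fin N → ℕ} {h : (𝔼 N) → E}

theorem integrable_smul_of_locallyIntegrableOn {f : (𝔼 N) → E}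
    (hf : LocallyIntegrableOn f U) (hχ : Continuous χ) (hχc : HasCompactSupport χ)
    (hχU : tsupport χ ⊆ U) : Integrable fun x => χ x • f x := by
  obtain ⟨M, hM⟩ := hχc.exists_bound_of_continuous hχ
  have hint := integrable_bilin_of_norm_le (ContinuousLinearMap.lsmul ℝ ℝ) hχ hM
    (hf.integrableOn_compact_subset hχU hχc)
  refine (integrableOn_iff_integrable_of_support_subset fun x hx => ?_).1 hint
  by_contra hxχ
  exact hx (by simp [image_eq_zero_of_notMem_tsupport hxχ])

include hχ in
theorem IsWeakDeriv.integral_multiDeriv_smul_of_suppIn (hgh : IsWeakDeriv U α g h)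
    (hg : SuppIn U K g) (hχc : HasCompactSupport χ) (hχU : tsupport χ ⊆ U)
    (hχ1 : ∀ x ∈ K, ∀ᶠ y in 𝓝 x, χ y = 1) {φ : (𝔼 N) → ℂ} (hφ : ContDiff ℝ ∞ φ) :
    ∫ x in (U : Set (𝔼 N)), multiDeriv α φ x • g x =
      (-1 : ℂ) ^ (∑ i, α i) • ∫ x in (U : Set (𝔼 N)), φ x • χ x • h x := by
  have htest := hgh.integral_multiDeriv_smul (hχ.smul hφ) (hχc.smul_right (f' := φ))
    ((tsupport_smul_subset_left χ φ).trans hχU)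
  calc ∫ x in (U : Set (𝔼 N)), multiDeriv α φ x • g x
      = ∫ x in (U : Set (𝔼 N)), multiDeriv α (fun x => χ x • φ x) x • g x := by
        refine integral_congr_ae ?_
        filter_upwards [hg] with x hx
        by_cases hxK : x ∈ K
        · have hχφ : (fun y => χ y • φ y) =ᶠ[𝓝 x] φ :=
            (hχ1 x hxK).mono fun y hy => by simp only [hy, one_smul]
          simp only [multiDeriv_eq_listDeriv, (listDeriv_congr hχφ _).self_of_nhds]
        · rw [hx hxK, smul_zero, smul_zero]
    _ = (-1 : ℂ) ^ (∑ i, α i) • ∫ x in (U : Set (𝔼 N)), (χ x • φ x) • h x := htest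
    _ = (-1 : ℂ) ^ (∑ i, α i) • ∫ x in (U : Set (𝔼 N)), φ x • χ x • h x := by
        simp only [smul_assoc, smul_comm (χ _)]

include hχ in
theorem IsWeakDeriv.smul_of_suppIn (hgh : IsWeakDeriv U α g h) (hg : SuppIn U K g)
    (hχc : HasCompactSupport χ) (hχU : tsupport χ ⊆ U) (hχ1 : ∀ x ∈ K, ∀ᶠ y in 𝓝 x, χ y = 1) :
    IsWeakDeriv U α g fun x => χ x • h x :=
  ⟨hgh.1, (integrable_smul_of_locallyIntegrableOn hgh.2.1 hχ.continuous hχc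
    hχU).locallyIntegrable.locallyIntegrableOn _,
    fun φ => hgh.integral_multiDeriv_smul_of_suppIn hχ hg hχc hχU hχ1 φ.contDiff⟩

include hχ in
theorem IsWeakDeriv.indicator_smul_of_suppIn (hgh : IsWeakDeriv U α g h) (hg : SuppIn U K g)
    (hK : IsCompact K) (hKU : K ⊆ U) (hχc : HasCompactSupport χ) (hχU : tsupport χ ⊆ U)
    (hχ1 : ∀ x ∈ K, ∀ᶠ y in 𝓝 x, χ y = 1) :
    IsWeakDeriv ⊤ α (K.indicator g) fun x => χ x • h x := by
  have hχh := integrable_smul_of_locallyIntegrableOn hgh.2.1 hχ.continuous hχc hχU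
  have hgK : Integrable (K.indicator g) :=
    (hgh.1.integrableOn_compact_subset hKU hK).integrable_indicator hK.measurableSet
  refine ⟨hgK.locallyIntegrable.locallyIntegrableOn _, hχh.locallyIntegrable.locallyIntegrableOn _,
    fun φ => ?_⟩
  have htest := hgh.integral_multiDeriv_smul_of_suppIn hχ hg hχc hχU hχ1 φ.contDiff
  rw [hg.setIntegral_eq_integral_indicator hKU (fun x y => multiDeriv α φ x • y) fun x =>
    smul_zero _, setIntegral_eq_integral_of_forall_compl_eq_zero fun x hx => by
      rw [image_eq_zero_of_notMem_tsupport fun h => hx (hχU h), zero_smul, smul_zero]] at htest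
  simpa using htest

end SuppIn

variable [CompleteSpace E] [CompleteSpace F]

theorem DiffOp.exists_smooth_approx_of_hasLipschitzCoeff [NeZero N]
    (A : DiffOp (⊤ : Opens (𝔼 N)) (k + 1) E F) (hA : A.HasLipschitzCoeff) {K : Set (𝔼 N)}
    (hK : IsCompact K) {d : ℝ} (hd : 0 < d) {g : (𝔼 N) → E} (hg : Integrable g)
    (hgK : Function.support g ⊆ K) {h : (Fin N → ℕ) → (𝔼 N) → E}
    (hgh : ∀ α ∈ multiIndices N k, IsWeakDeriv ⊤ α g (h α))
    (hh : ∀ α ∈ multiIndices N k, Integrable (h α)) {η : ℝ≥0∞} (hη : η ≠ 0) :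
    ∃ u : (𝔼 N) → E, ContDiff ℝ ∞ u ∧ tsupport u ⊆ Metric.cthickening d K ∧
      ∫⁻ x, ‖u x - g x‖ₑ ≤ η ∧
      (∀ α ∈ multiIndices N k, ∫⁻ x, ‖multiDeriv α u x - h α x‖ₑ ≤ η) ∧
      ∫⁻ x, ‖A.apply u x‖ₑ ≤ A.variation ⊤ g + η := by
  have hgc : HasCompactSupport g :=
    hK.of_isClosed_subset (isClosed_tsupport _) (closure_minimal hgK hK.isClosed)
  have hη0 : 0 < η := pos_iff_ne_zero.2 hη
  have hh_small : ∀ᶠ ε in 𝓝[>] 0, ∀ α ∈ multiIndices N k,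
      ∫⁻ x, ‖(mollifier N ε ⋆ h α) x - h α x‖ₑ ≤ η :=
    (Filter.eventually_all_finset _).2 fun α hα =>
      (tendsto_lintegral_mollifier_convolution_sub (hh α hα)).eventually_le_const hη0
  obtain ⟨ε, hAε, hgε, hhε, hε⟩ :=
    ((A.eventually_lintegral_apply_mollifier_convolution_le hA hg hgc hgh hh hη).and
      (((tendsto_lintegral_mollifier_convolution_sub hg).eventually_le_const hη0).and
        (hh_small.and (Ioc_mem_nhdsGT hd)))).exists
  refine ⟨mollifier N ε ⋆ g, contDiff_mollifier_convolution hε.1 hg.locallyIntegrable,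
    (tsupport_mollifier_convolution_subset hε.1 hgK).trans (Metric.cthickening_mono hε.2 K), hgε,
    fun α hα => ?_, hAε⟩
  rw [(hgh α hα).multiDeriv_convolution (contDiff_mollifier ε) (hasCompactSupport_mollifier hε.1)]
  exact hhε α hα

theorem DiffOp.exists_smooth_approx [NeZero N] (A : DiffOp Ω (k + 1) E F) (hU : U ≤ Ω)
    {K : Set (𝔼 N)} (hK : IsCompact K) (hKU : K ⊆ U) :
    ∃ K' : Set (𝔼 N), IsCompact K' ∧ K' ⊆ U ∧
      ∀ g : (𝔼 N) → E, MemSobolev k 1 U g → SuppIn U K g →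
        ∃ h : (Fin N → ℕ) → (𝔼 N) → E,
          (∀ α ∈ multiIndices N k, IsWeakDeriv U α g (h α) ∧ Integrable (h α)) ∧
          ∀ η : ℝ≥0∞, η ≠ 0 → ∃ u : (𝔼 N) → E, ContDiff ℝ ∞ u ∧ tsupport u ⊆ K' ∧
            ∫⁻ x in (U : Set (𝔼 N)), ‖u x - g x‖ₑ ≤ η ∧
            (∀ α ∈ multiIndices N k, ∫⁻ x, ‖multiDeriv α u x - h α x‖ₑ ≤ η) ∧
            ∫⁻ x, ‖A.apply u x‖ₑ ≤ A.variation U g + η := by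
  obtain ⟨d, hd, hdU⟩ := hK.exists_cthickening_subset_open U.isOpen hKU
  obtain ⟨χ, hχ, hχc, hχU, hχ01, hχ1⟩ := exists_smooth_cutoff hK.cthickening hdU
  have hχ1K (x) (hx : x ∈ K) : ∀ᶠ y in 𝓝 x, χ y = 1 :=
    hχ1 x (Metric.self_subset_cthickening K hx)
  refine ⟨Metric.cthickening d K, hK.cthickening, hdU, fun g hg hgK => ?_⟩
  choose! h₀ hh₀ _ using hg.2
  have hint (α) (hα : α ∈ multiIndices N k) : Integrable fun x => χ x • h₀ α x :=
    integrable_smul_of_locallyIntegrableOn (hh₀ α hα).2.1 hχ.continuous hχc hχU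
  refine ⟨fun α x => χ x • h₀ α x, fun α hα =>
    ⟨(hh₀ α hα).smul_of_suppIn hχ hgK hχc hχU hχ1K, hint α hα⟩, fun η hη => ?_⟩
  obtain ⟨u, hu, hus, hug, huh, huA⟩ :=
    (A.cutoff hχ (hχU.trans hU)).exists_smooth_approx_of_hasLipschitzCoeff
      (A.hasLipschitzCoeff_cutoff hχ _ hχc) hK hd
      ((IntegrableOn.mono_set (memLp_one_iff_integrable.1 hg.1) hKU).integrable_indicator
        hK.measurableSet)
      Set.support_indicator_subset (fun α hα =>
        (hh₀ α hα).indicator_smul_of_suppIn hχ hgK hK hKU hχc hχU hχ1K) hint hη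
  refine ⟨u, hu, hus, ?_, huh, ?_⟩
  · refine le_trans (lintegral_congr_ae ?_).le ((setLIntegral_le_lintegral _ _).trans hug)
    filter_upwards [hgK.indicator_ae_eq] with x hx
    rw [hx]
  · rw [A.cutoff_apply hχ _ fun x hx => (hχ1 x (hus hx)).self_of_nhds] at huA
    exact huA.trans (by gcongr; exact A.variation_cutoff_indicator_le hχ _ hχc hχU hχ01 hgK hKU)

end Localization

/-! ### The damped heat semigroup -/

section Heat

variable {N : ℕ} {E : Type*} [NormedAddCommGroup E] [NormedSpace ℂ E]

/-- The symbol `1 + 4π²|ξ|²` of `1 - Δ`. -/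
def besselSymbol (ξ : 𝔼 N) : ℝ := 1 + 4 * Real.pi ^ 2 * ‖ξ‖ ^ 2

theorem besselSymbol_pos (ξ : 𝔼 N) : 0 < besselSymbol ξ := by
  unfold besselSymbol
  positivity

theorem continuous_besselSymbol : Continuous (besselSymbol : (𝔼 N) → ℝ) := by
  unfold besselSymbol
  fun_prop

/-- The density of the centred Gaussian with covariance matrix `2t · 1`, that is, the kernel
of `exp (t Δ)`. -/
def gaussKernel (t : ℝ) (z : 𝔼 N) : ℝ :=
  ((4 * Real.pi * t)⁻¹) ^ ((N : ℝ) / 2) * Real.exp (-(‖z‖ ^ 2 / (4 * t)))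

/-- The kernel of `exp (-t (1 - Δ))`. -/
def heatKernel (t : ℝ) (z : 𝔼 N) : ℝ := Real.exp (-t) * gaussKernel t z

variable {t : ℝ}

theorem gaussKernel_nonneg (ht : 0 < t) (z : 𝔼 N) : 0 ≤ gaussKernel t z := by
  unfold gaussKernel
  positivity

theorem heatKernel_nonneg (ht : 0 < t) (z : 𝔼 N) : 0 ≤ heatKernel t z :=
  mul_nonneg (Real.exp_pos _).le (gaussKernel_nonneg ht z)

theorem continuous_heatKernel (t : ℝ) : Continuous (heatKernel t : (𝔼 N) → ℝ) := by
  unfold heatKernel gaussKernel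
  fun_prop

theorem measurable_uncurry_heatKernel :
    Measurable (Function.uncurry (heatKernel : ℝ → (𝔼 N) → ℝ)) := by
  unfold heatKernel gaussKernel Function.uncurry
  fun_prop

theorem integral_gaussKernel (ht : 0 < t) : ∫ z : 𝔼 N, gaussKernel t z = 1 := by
  have h := GaussianFourier.integral_rexp_neg_mul_sq_norm (V := 𝔼 N) (b := (4 * t)⁻¹)
    (by positivity)
  simp only [finrank_euclideanSpace, Fintype.card_fin, neg_mul, ← div_eq_inv_mul] at h
  unfold gaussKernel
  rw [integral_const_mul, h, ← Real.mul_rpow (by positivity) (by positivity),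
    show (4 * Real.pi * t)⁻¹ * (Real.pi / (4 * t)⁻¹) = 1 by field_simp, Real.one_rpow]

theorem lintegral_gaussKernel (ht : 0 < t) :
    ∫⁻ z : 𝔼 N, ENNReal.ofReal (gaussKernel t z) = 1 := by
  rw [← ofReal_integral_eq_lintegral_ofReal
    (integrable_of_integral_eq_one (integral_gaussKernel ht))
    (.of_forall (gaussKernel_nonneg ht)), integral_gaussKernel ht, ENNReal.ofReal_one]

theorem lintegral_enorm_heatKernel (ht : 0 < t) :
    ∫⁻ z : 𝔼 N, ‖heatKernel t z‖ₑ = ENNReal.ofReal (Real.exp (-t)) := by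
  simp only [Real.enorm_of_nonneg (heatKernel_nonneg ht _)]
  simp only [heatKernel, ENNReal.ofReal_mul (Real.exp_pos _).le]
  rw [lintegral_const_mul' _ _ ENNReal.ofReal_ne_top, lintegral_gaussKernel ht, mul_one]

theorem exp_neg_sq_div_le {d r : ℝ} (ht : 0 < t) (hd : 0 < d) (hr : d ≤ r) :
    Real.exp (-(r ^ 2 / (8 * t))) ≤ 8 / d ^ 2 * t :=
  calc Real.exp (-(r ^ 2 / (8 * t))) ≤ Real.exp (-(d ^ 2 / (8 * t))) := by gcongr
    _ = (Real.exp (d ^ 2 / (8 * t)))⁻¹ := Real.exp_neg _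
    _ ≤ (d ^ 2 / (8 * t))⁻¹ := by
      gcongr
      linarith [Real.add_one_le_exp (d ^ 2 / (8 * t))]
    _ = 8 / d ^ 2 * t := by field_simp

theorem heatKernel_le_mul_gaussKernel {d : ℝ} (ht : 0 < t) (hd : 0 < d) {z : 𝔼 N} (hz : d ≤ ‖z‖) :
    heatKernel t z ≤
      2 ^ ((N : ℝ) / 2) * (8 / d ^ 2) * (t * Real.exp (-t)) * gaussKernel (2 * t) z := by
  have hscale : ((4 * Real.pi * t)⁻¹) ^ ((N : ℝ) / 2) =
      2 ^ ((N : ℝ) / 2) * ((4 * Real.pi * (2 * t))⁻¹) ^ ((N : ℝ) / 2) := by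
    rw [← Real.mul_rpow (by positivity) (by positivity)]
    congr 1
    field_simp
  have hsplit : Real.exp (-(‖z‖ ^ 2 / (4 * t))) =
      Real.exp (-(‖z‖ ^ 2 / (8 * t))) * Real.exp (-(‖z‖ ^ 2 / (4 * (2 * t)))) := by
    rw [← Real.exp_add]
    congr 1
    field_simp
    ring
  unfold heatKernel gaussKernel
  rw [hscale, hsplit]
  calc Real.exp (-t) * (2 ^ ((N : ℝ) / 2) * ((4 * Real.pi * (2 * t))⁻¹) ^ ((N : ℝ) / 2) *
        (Real.exp (-(‖z‖ ^ 2 / (8 * t))) * Real.exp (-(‖z‖ ^ 2 / (4 * (2 * t))))))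
      ≤ Real.exp (-t) * (2 ^ ((N : ℝ) / 2) * ((4 * Real.pi * (2 * t))⁻¹) ^ ((N : ℝ) / 2) *
        (8 / d ^ 2 * t * Real.exp (-(‖z‖ ^ 2 / (4 * (2 * t)))))) := by
        gcongr
        exact exp_neg_sq_div_le ht hd hz
    _ = _ := by ring

theorem setLIntegral_enorm_heatKernel_le {d : ℝ} (ht : 0 < t) (hd : 0 < d) :
    ∫⁻ z : 𝔼 N in {z | d ≤ ‖z‖}, ‖heatKernel t z‖ₑ ≤
      ENNReal.ofReal (2 ^ ((N : ℝ) / 2) * (8 / d ^ 2) * (t * Real.exp (-t))) := by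
  set D : ℝ := 2 ^ ((N : ℝ) / 2) * (8 / d ^ 2) * (t * Real.exp (-t))
  calc ∫⁻ z : 𝔼 N in {z | d ≤ ‖z‖}, ‖heatKernel t z‖ₑ
      ≤ ∫⁻ z : 𝔼 N in {z | d ≤ ‖z‖}, ENNReal.ofReal D * ENNReal.ofReal (gaussKernel (2 * t) z) := by
        refine setLIntegral_mono' (measurableSet_le measurable_const measurable_norm)
          fun z hz => ?_
        rw [Real.enorm_of_nonneg (heatKernel_nonneg ht z), ← ENNReal.ofReal_mul (by positivity)]
        exact ENNReal.ofReal_le_ofReal (heatKernel_le_mul_gaussKernel ht hd hz)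
    _ ≤ ∫⁻ z : 𝔼 N, ENNReal.ofReal D * ENNReal.ofReal (gaussKernel (2 * t) z) :=
        setLIntegral_le_lintegral _ _
    _ = ENNReal.ofReal D := by
        rw [lintegral_const_mul' _ _ ENNReal.ofReal_ne_top, lintegral_gaussKernel (by positivity),
          mul_one]

theorem abs_exp_neg_sq_sub_le (a b : ℝ) : |Real.exp (-a ^ 2) - Real.exp (-b ^ 2)| ≤ |a - b| := by
  have hderiv (u : ℝ) :
      HasDerivAt (fun u => Real.exp (-u ^ 2)) (Real.exp (-u ^ 2) * -(2 * u)) u := by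
    simpa using (hasDerivAt_pow 2 u).fun_neg.exp
  have hbound (u : ℝ) : ‖Real.exp (-u ^ 2) * -(2 * u)‖ ≤ 1 := by
    rw [norm_mul, norm_neg, Real.norm_of_nonneg (Real.exp_pos _).le, Real.exp_neg,
      inv_mul_le_one₀ (Real.exp_pos _), Real.norm_eq_abs]
    refine le_trans ?_ (Real.add_one_le_exp (u ^ 2))
    exact abs_le.2 ⟨by nlinarith [sq_nonneg (u + 1)], by nlinarith [sq_nonneg (u - 1)]⟩
  simpa using Convex.norm_image_sub_le_of_norm_hasDerivWithin_le (s := Set.univ) (x := b) (y := a)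
    (fun u _ => (hderiv u).hasDerivWithinAt) (fun u _ => hbound u) convex_univ
    (Set.mem_univ _) (Set.mem_univ _)

variable {δ : ℝ}

theorem heatKernel_le (hδ : 0 < δ) (ht : δ ≤ t) (z : 𝔼 N) :
    heatKernel t z ≤ Real.exp (-t) * ((4 * Real.pi * δ)⁻¹) ^ ((N : ℝ) / 2) := by
  have ht0 : 0 < t := hδ.trans_le ht
  have hexp : Real.exp (-(‖z‖ ^ 2 / (4 * t))) ≤ 1 :=
    Real.exp_le_one_iff.2 (neg_nonpos.2 (by positivity))
  calc heatKernel t z ≤ Real.exp (-t) * (((4 * Real.pi * δ)⁻¹) ^ ((N : ℝ) / 2) * 1) := by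
        unfold heatKernel gaussKernel
        gcongr
    _ = _ := by rw [mul_one]

theorem abs_heatKernel_sub_le (hδ : 0 < δ) (ht : δ ≤ t) (z z' : 𝔼 N) :
    |heatKernel t z - heatKernel t z'| ≤
      Real.exp (-t) * (((4 * Real.pi * δ)⁻¹) ^ ((N : ℝ) / 2) / √δ) * ‖z - z'‖ := by
  have ht0 : 0 < t := hδ.trans_le ht
  have hsq (z : 𝔼 N) : -(‖z‖ ^ 2 / (4 * t)) = -(‖z‖ / (2 * √t)) ^ 2 := by
    rw [div_pow, mul_pow, Real.sq_sqrt ht0.le]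
    norm_num
  have hlip : |Real.exp (-(‖z‖ / (2 * √t)) ^ 2) - Real.exp (-(‖z'‖ / (2 * √t)) ^ 2)| ≤
      ‖z - z'‖ / √δ := by
    refine (abs_exp_neg_sq_sub_le _ _).trans ?_
    rw [← sub_div, abs_div, abs_of_pos (by positivity : 0 < 2 * √t)]
    refine div_le_div₀ (norm_nonneg _) (abs_norm_sub_norm_le _ _) (by positivity) ?_
    linarith [Real.sqrt_le_sqrt ht, Real.sqrt_nonneg t]
  unfold heatKernel gaussKernel
  rw [hsq, hsq, ← mul_sub, ← mul_sub, abs_mul, abs_mul, abs_of_pos (Real.exp_pos _),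
    abs_of_nonneg (by positivity : (0 : ℝ) ≤ ((4 * Real.pi * t)⁻¹) ^ ((N : ℝ) / 2))]
  calc Real.exp (-t) * (((4 * Real.pi * t)⁻¹) ^ ((N : ℝ) / 2) *
        |Real.exp (-(‖z‖ / (2 * √t)) ^ 2) - Real.exp (-(‖z'‖ / (2 * √t)) ^ 2)|)
      ≤ Real.exp (-t) * (((4 * Real.pi * δ)⁻¹) ^ ((N : ℝ) / 2) * (‖z - z'‖ / √δ)) := by gcongr
    _ = _ := by ring

theorem norm_heatKernel_convolution_le (hδ : 0 < δ) (ht : δ ≤ t) {f : (𝔼 N) → E}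
    (hf : Integrable f) (x : 𝔼 N) : ‖(heatKernel t ⋆ f) x‖ ≤
      Real.exp (-t) * (((4 * Real.pi * δ)⁻¹) ^ ((N : ℝ) / 2) * ∫ y, ‖f y‖) := by
  rw [convolution_lsmul_swap, ← mul_assoc, ← integral_const_mul]
  refine norm_integral_le_of_norm_le (hf.norm.const_mul _) (.of_forall fun y => ?_)
  rw [norm_smul, Real.norm_of_nonneg (heatKernel_nonneg (hδ.trans_le ht) _)]
  gcongr
  exact heatKernel_le hδ ht _

theorem integrable_heatKernel_smul (ht : 0 < t) {f : (𝔼 N) → E} (hf : Integrable f) (x : 𝔼 N) :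
    Integrable fun y => heatKernel t (x - y) • f y := by
  have hk : Continuous fun y => heatKernel t (x - y) := by
    have := continuous_heatKernel (N := N) t
    fun_prop
  refine hf.bdd_smul (φ := fun y => heatKernel t (x - y))
    (Real.exp (-t) * ((4 * Real.pi * t)⁻¹) ^ ((N : ℝ) / 2)) hk.aestronglyMeasurable
    (.of_forall fun y => ?_)
  rw [Real.norm_of_nonneg (heatKernel_nonneg ht _)]
  exact heatKernel_le ht le_rfl _

theorem norm_heatKernel_convolution_sub_le (hδ : 0 < δ) (ht : δ ≤ t) {f : (𝔼 N) → E}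
    (hf : Integrable f) (x x' : 𝔼 N) : ‖(heatKernel t ⋆ f) x - (heatKernel t ⋆ f) x'‖ ≤
      Real.exp (-t) * (((4 * Real.pi * δ)⁻¹) ^ ((N : ℝ) / 2) / √δ * (∫ y, ‖f y‖) * ‖x - x'‖) := by
  have ht0 : 0 < t := hδ.trans_le ht
  rw [convolution_lsmul_swap, convolution_lsmul_swap,
    ← integral_sub (integrable_heatKernel_smul ht0 hf x) (integrable_heatKernel_smul ht0 hf x')]
  refine (norm_integral_le_of_norm_le
    (hf.norm.const_mul (Real.exp (-t) * (((4 * Real.pi * δ)⁻¹) ^ ((N : ℝ) / 2) / √δ) * ‖x - x'‖))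
    (.of_forall fun y => ?_)).trans_eq ?_
  · rw [← sub_smul, norm_smul, Real.norm_eq_abs]
    gcongr
    simpa only [sub_sub_sub_cancel_right] using abs_heatKernel_sub_le hδ ht (x - y) (x' - y)
  · rw [integral_const_mul]
    ring

theorem fourier_cexp_eq_gaussKernel (ht : 0 < t) (x y : 𝔼 N) :
    𝓕 (fun ξ : 𝔼 N => Complex.exp (-((4 * Real.pi ^ 2 * t : ℝ) : ℂ) * ‖ξ‖ ^ 2 +
      2 * Real.pi * Complex.I * (inner ℝ x ξ : ℝ))) y = (gaussKernel t (x - y) : ℝ) := by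
  have hπ : (Real.pi : ℂ) ≠ 0 := by exact_mod_cast Real.pi_ne_zero
  have ht' : (t : ℂ) ≠ 0 := by exact_mod_cast ht.ne'
  set b : ℂ := ((4 * Real.pi ^ 2 * t : ℝ) : ℂ) with hb
  rw [fourier_gaussian_innerProductSpace' (by rw [hb, Complex.ofReal_re]; positivity) x y,
    gaussKernel, Complex.ofReal_mul, Complex.ofReal_exp, Complex.ofReal_cpow (by positivity),
    finrank_euclideanSpace, Fintype.card_fin, hb]
  push_cast
  congr 2
  · field_simp
  · field_simp

theorem heatKernel_convolution_eq_fourierInv [CompleteSpace E] (ht : 0 < t) {f : (𝔼 N) → E}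
    (hf : Integrable f) (x : 𝔼 N) :
    (heatKernel t ⋆ f) x = 𝓕⁻ (fun ξ => Real.exp (-(t * besselSymbol ξ)) • 𝓕 f ξ) x := by
  set b : ℂ := ((4 * Real.pi ^ 2 * t : ℝ) : ℂ) with hb
  have hbre : 0 < b.re := by rw [hb, Complex.ofReal_re]; positivity
  have hflip : ∫ y, gaussKernel t (x - y) • f y = ∫ ξ, Complex.exp (-b * ‖ξ‖ ^ 2 +
      2 * Real.pi * Complex.I * (inner ℝ x ξ : ℝ)) • 𝓕 f ξ := by
    have h := VectorFourier.integral_fourierIntegral_smul_eq_flip (L := innerₗ (𝔼 N))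
      (μ := volume) (ν := volume) Real.continuous_fourierChar (by exact continuous_inner)
      (GaussianFourier.integrable_cexp_neg_mul_sq_norm_add hbre (2 * Real.pi * Complex.I) x) hf
    rw [flip_innerₗ] at h
    refine Eq.trans (integral_congr_ae (.of_forall fun y => ?_)) h
    beta_reduce
    rw [← Complex.coe_smul, ← fourier_cexp_eq_gaussKernel ht]
    rfl
  rw [convolution_lsmul_swap, Real.fourierInv_eq']
  simp only [heatKernel, mul_smul]
  rw [integral_smul, hflip, ← integral_smul]
  refine integral_congr_ae (.of_forall fun ξ => ?_)
  simp only [← Complex.coe_smul, ← mul_smul, Complex.ofReal_exp, ← Complex.exp_add]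
  congr 2
  rw [hb, besselSymbol, real_inner_comm]
  push_cast
  ring

end Heat

/-! ### Bessel potentials as integrals over the heat semigroup -/

section PowerIntegrals

variable {s l : ℝ}

/-- The constant `-Γ(-s)`, for which `∫₀^∞ t ^ (-s - 1) (1 - exp (-t l)) dt` equals `l ^ s`
times it when `0 < s < 1`. -/
def subordinationConst (s : ℝ) : ℝ :=
  ∫ t in Set.Ioi (0 : ℝ), t ^ (-s - 1) * (1 - Real.exp (-t))

theorem integrableOn_rpow_mul_one_sub_exp (hs : 0 < s) (hs1 : s < 1) :
    IntegrableOn (fun t : ℝ => t ^ (-s - 1) * (1 - Real.exp (-t))) (Set.Ioi 0) := by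
  have hmeas : Measurable fun t : ℝ => t ^ (-s - 1) * (1 - Real.exp (-t)) := by fun_prop
  have hnorm {t : ℝ} (ht : 0 < t) {b : ℝ} (hb : 1 - Real.exp (-t) ≤ b) :
      ‖t ^ (-s - 1) * (1 - Real.exp (-t))‖ ≤ t ^ (-s - 1) * b := by
    have hexp : Real.exp (-t) ≤ 1 := Real.exp_le_one_iff.2 (neg_nonpos.2 ht.le)
    rw [Real.norm_of_nonneg (mul_nonneg (Real.rpow_nonneg ht.le _) (sub_nonneg.2 hexp))]
    gcongr
  have hnear : IntegrableOn (fun t : ℝ => t ^ (-s)) (Set.Ioc 0 1) :=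
    (intervalIntegrable_iff_integrableOn_Ioc_of_le zero_le_one).1
      (intervalIntegral.intervalIntegrable_rpow' (by linarith))
  have hfar : IntegrableOn (fun t : ℝ => t ^ (-s - 1)) (Set.Ioi 1) :=
    integrableOn_Ioi_rpow_of_lt (by linarith) zero_lt_one
  rw [← Set.Ioc_union_Ioi_eq_Ioi (zero_le_one' ℝ)]
  refine IntegrableOn.union (hnear.mono' hmeas.aestronglyMeasurable ?_)
    (hfar.mono' hmeas.aestronglyMeasurable ?_)
  · filter_upwards [self_mem_ae_restrict measurableSet_Ioc] with t ht
    refine (hnorm ht.1 (by linarith [Real.add_one_le_exp (-t)] : _ ≤ t)).trans_eq ?_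
    rw [← Real.rpow_add_one ht.1.ne', sub_add_cancel]
  · filter_upwards [self_mem_ae_restrict measurableSet_Ioi] with t ht
    simpa using hnorm (zero_lt_one.trans ht) (by linarith [Real.exp_pos (-t)] : _ ≤ (1 : ℝ))

theorem subordinationConst_pos (hs : 0 < s) (hs1 : s < 1) : 0 < subordinationConst s := by
  have hpos : ∀ t ∈ Set.Ioi (0 : ℝ), 0 < t ^ (-s - 1) * (1 - Real.exp (-t)) := fun t ht =>
    mul_pos (Real.rpow_pos_of_pos ht _)
      (sub_pos.2 (Real.exp_lt_one_iff.2 (neg_neg_of_pos ht)))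
  rw [subordinationConst, setIntegral_pos_iff_support_of_nonneg_ae
    (by filter_upwards [self_mem_ae_restrict measurableSet_Ioi] with t ht using (hpos t ht).le)
    (integrableOn_rpow_mul_one_sub_exp hs hs1)]
  refine lt_of_lt_of_le (by simp) (measure_mono (s := Set.Ioi (0 : ℝ)) fun t ht => ?_)
  exact ⟨(hpos t ht).ne', ht⟩

theorem rpow_mul_one_sub_exp_scale (hl : 0 < l) {t : ℝ} (ht : 0 < t) :
    t ^ (-s - 1) * (1 - Real.exp (-(t * l))) =
      l ^ (s + 1) * ((l * t) ^ (-s - 1) * (1 - Real.exp (-(l * t)))) := by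
  have hcancel : l ^ (s + 1) * l ^ (-s - 1) = 1 := by
    rw [← Real.rpow_add hl, add_add_sub_cancel, add_neg_cancel, Real.rpow_zero]
  rw [Real.mul_rpow hl.le ht.le, mul_comm t l]
  linear_combination (-(t ^ (-s - 1) * (1 - Real.exp (-(l * t))))) * hcancel

theorem integrableOn_rpow_mul_one_sub_exp_mul (hs : 0 < s) (hs1 : s < 1) (hl : 0 < l) :
    IntegrableOn (fun t : ℝ => t ^ (-s - 1) * (1 - Real.exp (-(t * l)))) (Set.Ioi 0) := by
  have h := (integrableOn_Ioi_comp_mul_left_iff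
    (fun t : ℝ => t ^ (-s - 1) * (1 - Real.exp (-t))) 0 hl).2
    (by rw [mul_zero]; exact integrableOn_rpow_mul_one_sub_exp hs hs1)
  exact IntegrableOn.congr_fun (Integrable.const_mul h (l ^ (s + 1)))
    (fun t ht => (rpow_mul_one_sub_exp_scale hl ht).symm) measurableSet_Ioi

theorem integral_rpow_mul_one_sub_exp_mul (hl : 0 < l) :
    ∫ t in Set.Ioi (0 : ℝ), t ^ (-s - 1) * (1 - Real.exp (-(t * l))) =
      subordinationConst s * l ^ s := by
  rw [setIntegral_congr_fun measurableSet_Ioi fun t ht => rpow_mul_one_sub_exp_scale hl ht,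
    integral_const_mul,
    integral_comp_mul_left_Ioi (fun t : ℝ => t ^ (-s - 1) * (1 - Real.exp (-t))) 0 hl, mul_zero,
    smul_eq_mul, Real.rpow_add_one hl.ne', subordinationConst]
  field_simp

theorem integrableOn_rpow_mul_exp_neg_mul (hs : 0 < s) (hl : 0 < l) :
    IntegrableOn (fun t : ℝ => t ^ (s - 1) * Real.exp (-(t * l))) (Set.Ioi 0) := by
  simpa only [Real.rpow_one, neg_mul, mul_comm l] using
    integrableOn_rpow_mul_exp_neg_mul_rpow (p := 1) (by linarith : -1 < s - 1) zero_lt_one hl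

theorem integral_rpow_mul_exp_neg_mul (hs : 0 < s) (hl : 0 < l) :
    ∫ t in Set.Ioi (0 : ℝ), t ^ (s - 1) * Real.exp (-(t * l)) = Real.Gamma s * l ^ (-s) := by
  simp only [mul_comm _ l]
  rw [Real.integral_rpow_mul_exp_neg_mul_Ioi hs hl, one_div, Real.inv_rpow hl.le,
    Real.rpow_neg hl.le, mul_comm]

end PowerIntegrals

section Subordination

variable {α : Type*} [MeasurableSpace α] {μ : Measure α} {N : ℕ}
  {E : Type*} [NormedAddCommGroup E] [NormedSpace ℂ E]

theorem integrable_uncurry_smul [SFinite μ] {k : α → (𝔼 N) → ℝ} {G : (𝔼 N) → E}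
    (hk : Measurable (Function.uncurry k)) (hk0 : ∀ ξ, ∀ᵐ t ∂μ, 0 ≤ k t ξ)
    (hki : ∀ ξ, Integrable (fun t => k t ξ) μ) (hG : AEStronglyMeasurable G)
    (hkG : Integrable fun ξ => (∫ t, k t ξ ∂μ) • G ξ) :
    Integrable (Function.uncurry fun t ξ => k t ξ • G ξ) (μ.prod volume) := by
  refine (integrable_prod_iff' (hk.aestronglyMeasurable.smul hG.comp_snd)).2
    ⟨.of_forall fun ξ => (hki ξ).smul_const (G ξ), hkG.norm.congr (.of_forall fun ξ => ?_)⟩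
  have hnorm : (fun t => ‖k t ξ • G ξ‖) =ᵐ[μ] fun t => k t ξ * ‖G ξ‖ := by
    filter_upwards [hk0 ξ] with t ht
    rw [norm_smul, Real.norm_of_nonneg ht]
  change ‖(∫ t, k t ξ ∂μ) • G ξ‖ = ∫ t, ‖k t ξ • G ξ‖ ∂μ
  rw [integral_congr_ae hnorm, integral_mul_const, norm_smul,
    Real.norm_of_nonneg (integral_nonneg_of_ae (hk0 ξ))]

theorem integrable_fourierChar_smul [SFinite μ] {H : α → (𝔼 N) → E}
    (hH : Integrable (Function.uncurry H) (μ.prod volume)) (x : 𝔼 N) :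
    Integrable (Function.uncurry fun t ξ => Real.fourierChar (inner ℝ ξ x) • H t ξ)
      (μ.prod volume) := by
  have hchar : Continuous fun ξ : 𝔼 N => ((Real.fourierChar (inner ℝ ξ x) : Circle) : ℂ) :=
    continuous_subtype_val.comp
      (Real.continuous_fourierChar.comp (continuous_id.inner continuous_const))
  exact hH.bdd_smul (φ := fun p : α × (𝔼 N) => ((Real.fourierChar (inner ℝ p.2 x) : Circle) : ℂ)) 1
    (hchar.aestronglyMeasurable.comp_snd) (.of_forall fun p => (Circle.norm_coe _).le)

theorem integrable_fourierInv [SFinite μ] {H : α → (𝔼 N) → E}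
    (hH : Integrable (Function.uncurry H) (μ.prod volume)) (x : 𝔼 N) :
    Integrable (fun t => 𝓕⁻ (H t) x) μ := by
  simp only [Real.fourierInv_eq]
  exact (integrable_fourierChar_smul hH x).integral_prod_left

theorem integral_fourierInv [SFinite μ] {H : α → (𝔼 N) → E}
    (hH : Integrable (Function.uncurry H) (μ.prod volume)) (x : 𝔼 N) :
    ∫ t, 𝓕⁻ (H t) x ∂μ = 𝓕⁻ (fun ξ => ∫ t, H t ξ ∂μ) x := by
  simp only [Real.fourierInv_eq]
  rw [integral_integral_swap (integrable_fourierChar_smul hH x)]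
  congr 1 with ξ
  exact integral_smul ((Real.fourierChar (inner ℝ ξ x) : Circle) : ℂ) _

end Subordination

section BesselPow

open scoped SchwartzMap

variable {N : ℕ} {E : Type*} [NormedAddCommGroup E] [NormedSpace ℂ E]

/-- The operator `(1 - Δ) ^ s` on Schwartz functions. -/
def besselPow (s : ℝ) : 𝓢(𝔼 N, E) →L[ℝ] 𝓢(𝔼 N, E) :=
  SchwartzMap.fourierMultiplierCLM E fun ξ => besselSymbol ξ ^ s

theorem hasTemperateGrowth_besselSymbol_rpow (s : ℝ) :
    Function.HasTemperateGrowth fun ξ : 𝔼 N => besselSymbol ξ ^ s := by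
  have h : (fun ξ : 𝔼 N => besselSymbol ξ ^ s) =
      (fun ξ : 𝔼 N => (1 + ‖ξ‖ ^ 2) ^ s) ∘ fun ξ => (2 * Real.pi) • ξ := by
    ext ξ
    rw [Function.comp_apply, norm_smul, Real.norm_of_nonneg (by positivity), besselSymbol]
    ring_nf
  rw [h]
  exact (Function.hasTemperateGrowth_one_add_norm_sq_rpow (𝔼 N) s).comp (by fun_prop)

theorem coe_besselPow (s : ℝ) (f : 𝓢(𝔼 N, E)) :
    ⇑(besselPow s f) = 𝓕⁻ fun ξ => besselSymbol ξ ^ s • 𝓕 f ξ := by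
  rw [besselPow, SchwartzMap.fourierMultiplierCLM_apply, SchwartzMap.fourierInv_coe]
  congr 1 with ξ
  exact SchwartzMap.smulLeftCLM_apply_apply (hasTemperateGrowth_besselSymbol_rpow s) (𝓕 f) ξ

theorem integrable_rpow_smul_fourier (s : ℝ) (f : 𝓢(𝔼 N, E)) :
    Integrable fun ξ => besselSymbol ξ ^ s • 𝓕 f ξ := by
  have h : ⇑(SchwartzMap.smulLeftCLM E (fun ξ : 𝔼 N => besselSymbol ξ ^ s) (𝓕 f)) =
      fun ξ => besselSymbol ξ ^ s • 𝓕 f ξ :=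
    funext (SchwartzMap.smulLeftCLM_apply_apply (hasTemperateGrowth_besselSymbol_rpow s) (𝓕 f))
  exact h ▸ SchwartzMap.integrable _

variable {s t : ℝ}

theorem fourierInv_const_smul (a : ℝ) (G : (𝔼 N) → E) (x : 𝔼 N) :
    𝓕⁻ (fun ξ => a • G ξ) x = a • 𝓕⁻ G x := by
  simp only [Real.fourierInv_eq, smul_comm _ a]
  exact integral_smul a _

theorem integrable_exp_smul_fourier (ht : 0 ≤ t) (f : 𝓢(𝔼 N, E)) :
    Integrable fun ξ => Real.exp (-(t * besselSymbol ξ)) • 𝓕 f ξ := by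
  refine (𝓕 f).integrable.bdd_smul (φ := fun ξ => Real.exp (-(t * besselSymbol ξ))) 1 ?_
    (.of_forall fun ξ => ?_)
  · have hσ := continuous_besselSymbol (N := N)
    exact (by fun_prop : Continuous fun ξ : 𝔼 N =>
      Real.exp (-(t * besselSymbol ξ))).aestronglyMeasurable
  · rw [Real.norm_of_nonneg (Real.exp_pos _).le, Real.exp_le_one_iff]
    exact neg_nonpos.2 (mul_nonneg ht (besselSymbol_pos ξ).le)

theorem fourierInv_sub {G H : (𝔼 N) → E} (hG : Integrable G) (hH : Integrable H) (x : 𝔼 N) :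
    𝓕⁻ (fun ξ => G ξ - H ξ) x = 𝓕⁻ G x - 𝓕⁻ H x := by
  simp only [Real.fourierInv_eq, smul_sub]
  have hchar : ∀ {G : (𝔼 N) → E}, Integrable G →
      Integrable fun ξ => Real.fourierChar (inner ℝ ξ x) • G ξ := fun hG => by
    simpa using (Real.fourierIntegral_convergent_iff (-x)).2 hG
  exact integral_sub (hchar hG) (hchar hH)

theorem integrable_rpow_mul_one_sub_exp_smul_fourier (hs : 0 < s) (hs1 : s < 1) (f : 𝓢(𝔼 N, E)) :
    Integrable (Function.uncurry fun t ξ =>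
      (t ^ (-s - 1) * (1 - Real.exp (-(t * besselSymbol ξ)))) • 𝓕 f ξ)
      ((volume.restrict (Set.Ioi 0)).prod volume) := by
  have hσ := (continuous_besselSymbol (N := N)).measurable
  refine integrable_uncurry_smul (by unfold Function.uncurry; fun_prop) (fun ξ => ?_)
    (fun ξ => integrableOn_rpow_mul_one_sub_exp_mul hs hs1 (besselSymbol_pos ξ))
    (𝓕 f).integrable.aestronglyMeasurable ?_
  · filter_upwards [self_mem_ae_restrict measurableSet_Ioi] with t ht
    refine mul_nonneg (Real.rpow_nonneg (le_of_lt ht) _) (sub_nonneg.2 (Real.exp_le_one_iff.2 ?_))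
    exact neg_nonpos.2 (mul_pos ht (besselSymbol_pos ξ)).le
  · simp only [integral_rpow_mul_one_sub_exp_mul (besselSymbol_pos _), mul_smul]
    exact (integrable_rpow_smul_fourier s f).smul (subordinationConst s)

theorem integrable_rpow_mul_exp_smul_fourier (hs : 0 < s) (f : 𝓢(𝔼 N, E)) :
    Integrable (Function.uncurry fun t ξ =>
      (t ^ (s - 1) * Real.exp (-(t * besselSymbol ξ))) • 𝓕 f ξ)
      ((volume.restrict (Set.Ioi 0)).prod volume) := by
  have hσ := (continuous_besselSymbol (N := N)).measurable
  refine integrable_uncurry_smul (by unfold Function.uncurry; fun_prop) (fun ξ => ?_)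
    (fun ξ => integrableOn_rpow_mul_exp_neg_mul hs (besselSymbol_pos ξ))
    (𝓕 f).integrable.aestronglyMeasurable ?_
  · filter_upwards [self_mem_ae_restrict measurableSet_Ioi] with t ht
    exact mul_nonneg (Real.rpow_nonneg (le_of_lt ht) _) (Real.exp_pos _).le
  · simp only [integral_rpow_mul_exp_neg_mul hs (besselSymbol_pos _), mul_smul]
    exact (integrable_rpow_smul_fourier (-s) f).smul (Real.Gamma s)

variable [CompleteSpace E]

theorem besselPow_neg_besselPow (s : ℝ) (f : 𝓢(𝔼 N, E)) : besselPow (-s) (besselPow s f) = f := by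
  have hmul : ((fun ξ : 𝔼 N => besselSymbol ξ ^ (-s)) * fun ξ => besselSymbol ξ ^ s) =
      fun _ => 1 := by
    ext ξ
    rw [Pi.mul_apply, ← Real.rpow_add (besselSymbol_pos ξ), neg_add_cancel, Real.rpow_zero]
  rw [besselPow, besselPow, SchwartzMap.fourierMultiplierCLM_fourierMultiplierCLM_apply
    (hasTemperateGrowth_besselSymbol_rpow _) (hasTemperateGrowth_besselSymbol_rpow _), hmul,
    SchwartzMap.fourierMultiplierCLM_const]
  simp

theorem sub_heatKernel_convolution_eq_fourierInv (ht : 0 < t) (f : 𝓢(𝔼 N, E)) (x : 𝔼 N) :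
    f x - (heatKernel t ⋆ f) x =
      𝓕⁻ (fun ξ => (1 - Real.exp (-(t * besselSymbol ξ))) • 𝓕 f ξ) x := by
  have hinv : 𝓕⁻ (fun ξ => 𝓕 f ξ) x = f x := by
    rw [← SchwartzMap.fourierInv_coe, FourierTransform.fourierInv_fourier_eq]
  simp only [sub_smul, one_smul]
  rw [fourierInv_sub (𝓕 f).integrable (integrable_exp_smul_fourier ht.le f), hinv,
    heatKernel_convolution_eq_fourierInv ht f.integrable, SchwartzMap.fourier_coe]

theorem rpow_smul_sub_heatKernel_convolution (ht : 0 < t) (f : 𝓢(𝔼 N, E)) (x : 𝔼 N) :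
    t ^ (-s - 1) • (f x - (heatKernel t ⋆ f) x) =
      𝓕⁻ (fun ξ => (t ^ (-s - 1) * (1 - Real.exp (-(t * besselSymbol ξ)))) • 𝓕 f ξ) x := by
  rw [sub_heatKernel_convolution_eq_fourierInv ht, ← fourierInv_const_smul]
  simp only [mul_smul]

theorem exists_integrableOn_norm_rpow_smul_sub_le (hs : 0 < s) (hs1 : s < 1) (f : 𝓢(𝔼 N, E)) :
    ∃ D : ℝ → ℝ, IntegrableOn D (Set.Ioi 0) ∧ ∀ t, 0 < t → ∀ x,
      ‖t ^ (-s - 1) • (f x - (heatKernel t ⋆ f) x)‖ ≤ D t := by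
  refine ⟨_, (integrable_rpow_mul_one_sub_exp_smul_fourier hs hs1 f).norm.integral_prod_left,
    fun t ht x => ?_⟩
  rw [rpow_smul_sub_heatKernel_convolution ht, Real.fourierInv_eq]
  refine (norm_integral_le_integral_norm _).trans_eq (integral_congr_ae (.of_forall fun ξ => ?_))
  exact Circle.norm_smul _ _

theorem integrableOn_rpow_smul_sub_heatKernel_convolution (hs : 0 < s) (hs1 : s < 1)
    (f : 𝓢(𝔼 N, E)) (x : 𝔼 N) :
    IntegrableOn (fun t => t ^ (-s - 1) • (f x - (heatKernel t ⋆ f) x)) (Set.Ioi 0) :=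
  IntegrableOn.congr_fun
    (integrable_fourierInv (integrable_rpow_mul_one_sub_exp_smul_fourier hs hs1 f) x)
    (fun _ ht => (rpow_smul_sub_heatKernel_convolution ht f x).symm) measurableSet_Ioi

theorem integral_rpow_smul_sub_heatKernel_convolution (hs : 0 < s) (hs1 : s < 1) (f : 𝓢(𝔼 N, E))
    (x : 𝔼 N) : ∫ t in Set.Ioi (0 : ℝ), t ^ (-s - 1) • (f x - (heatKernel t ⋆ f) x) =
      subordinationConst s • besselPow s f x := by
  rw [setIntegral_congr_fun measurableSet_Ioi
      fun t ht => rpow_smul_sub_heatKernel_convolution ht f x,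
    integral_fourierInv (integrable_rpow_mul_one_sub_exp_smul_fourier hs hs1 f), coe_besselPow,
    ← fourierInv_const_smul]
  simp only [integral_smul_const, integral_rpow_mul_one_sub_exp_mul (besselSymbol_pos _)]
  simp only [mul_smul]

theorem rpow_smul_heatKernel_convolution (ht : 0 < t) (f : 𝓢(𝔼 N, E)) (x : 𝔼 N) :
    t ^ (s - 1) • (heatKernel t ⋆ f) x =
      𝓕⁻ (fun ξ => (t ^ (s - 1) * Real.exp (-(t * besselSymbol ξ))) • 𝓕 f ξ) x := by
  rw [heatKernel_convolution_eq_fourierInv ht f.integrable, ← fourierInv_const_smul]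
  simp only [mul_smul, SchwartzMap.fourier_coe]

theorem integrableOn_rpow_smul_heatKernel_convolution (hs : 0 < s) (f : 𝓢(𝔼 N, E)) (x : 𝔼 N) :
    IntegrableOn (fun t => t ^ (s - 1) • (heatKernel t ⋆ f) x) (Set.Ioi 0) :=
  IntegrableOn.congr_fun (integrable_fourierInv (integrable_rpow_mul_exp_smul_fourier hs f) x)
    (fun _ ht => (rpow_smul_heatKernel_convolution ht f x).symm) measurableSet_Ioi

theorem integral_rpow_smul_heatKernel_convolution (hs : 0 < s) (f : 𝓢(𝔼 N, E)) (x : 𝔼 N) :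
    ∫ t in Set.Ioi (0 : ℝ), t ^ (s - 1) • (heatKernel t ⋆ f) x =
      Real.Gamma s • besselPow (-s) f x := by
  rw [setIntegral_congr_fun measurableSet_Ioi fun t ht => rpow_smul_heatKernel_convolution ht f x,
    integral_fourierInv (integrable_rpow_mul_exp_smul_fourier hs f), coe_besselPow,
    ← fourierInv_const_smul]
  simp only [integral_smul_const, integral_rpow_mul_exp_neg_mul hs (besselSymbol_pos _)]
  simp only [mul_smul]

end BesselPow

section BesselEstimates

open scoped SchwartzMap

variable {N : ℕ} {E : Type*} [NormedAddCommGroup E]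

section NormedSpaceReal

variable [NormedSpace ℝ E]

theorem stronglyMeasurable_uncurry_convolution {k : ℝ → (𝔼 N) → ℝ}
    (hk : Measurable (Function.uncurry k)) {f : (𝔼 N) → E} (hf : Continuous f) :
    StronglyMeasurable (Function.uncurry fun t => k t ⋆ f) := by
  have hkf : StronglyMeasurable fun q : (ℝ × (𝔼 N)) × (𝔼 N) => k q.1.1 q.2 • f (q.1.2 - q.2) :=
    (hk.comp (by fun_prop : Measurable fun q : (ℝ × (𝔼 N)) × (𝔼 N) => (q.1.1, q.2))
      ).stronglyMeasurable.smul (by fun_prop : Continuous _).stronglyMeasurable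
  exact hkf.integral_prod_right'

theorem lintegral_lintegral_mul_enorm_convolution_le {μ : Measure ℝ} [SFinite μ] {w : ℝ → ℝ≥0∞}
    (hw : Measurable w) {k : ℝ → (𝔼 N) → ℝ} (hk : Measurable (Function.uncurry k))
    {f : (𝔼 N) → E} (hf : Continuous f) :
    ∫⁻ x, ∫⁻ t, w t * ‖(k t ⋆ f) x‖ₑ ∂μ ≤
      (∫⁻ t, w t * (∫⁻ z, ‖k t z‖ₑ) ∂μ) * ∫⁻ x, ‖f x‖ₑ := by
  have hconv := stronglyMeasurable_uncurry_convolution hk hf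
  have hwk : Measurable fun t => w t * ∫⁻ z, ‖k t z‖ₑ := hw.mul hk.enorm.lintegral_prod_right'
  rw [lintegral_lintegral_swap ((hw.comp measurable_snd).mul
      (hconv.comp_measurable measurable_swap).enorm).aemeasurable,
    ← lintegral_mul_const _ hwk]
  refine lintegral_mono fun t => ?_
  have hconv_t : Measurable fun x => ‖(k t ⋆ f) x‖ₑ :=
    (hconv.comp_measurable measurable_prodMk_left).enorm
  rw [lintegral_const_mul _ hconv_t, mul_assoc]
  gcongr
  exact lintegral_enorm_convolution_le hk.of_uncurry_left.aestronglyMeasurable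
    hf.aestronglyMeasurable

theorem convolution_eq_indicator_convolution {ρ : (𝔼 N) → ℝ} {f : (𝔼 N) → E} {d : ℝ} {x : 𝔼 N}
    (hx : ∀ y ∈ tsupport f, d ≤ ‖x - y‖) :
    (ρ ⋆ f) x = ({z | d ≤ ‖z‖}.indicator ρ ⋆ f) x := by
  refine integral_congr_ae (.of_forall fun z => ?_)
  by_cases hz : d ≤ ‖z‖
  · simp only [Set.indicator_of_mem (show z ∈ {z : 𝔼 N | d ≤ ‖z‖} from hz)]
  · have hfz : f (x - z) = 0 := image_eq_zero_of_notMem_tsupport fun h =>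
      hz ((hx _ h).trans_eq (by rw [sub_sub_cancel]))
    simp only [hfz, map_zero]

end NormedSpaceReal

theorem lintegral_rpow_mul_enorm_indicator_heatKernel_le {s d : ℝ} (hs1 : s < 1) (hd : 0 < d) :
    ∫⁻ t in Set.Ioi (0 : ℝ), ENNReal.ofReal (t ^ (-s - 1)) *
        ∫⁻ z : 𝔼 N, ‖{z | d ≤ ‖z‖}.indicator (heatKernel t) z‖ₑ ≤
      ENNReal.ofReal (2 ^ ((N : ℝ) / 2) * (8 / d ^ 2) * Real.Gamma (1 - s)) := by
  have hD : 0 ≤ 2 ^ ((N : ℝ) / 2) * (8 / d ^ 2) := by positivity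
  have hms : MeasurableSet {z : 𝔼 N | d ≤ ‖z‖} := measurableSet_le measurable_const measurable_norm
  have hΓ : 0 ≤ᵐ[volume.restrict (Set.Ioi 0)] fun t : ℝ => Real.exp (-t) * t ^ (1 - s - 1) := by
    filter_upwards [self_mem_ae_restrict measurableSet_Ioi] with t ht
    exact mul_nonneg (Real.exp_pos _).le (Real.rpow_nonneg (le_of_lt ht) _)
  rw [Real.Gamma_eq_integral (by linarith), ENNReal.ofReal_mul hD,
    ofReal_integral_eq_lintegral_ofReal (Real.GammaIntegral_convergent (by linarith)) hΓ,
    ← lintegral_const_mul' _ _ ENNReal.ofReal_ne_top]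
  refine setLIntegral_mono' measurableSet_Ioi fun t ht => ?_
  simp only [enorm_indicator_eq_indicator_enorm]
  rw [lintegral_indicator hms]
  refine (mul_le_mul_right (setLIntegral_enorm_heatKernel_le ht hd) _).trans_eq ?_
  have hpow : t ^ (-s - 1) * t = t ^ (1 - s - 1) := by
    rw [← Real.rpow_add_one (ne_of_gt ht)]
    ring_nf
  rw [← ENNReal.ofReal_mul (Real.rpow_nonneg (le_of_lt ht) _), ← ENNReal.ofReal_mul hD, ← hpow]
  ring_nf

variable [NormedSpace ℂ E] [CompleteSpace E]

theorem enorm_besselPow_le_of_dist_tsupport {s d : ℝ} (hs : 0 < s) (hs1 : s < 1) (hd : 0 < d)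
    {f : 𝓢(𝔼 N, E)} {x : 𝔼 N} (hx : ∀ y ∈ tsupport f, d ≤ ‖x - y‖) :
    ENNReal.ofReal (subordinationConst s) * ‖besselPow s f x‖ₑ ≤
      ∫⁻ t in Set.Ioi (0 : ℝ), ENNReal.ofReal (t ^ (-s - 1)) *
        ‖({z | d ≤ ‖z‖}.indicator (heatKernel t) ⋆ f) x‖ₑ := by
  have hfx : f x = 0 := image_eq_zero_of_notMem_tsupport fun h =>
    hd.not_ge ((hx x h).trans_eq (by rw [sub_self, norm_zero]))
  rw [← Real.enorm_of_nonneg (subordinationConst_pos hs hs1).le, ← enorm_smul,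
    ← integral_rpow_smul_sub_heatKernel_convolution hs hs1]
  refine (enorm_integral_le_lintegral_enorm _).trans
    (setLIntegral_mono' measurableSet_Ioi fun t ht => ?_)
  rw [enorm_smul, Real.enorm_of_nonneg (Real.rpow_nonneg (le_of_lt ht) _), hfx, zero_sub,
    enorm_neg, convolution_eq_indicator_convolution hx]

theorem exists_setLIntegral_enorm_besselPow_le {s d : ℝ} (hs : 0 < s) (hs1 : s < 1) (hd : 0 < d) :
    ∃ C : ℝ≥0, ∀ (f : 𝓢(𝔼 N, E)) {V : Set (𝔼 N)}, MeasurableSet V →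
      (∀ x ∈ V, ∀ y ∈ tsupport f, d ≤ ‖x - y‖) →
      ∫⁻ x in V, ‖besselPow s f x‖ₑ ≤ C * ∫⁻ x, ‖f x‖ₑ := by
  have hc := subordinationConst_pos hs hs1
  set D := 2 ^ ((N : ℝ) / 2) * (8 / d ^ 2) * Real.Gamma (1 - s)
  refine ⟨(D / subordinationConst s).toNNReal, fun f V hV hdist => ?_⟩
  have hms : MeasurableSet {z : 𝔼 N | d ≤ ‖z‖} := measurableSet_le measurable_const measurable_norm
  have hk : Measurable (Function.uncurry fun t => {z : 𝔼 N | d ≤ ‖z‖}.indicator (heatKernel t)) :=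
    (measurable_uncurry_heatKernel (N := N)).indicator (measurable_snd hms)
  change _ ≤ ENNReal.ofReal (D / subordinationConst s) * _
  rw [ENNReal.ofReal_div_of_pos hc, ← ENNReal.mul_div_right_comm,
    ENNReal.le_div_iff_mul_le (.inl (by simpa using hc)) (.inl ENNReal.ofReal_ne_top), mul_comm,
    ← lintegral_const_mul' _ _ ENNReal.ofReal_ne_top]
  refine (setLIntegral_mono' hV fun x hx =>
    enorm_besselPow_le_of_dist_tsupport hs hs1 hd (hdist x hx)).trans ?_
  refine (setLIntegral_le_lintegral _ _).trans
    ((lintegral_lintegral_mul_enorm_convolution_le (by fun_prop) hk f.continuous).trans ?_)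
  gcongr
  exact lintegral_rpow_mul_enorm_indicator_heatKernel_le hs1 hd

end BesselEstimates

section KatoInequality

open scoped SchwartzMap

variable {N : ℕ} {E : Type*} [NormedAddCommGroup E]

theorem integral_mul_norm_sub_norm_le {α : Type*} [MeasurableSpace α] {μ : Measure α}
    [NormedSpace ℝ E] [CompleteSpace E] {a : α → ℝ} (ha : 0 ≤ᵐ[μ] a) (e : E) {w : α → E}
    (hw : Integrable (fun t => a t • (e - w t)) μ) :
    ∫ t, a t * (‖e‖ - ‖w t‖) ∂μ ≤ ‖∫ t, a t • (e - w t) ∂μ‖ := by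
  by_cases hn : Integrable (fun t => a t * (‖e‖ - ‖w t‖)) μ
  swap
  · exact (integral_undef hn).trans_le (norm_nonneg _)
  obtain ⟨g, hg, hge⟩ := exists_dual_vector'' ℝ e
  have hg_le (v : E) : g v ≤ ‖v‖ :=
    (le_abs_self _).trans ((g.le_of_opNorm_le hg v).trans_eq (one_mul _))
  calc ∫ t, a t * (‖e‖ - ‖w t‖) ∂μ ≤ ∫ t, g (a t • (e - w t)) ∂μ := by
        refine integral_mono_ae hn (g.integrable_comp hw) ?_
        filter_upwards [ha] with t ht
        rw [map_smul, map_sub, hge, smul_eq_mul]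
        have hgw : g (w t) ≤ ‖w t‖ := hg_le (w t)
        exact mul_le_mul_of_nonneg_left (sub_le_sub_left hgw _) ht
    _ = g (∫ t, a t • (e - w t) ∂μ) := g.integral_comp_comm hw
    _ ≤ ‖∫ t, a t • (e - w t) ∂μ‖ := hg_le _

theorem integrable_heatKernel_convolution [NormedSpace ℝ E] {t : ℝ} (ht : 0 < t) {f : (𝔼 N) → E}
    (hf : Integrable f) : Integrable (heatKernel t ⋆ f) :=
  Integrable.integrable_convolution _
    ⟨(continuous_heatKernel t).aestronglyMeasurable, by
      rw [HasFiniteIntegral, lintegral_enorm_heatKernel ht]; exact ENNReal.ofReal_lt_top⟩ hf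

theorem integral_norm_heatKernel_convolution_le [NormedSpace ℝ E] {t : ℝ} (ht : 0 < t)
    {f : (𝔼 N) → E} (hf : Integrable f) :
    ∫ x, ‖(heatKernel t ⋆ f) x‖ ≤ Real.exp (-t) * ∫ x, ‖f x‖ := by
  have hyoung := lintegral_enorm_convolution_le
    (continuous_heatKernel (N := N) t).aestronglyMeasurable hf.aestronglyMeasurable
  rw [lintegral_enorm_heatKernel ht, ← ofReal_integral_norm_eq_lintegral_enorm hf,
    ← ofReal_integral_norm_eq_lintegral_enorm (integrable_heatKernel_convolution ht hf),
    ← ENNReal.ofReal_mul (Real.exp_pos _).le] at hyoung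
  exact (ENNReal.ofReal_le_ofReal_iff (by positivity)).1 hyoung

variable [NormedSpace ℂ E] {s : ℝ} {f : 𝓢(𝔼 N, E)} {K : Set (𝔼 N)}

theorem le_setIntegral_rpow_mul_norm_sub_norm {t : ℝ} (ht : 0 < t) (hfK : Function.support f ⊆ K) :
    t ^ (-s - 1) * (1 - Real.exp (-t)) * ∫ x, ‖f x‖ ≤
      ∫ x in K, t ^ (-s - 1) * (‖f x‖ - ‖(heatKernel t ⋆ f) x‖) := by
  have hconv := integrable_heatKernel_convolution ht f.integrable
  have hle : ∫ x in K, ‖(heatKernel t ⋆ f) x‖ ≤ Real.exp (-t) * ∫ x, ‖f x‖ :=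
    (setIntegral_le_integral hconv.norm (.of_forall fun x => norm_nonneg _)).trans
      (integral_norm_heatKernel_convolution_le ht f.integrable)
  rw [integral_const_mul, integral_sub f.integrable.norm.integrableOn hconv.norm.integrableOn,
    setIntegral_eq_integral_of_forall_compl_eq_zero fun x hx => by
      rw [Function.notMem_support.1 fun h => hx (hfK h), norm_zero], mul_assoc]
  gcongr
  linarith

variable [CompleteSpace E]

theorem integrable_rpow_mul_norm_sub_norm (hs : 0 < s) (hs1 : s < 1) (f : 𝓢(𝔼 N, E))
    (hK : volume K ≠ ⊤) :
    Integrable (Function.uncurry fun t x => t ^ (-s - 1) * (‖f x‖ - ‖(heatKernel t ⋆ f) x‖))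
      ((volume.restrict (Set.Ioi 0)).prod (volume.restrict K)) := by
  have : IsFiniteMeasure (volume.restrict K) := isFiniteMeasure_restrict.2 hK
  obtain ⟨D, hD, hle⟩ := exists_integrableOn_norm_rpow_smul_sub_le hs hs1 f
  have hconv := stronglyMeasurable_uncurry_convolution measurable_uncurry_heatKernel f.continuous
  refine (hD.comp_fst (volume.restrict K)).mono' ?_ ?_
  · exact ((by fun_prop : Measurable fun p : ℝ × (𝔼 N) => p.1 ^ (-s - 1)).stronglyMeasurable.mul
      ((f.continuous.comp continuous_snd).norm.stronglyMeasurable.sub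
        hconv.norm)).aestronglyMeasurable
  · filter_upwards [Measure.quasiMeasurePreserving_fst.ae
      (self_mem_ae_restrict measurableSet_Ioi)] with p hp
    refine le_trans ?_ (hle p.1 hp p.2)
    rw [Function.uncurry, norm_mul, norm_smul]
    gcongr
    exact abs_norm_sub_norm_le _ _

theorem integral_rpow_mul_norm_sub_norm_le (hs : 0 < s) (hs1 : s < 1) (f : 𝓢(𝔼 N, E)) (x : 𝔼 N) :
    ∫ t in Set.Ioi (0 : ℝ), t ^ (-s - 1) * (‖f x‖ - ‖(heatKernel t ⋆ f) x‖) ≤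
      subordinationConst s * ‖besselPow s f x‖ := by
  have hc := subordinationConst_pos hs hs1
  have hnonneg : 0 ≤ᵐ[volume.restrict (Set.Ioi 0)] fun t : ℝ => t ^ (-s - 1) := by
    filter_upwards [self_mem_ae_restrict measurableSet_Ioi] with t ht
    exact Real.rpow_nonneg (le_of_lt ht) _
  rw [← Real.norm_of_nonneg hc.le, ← norm_smul,
    ← integral_rpow_smul_sub_heatKernel_convolution hs hs1]
  refine integral_mul_norm_sub_norm_le hnonneg (f x)
    (integrableOn_rpow_smul_sub_heatKernel_convolution hs hs1 f x)

/-- The heat semigroup contracts `L¹`, so averaging `‖f x‖ - ‖e ^ (-t (1 - Δ)) f x‖` over `t`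
bounds `(1 - Δ) ^ s f` from below by `‖f‖` in `L¹`. -/
theorem lintegral_enorm_le_setLIntegral_enorm_besselPow (hs : 0 < s) (hs1 : s < 1)
    (hK : volume K ≠ ⊤) (hfK : Function.support f ⊆ K) :
    ∫⁻ x, ‖f x‖ₑ ≤ ∫⁻ x in K, ‖besselPow s f x‖ₑ := by
  have hc := subordinationConst_pos hs hs1
  have hQ := integrable_rpow_mul_norm_sub_norm hs hs1 f hK
  have key : subordinationConst s * ∫ x, ‖f x‖ ≤
      subordinationConst s * ∫ x in K, ‖besselPow s f x‖ := by
    calc subordinationConst s * ∫ x, ‖f x‖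
        = ∫ t in Set.Ioi (0 : ℝ), t ^ (-s - 1) * (1 - Real.exp (-t)) * ∫ x, ‖f x‖ :=
          (integral_mul_const _ _).symm
      _ ≤ ∫ t in Set.Ioi (0 : ℝ), ∫ x in K, t ^ (-s - 1) * (‖f x‖ - ‖(heatKernel t ⋆ f) x‖) :=
          setIntegral_mono_on ((integrableOn_rpow_mul_one_sub_exp hs hs1).mul_const _)
            hQ.integral_prod_left measurableSet_Ioi
            fun t ht => le_setIntegral_rpow_mul_norm_sub_norm ht hfK
      _ = ∫ x in K, ∫ t in Set.Ioi (0 : ℝ), t ^ (-s - 1) * (‖f x‖ - ‖(heatKernel t ⋆ f) x‖) :=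
          integral_integral_swap hQ
      _ ≤ ∫ x in K, subordinationConst s * ‖besselPow s f x‖ :=
          integral_mono hQ.integral_prod_right
            ((besselPow s f).integrable.norm.integrableOn.const_mul _)
            fun x => integral_rpow_mul_norm_sub_norm_le hs hs1 f x
      _ = subordinationConst s * ∫ x in K, ‖besselPow s f x‖ := integral_const_mul _ _
  rw [← ofReal_integral_norm_eq_lintegral_enorm f.integrable,
    ← ofReal_integral_norm_eq_lintegral_enorm (besselPow s f).integrable.integrableOn]
  exact ENNReal.ofReal_le_ofReal (le_of_mul_le_mul_left key hc)

end KatoInequality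

/-! ### Compactness from bounds on Bessel potentials -/

section LipschitzApproximation

open scoped SchwartzMap

variable {N : ℕ} {E : Type*} [NormedAddCommGroup E] {s δ : ℝ}

theorem norm_setIntegral_rpow_smul_le [NormedSpace ℝ E] (hs : 0 < s) (hδ : 0 ≤ δ) {M : ℝ}
    (hM : 0 ≤ M) {w : ℝ → E} (hw : ∀ t, δ < t → ‖w t‖ ≤ Real.exp (-t) * M) :
    ‖∫ t in Set.Ioi δ, t ^ (s - 1) • w t‖ ≤ Real.Gamma s * M := by
  have hΓ : IntegrableOn (fun t => Real.exp (-t) * t ^ (s - 1) * M) (Set.Ioi 0) :=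
    (Real.GammaIntegral_convergent hs).mul_const M
  have hsub : Set.Ioi δ ⊆ Set.Ioi 0 := Set.Ioi_subset_Ioi hδ
  have hpow {t : ℝ} (ht : t ∈ Set.Ioi 0) : 0 ≤ t ^ (s - 1) := Real.rpow_nonneg (le_of_lt ht) _
  calc ‖∫ t in Set.Ioi δ, t ^ (s - 1) • w t‖
      ≤ ∫ t in Set.Ioi δ, Real.exp (-t) * t ^ (s - 1) * M := by
        refine norm_integral_le_of_norm_le (hΓ.mono_set hsub) ?_
        filter_upwards [self_mem_ae_restrict measurableSet_Ioi] with t ht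
        rw [norm_smul, Real.norm_of_nonneg (hpow (hsub ht)), mul_right_comm, mul_comm]
        exact mul_le_mul_of_nonneg_right (hw t ht) (hpow (hsub ht))
    _ ≤ ∫ t in Set.Ioi (0 : ℝ), Real.exp (-t) * t ^ (s - 1) * M := by
        refine setIntegral_mono_set hΓ ?_ hsub.eventuallyLE
        filter_upwards [self_mem_ae_restrict measurableSet_Ioi] with t ht
        exact mul_nonneg (mul_nonneg (Real.exp_pos _).le (hpow ht)) hM
    _ = Real.Gamma s * M := by rw [integral_mul_const, ← Real.Gamma_eq_integral hs]

theorem setLIntegral_Ioc_rpow (hs : 0 < s) (hδ : 0 ≤ δ) :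
    ∫⁻ t in Set.Ioc 0 δ, ENNReal.ofReal (t ^ (s - 1)) = ENNReal.ofReal (δ ^ s / s) := by
  have hi : IntegrableOn (fun t : ℝ => t ^ (s - 1)) (Set.Ioc 0 δ) :=
    (intervalIntegrable_iff_integrableOn_Ioc_of_le hδ).1
      (intervalIntegral.intervalIntegrable_rpow' (by linarith))
  rw [← ofReal_integral_eq_lintegral_ofReal hi
    (by filter_upwards [self_mem_ae_restrict measurableSet_Ioc] with t ht
        exact Real.rpow_nonneg ht.1.le _),
    ← intervalIntegral.integral_of_le hδ, integral_rpow (Or.inl (by linarith)), sub_add_cancel,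
    Real.zero_rpow hs.ne', sub_zero]

variable [NormedSpace ℂ E]

/-- The part `t > δ` of the integral `Γ(s)⁻¹ ∫ t ^ (s - 1) e ^ (-t (1 - Δ)) f dt` representing
`(1 - Δ) ^ (-s) f`; it is a Lipschitz function for integrable `f`. -/
def besselTail (s δ : ℝ) (f : (𝔼 N) → E) (x : 𝔼 N) : E :=
  (Real.Gamma s)⁻¹ • ∫ t in Set.Ioi δ, t ^ (s - 1) • (heatKernel t ⋆ f) x

theorem norm_besselTail_le (hs : 0 < s) (hδ : 0 < δ) {f : (𝔼 N) → E} (hf : Integrable f)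
    (x : 𝔼 N) : ‖besselTail s δ f x‖ ≤ ((4 * Real.pi * δ)⁻¹) ^ ((N : ℝ) / 2) * ∫ y, ‖f y‖ := by
  have hΓ := Real.Gamma_pos_of_pos hs
  rw [besselTail, norm_smul, Real.norm_of_nonneg (inv_pos.2 hΓ).le, inv_mul_le_iff₀ hΓ]
  exact norm_setIntegral_rpow_smul_le hs hδ.le (by positivity)
    fun t ht => norm_heatKernel_convolution_le hδ ht.le hf x

variable [CompleteSpace E]

theorem norm_besselTail_sub_le (hs : 0 < s) (hδ : 0 < δ) (f : 𝓢(𝔼 N, E)) (x x' : 𝔼 N) :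
    ‖besselTail s δ f x - besselTail s δ f x'‖ ≤
      ((4 * Real.pi * δ)⁻¹) ^ ((N : ℝ) / 2) / √δ * (∫ y, ‖f y‖) * ‖x - x'‖ := by
  have hΓ := Real.Gamma_pos_of_pos hs
  have hint (x : 𝔼 N) := (integrableOn_rpow_smul_heatKernel_convolution hs f x).mono_set
    (Set.Ioi_subset_Ioi hδ.le)
  rw [besselTail, besselTail, ← smul_sub, ← integral_sub (hint x) (hint x'), norm_smul,
    Real.norm_of_nonneg (inv_pos.2 hΓ).le, inv_mul_le_iff₀ hΓ]
  simp only [← smul_sub]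
  exact norm_setIntegral_rpow_smul_le hs hδ.le (by positivity)
    fun t ht => norm_heatKernel_convolution_sub_le hδ ht.le f.integrable x x'

theorem besselPow_neg_sub_besselTail (hs : 0 < s) (hδ : 0 ≤ δ) (f : 𝓢(𝔼 N, E)) (x : 𝔼 N) :
    besselPow (-s) f x - besselTail s δ f x =
      (Real.Gamma s)⁻¹ • ∫ t in Set.Ioc 0 δ, t ^ (s - 1) • (heatKernel t ⋆ f) x := by
  have hint := integrableOn_rpow_smul_heatKernel_convolution hs f x
  rw [besselTail, ← inv_smul_smul₀ (Real.Gamma_pos_of_pos hs).ne' (besselPow (-s) f x),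
    ← integral_rpow_smul_heatKernel_convolution hs, ← smul_sub, ← Set.Ioc_union_Ioi_eq_Ioi hδ,
    setIntegral_union Set.Ioc_disjoint_Ioi_same measurableSet_Ioi
      (hint.mono_set Set.Ioc_subset_Ioi_self) (hint.mono_set (Set.Ioi_subset_Ioi hδ)),
    add_sub_cancel_right]

theorem lintegral_enorm_besselPow_neg_sub_besselTail_le (hs : 0 < s) (hδ : 0 ≤ δ)
    (f : 𝓢(𝔼 N, E)) :
    ∫⁻ x, ‖besselPow (-s) f x - besselTail s δ f x‖ₑ ≤
      ENNReal.ofReal ((Real.Gamma s)⁻¹ * (δ ^ s / s)) * ∫⁻ x, ‖f x‖ₑ := by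
  have hΓ : 0 ≤ (Real.Gamma s)⁻¹ := (inv_pos.2 (Real.Gamma_pos_of_pos hs)).le
  simp only [besselPow_neg_sub_besselTail hs hδ, enorm_smul, Real.enorm_of_nonneg hΓ]
  rw [lintegral_const_mul' _ _ ENNReal.ofReal_ne_top, ENNReal.ofReal_mul hΓ, mul_assoc]
  gcongr
  calc ∫⁻ x, ‖∫ t in Set.Ioc 0 δ, t ^ (s - 1) • (heatKernel t ⋆ f) x‖ₑ
      ≤ ∫⁻ x, ∫⁻ t in Set.Ioc 0 δ, ENNReal.ofReal (t ^ (s - 1)) * ‖(heatKernel t ⋆ f) x‖ₑ := by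
        refine lintegral_mono fun x => (enorm_integral_le_lintegral_enorm _).trans_eq
          (setLIntegral_congr_fun measurableSet_Ioc fun t ht => ?_)
        rw [enorm_smul, Real.enorm_of_nonneg (Real.rpow_nonneg ht.1.le _)]
    _ ≤ (∫⁻ t in Set.Ioc 0 δ, ENNReal.ofReal (t ^ (s - 1)) * ∫⁻ z : 𝔼 N, ‖heatKernel t z‖ₑ) *
          ∫⁻ x, ‖f x‖ₑ :=
        lintegral_lintegral_mul_enorm_convolution_le (by fun_prop) measurable_uncurry_heatKernel
          f.continuous
    _ ≤ ENNReal.ofReal (δ ^ s / s) * ∫⁻ x, ‖f x‖ₑ := by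
        rw [← setLIntegral_Ioc_rpow hs hδ]
        gcongr ?_ * _
        refine setLIntegral_mono' (measurableSet_Ioc (a := (0 : ℝ))) fun t ht => ?_
        rw [lintegral_enorm_heatKernel ht.1]
        exact mul_le_of_le_one_right' (ENNReal.ofReal_le_one.2
          (Real.exp_le_one_iff.2 (neg_nonpos.2 ht.1.le)))

end LipschitzApproximation

section FiniteNets

variable {X E ι : Type*} [MetricSpace X] [NormedAddCommGroup E] {K : Set X}

theorem exists_finite_net_of_lipschitzWith [ProperSpace E] (hK : IsCompact K) {h : ι → X → E}
    {L : ℝ≥0} (hL : ∀ i, LipschitzWith L (h i)) {M : ℝ} (hM : ∀ i x, ‖h i x‖ ≤ M) {ε : ℝ≥0}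
    (hε : 0 < ε) :
    ∃ t : Set ι, t.Finite ∧ ∀ i, ∃ j ∈ t, ∀ x ∈ K, ‖h i x - h j x‖ₑ ≤ ε := by
  have : CompactSpace K := isCompact_iff_compactSpace.1 hK
  let H (i : ι) : BoundedContinuousFunction K E := BoundedContinuousFunction.mkOfCompact
    ⟨fun x => h i x, (hL i).continuous.comp continuous_subtype_val⟩
  have hH : IsCompact (closure (Set.range H)) := by
    refine BoundedContinuousFunction.arzela_ascoli (Metric.closedBall 0 M)
      (isCompact_closedBall 0 M) _ ?_ ?_
    · rintro _ x ⟨i, rfl⟩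
      exact mem_closedBall_zero_iff.2 (hM i x)
    · refine (LipschitzWith.uniformEquicontinuous _ L ?_).equicontinuous
      rintro ⟨_, i, rfl⟩
      exact ((hL i).comp (LipschitzWith.subtype_val K)).weaken (mul_one L).le
  obtain ⟨t, htH, htf, ht⟩ := totallyBounded_iff_subset.1
    (hH.totallyBounded.subset subset_closure) _ (Metric.dist_mem_uniformity (NNReal.coe_pos.2 hε))
  choose j hj using htH
  have := htf.to_subtype
  refine ⟨Set.range fun b : t => j b.2, Set.finite_range _, fun i => ?_⟩
  obtain ⟨b, hbt, hib⟩ := Set.mem_iUnion₂.1 (ht (Set.mem_range_self i))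
  refine ⟨j hbt, ⟨⟨b, hbt⟩, rfl⟩, fun x hx => ?_⟩
  have hdist : dist (H i) (H (j hbt)) ≤ ε := by rw [hj hbt]; exact le_of_lt hib
  rw [← edist_eq_enorm_sub, edist_nndist, ENNReal.coe_le_coe, ← NNReal.coe_le_coe, coe_nndist]
  exact (BoundedContinuousFunction.dist_coe_le_dist (⟨x, hx⟩ : K)).trans hdist

theorem exists_finite_net_of_lipschitzWith_approx [ProperSpace E] [MeasurableSpace X]
    [OpensMeasurableSpace X] {μ : Measure X} (hK : IsCompact K) (hμK : μ K ≠ ⊤) {f : ι → X → E}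
    (hf : ∀ i, AEStronglyMeasurable (f i) (μ.restrict K))
    (happ : ∀ η : ℝ≥0∞, η ≠ 0 → ∃ (L : ℝ≥0) (M : ℝ), ∀ i, ∃ h : X → E, LipschitzWith L h ∧
      (∀ x, ‖h x‖ ≤ M) ∧ ∫⁻ x in K, ‖f i x - h x‖ₑ ∂μ ≤ η) {η : ℝ≥0∞} (hη : η ≠ 0) :
    ∃ t : Set ι, t.Finite ∧ ∀ i, ∃ j ∈ t, ∫⁻ x in K, ‖f i x - f j x‖ₑ ∂μ ≤ η := by
  have hη3 : η / 3 ≠ 0 := (ENNReal.div_pos hη (by norm_num)).ne'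
  obtain ⟨L, M, hLM⟩ := happ (η / 3) hη3
  choose h hL hM hfh using hLM
  obtain ⟨ε, hε, hεη⟩ := ENNReal.exists_nnreal_pos_mul_lt hμK hη3
  obtain ⟨t, ht, hnet⟩ := exists_finite_net_of_lipschitzWith hK hL hM hε
  refine ⟨t, ht, fun i => (hnet i).imp fun j ⟨hj, hij⟩ => ⟨hj, ?_⟩⟩
  have hh (i : ι) : AEStronglyMeasurable (h i) (μ.restrict K) :=
    (hL i).continuous.aestronglyMeasurable
  simp only [← edist_eq_enorm_sub] at hfh hij ⊢
  calc ∫⁻ x in K, edist (f i x) (f j x) ∂μ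
      ≤ ∫⁻ x in K, edist (f i x) (h i x) ∂μ + ∫⁻ x in K, edist (f j x) (h i x) ∂μ :=
        lintegral_edist_triangle (hf i) (hh i)
    _ ≤ η / 3 + (∫⁻ x in K, edist (f j x) (h j x) ∂μ + ∫⁻ x in K, edist (h i x) (h j x) ∂μ) :=
        add_le_add (hfh i) (lintegral_edist_triangle (hf j) (hh j))
    _ ≤ η / 3 + (η / 3 + η / 3) := by
        gcongr
        · exact hfh j
        · exact (setLIntegral_mono' hK.measurableSet hij).trans
            ((setLIntegral_const K _).trans_le hεη.le)
    _ = η := by rw [← add_assoc, ENNReal.add_thirds]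

end FiniteNets

section BesselNets

open scoped SchwartzMap

variable {N : ℕ} {E : Type*} [NormedAddCommGroup E] [NormedSpace ℂ E] {s : ℝ} {K U : Set (𝔼 N)}

theorem exists_lintegral_enorm_besselPow_le [CompleteSpace E] (hs : 0 < s) (hs1 : s < 1)
    (hU : IsOpen U) (hK : IsCompact K) (hKU : K ⊆ U) :
    ∃ C : ℝ≥0, ∀ f : 𝓢(𝔼 N, E), tsupport f ⊆ K →
      ∫⁻ x, ‖besselPow s f x‖ₑ ≤ C * ∫⁻ x in U, ‖besselPow s f x‖ₑ := by
  obtain ⟨d, hd, hdU⟩ := hK.exists_thickening_subset_open hU hKU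
  obtain ⟨C, hC⟩ := exists_setLIntegral_enorm_besselPow_le (N := N) (E := E) hs hs1 hd
  refine ⟨1 + C, fun f hfK => ?_⟩
  have hfar (x : 𝔼 N) (hx : x ∈ Uᶜ) (y : 𝔼 N) (hy : y ∈ tsupport f) : d ≤ ‖x - y‖ := by
    by_contra! hlt
    exact hx (hdU (Metric.mem_thickening_iff.2 ⟨y, hfK hy, by rwa [dist_eq_norm]⟩))
  have hnear : ∫⁻ x, ‖f x‖ₑ ≤ ∫⁻ x in U, ‖besselPow s f x‖ₑ :=
    (lintegral_enorm_le_setLIntegral_enorm_besselPow hs hs1 hK.measure_lt_top.ne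
      ((subset_tsupport f).trans hfK)).trans (lintegral_mono_set hKU)
  calc ∫⁻ x, ‖besselPow s f x‖ₑ
      = (∫⁻ x in U, ‖besselPow s f x‖ₑ) + ∫⁻ x in Uᶜ, ‖besselPow s f x‖ₑ :=
        (lintegral_add_compl _ hU.measurableSet).symm
    _ ≤ (∫⁻ x in U, ‖besselPow s f x‖ₑ) + C * ∫⁻ x in U, ‖besselPow s f x‖ₑ := by
        gcongr
        exact (hC f hU.measurableSet.compl hfar).trans (by gcongr)
    _ = ↑(1 + C) * ∫⁻ x in U, ‖besselPow s f x‖ₑ := by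
        rw [ENNReal.coe_add, ENNReal.coe_one, add_mul, one_mul]

theorem exists_ofReal_mul_rpow_div_mul_le (hs : 0 < s) (c : ℝ) {B η : ℝ≥0∞} (hB : B ≠ ⊤)
    (hη : η ≠ 0) : ∃ δ > 0, ENNReal.ofReal (c * (δ ^ s / s)) * B ≤ η := by
  have hpow : Tendsto (fun δ : ℝ => δ ^ s) (𝓝[>] 0) (𝓝 0) := by
    simpa only [Real.zero_rpow hs.ne'] using
      (Real.continuousAt_rpow_const 0 s (Or.inr hs.le)).tendsto.mono_left nhdsWithin_le_nhds
  have hlim : Tendsto (fun δ : ℝ => ENNReal.ofReal (c * (δ ^ s / s)) * B) (𝓝[>] 0) (𝓝 0) := by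
    simpa only [zero_div, mul_zero, ENNReal.ofReal_zero, zero_mul] using ENNReal.Tendsto.mul_const
      (ENNReal.tendsto_ofReal ((hpow.div_const s).const_mul c)) (Or.inr hB)
  exact (((hlim.eventually_le_const (pos_iff_ne_zero.2 hη)).and self_mem_nhdsWithin).exists).imp
    fun δ h => h.symm

theorem exists_finite_net_of_besselPow_le [FiniteDimensional ℂ E] {ι : Type*} (hs : 0 < s)
    (hs1 : s < 1) (hU : IsOpen U) (hK : IsCompact K) (hKU : K ⊆ U) {f : ι → 𝓢(𝔼 N, E)}
    (hfK : ∀ i, tsupport (f i) ⊆ K) {B : ℝ≥0∞} (hB : B ≠ ⊤)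
    (hfB : ∀ i, ∫⁻ x in U, ‖besselPow s (f i) x‖ₑ ≤ B) {η : ℝ≥0∞} (hη : η ≠ 0) :
    ∃ t : Set ι, t.Finite ∧ ∀ i, ∃ j ∈ t, ∫⁻ x, ‖f i x - f j x‖ₑ ≤ η := by
  have : CompleteSpace E := FiniteDimensional.complete ℂ E
  have : ProperSpace E := FiniteDimensional.proper ℂ E
  obtain ⟨C, hC⟩ := exists_lintegral_enorm_besselPow_le (E := E) hs hs1 hU hK hKU
  have hCB : C * B ≠ ⊤ := ENNReal.mul_ne_top ENNReal.coe_ne_top hB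
  have hbound (i : ι) : ∫⁻ x, ‖besselPow s (f i) x‖ₑ ≤ C * B :=
    (hC (f i) (hfK i)).trans (by gcongr; exact hfB i)
  have hnorm (i : ι) : ∫ x, ‖besselPow s (f i) x‖ ≤ (C * B).toReal := by
    rw [integral_norm_eq_lintegral_enorm (besselPow s (f i)).integrable.aestronglyMeasurable]
    exact ENNReal.toReal_mono hCB (hbound i)
  have hsupp (i j : ι) : ∫⁻ x in K, ‖f i x - f j x‖ₑ = ∫⁻ x, ‖f i x - f j x‖ₑ := by
    refine setLIntegral_eq_of_support_subset fun x hx => ?_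
    by_contra hxK
    have hzero (i : ι) : f i x = 0 := image_eq_zero_of_notMem_tsupport fun h => hxK (hfK i h)
    simp [hzero] at hx
  simp only [← hsupp]
  refine exists_finite_net_of_lipschitzWith_approx hK hK.measure_lt_top.ne
    (fun i => (f i).continuous.aestronglyMeasurable) (fun η hη => ?_) hη
  obtain ⟨δ, hδ, hδη⟩ := exists_ofReal_mul_rpow_div_mul_le hs (Real.Gamma s)⁻¹ hCB hη
  refine ⟨(((4 * Real.pi * δ)⁻¹) ^ ((N : ℝ) / 2) / √δ * (C * B).toReal).toNNReal, _,
    fun i => ⟨besselTail s δ (besselPow s (f i)), .of_dist_le_mul fun x x' => ?_, fun x =>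
      (norm_besselTail_le hs hδ (besselPow s (f i)).integrable x).trans
        (mul_le_mul_of_nonneg_left (hnorm i) (by positivity)), ?_⟩⟩
  · rw [Real.coe_toNNReal _ (by positivity), dist_eq_norm, dist_eq_norm]
    exact (norm_besselTail_sub_le hs hδ _ x x').trans (by gcongr; exact hnorm i)
  · have h := lintegral_enorm_besselPow_neg_sub_besselTail_le hs hδ.le (besselPow s (f i))
    rw [besselPow_neg_besselPow] at h
    exact (setLIntegral_le_lintegral _ _).trans (h.trans (le_trans (by gcongr; exact hbound i) hδη))

end BesselNets

/-! ### Sequences converging in the mean -/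

section MeanConvergence

variable {X G : Type*} [MeasurableSpace X] {μ : Measure X} [NormedAddCommGroup G]

theorem exists_subseq_tendsto_of_finite_nets [CompleteSpace G] {ι : Type*} (S : Finset ι)
    {f : ι → ℕ → X → G} (hf : ∀ a ∈ S, ∀ i, Integrable (f a i) μ)
    (hnet : ∀ a ∈ S, ∀ η : ℝ≥0∞, η ≠ 0 → ∃ t : Set ℕ, t.Finite ∧
      ∀ i, ∃ j ∈ t, ∫⁻ x, ‖f a i x - f a j x‖ₑ ∂μ ≤ η) :
    ∃ s : ℕ → ℕ, StrictMono s ∧ ∃ h : ι → X → G, ∀ a ∈ S, Integrable (h a) μ ∧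
      Tendsto (fun k => ∫⁻ x, ‖f a (s k) x - h a x‖ₑ ∂μ) atTop (𝓝 0) := by
  simp only [← edist_eq_enorm_sub] at hnet ⊢
  let T (i : ℕ) (a : S) : Lp G 1 μ := (hf a a.2 i).toL1 (f a i)
  have hT (a : S) : IsCompact (closure (Set.range fun i => T i a)) := by
    refine TotallyBounded.isCompact_of_isClosed (.closure ?_) isClosed_closure
    refine EMetric.totallyBounded_iff'.2 fun ε hε => ?_
    obtain ⟨δ, hδ, hδε⟩ := exists_between hε
    obtain ⟨t, htf, ht⟩ := hnet a a.2 δ hδ.ne'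
    refine ⟨(fun i => T i a) '' t, Set.image_subset_range _ t, htf.image _, ?_⟩
    rintro _ ⟨i, rfl⟩
    obtain ⟨j, hj, hij⟩ := ht i
    refine Set.mem_iUnion₂.2 ⟨_, Set.mem_image_of_mem _ hj, ?_⟩
    rw [Metric.mem_eball, Integrable.edist_toL1_toL1]
    exact hij.trans_lt hδε
  obtain ⟨H, -, s, hs, hH⟩ := (isCompact_univ_pi hT).tendsto_subseq
    (x := T) fun i a _ => subset_closure (Set.mem_range_self i)
  have hlim (a : S) : Integrable (H a) μ ∧
      Tendsto (fun k => ∫⁻ x, edist (f a (s k) x) (H a x) ∂μ) atTop (𝓝 0) := by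
    have hHa := L1.integrable_coeFn (H a)
    refine ⟨hHa, (tendsto_iff_edist_tendsto_0.1 (tendsto_pi_nhds.1 hH a)).congr fun k => ?_⟩
    rw [← Integrable.edist_toL1_toL1 _ _ (hf a a.2 (s k)) hHa, Integrable.toL1_coeFn]
    rfl
  choose! h hh using fun (a : ι) (ha : a ∈ S) =>
    (⟨_, hlim ⟨a, ha⟩⟩ : ∃ h : X → G, Integrable h μ ∧
      Tendsto (fun k => ∫⁻ x, edist (f a (s k) x) (h x) ∂μ) atTop (𝓝 0))
  exact ⟨s, hs, h, hh⟩

theorem tendsto_lintegral_enorm_sub_of_tendsto {ι : Type*} {l : Filter ι} {f g : ι → X → G}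
    {h : X → G} (hf : ∀ i, AEStronglyMeasurable (f i) μ) (hg : ∀ i, AEStronglyMeasurable (g i) μ)
    (hfg : Tendsto (fun i => ∫⁻ x, ‖f i x - g i x‖ₑ ∂μ) l (𝓝 0))
    (hfh : Tendsto (fun i => ∫⁻ x, ‖f i x - h x‖ₑ ∂μ) l (𝓝 0)) :
    Tendsto (fun i => ∫⁻ x, ‖g i x - h x‖ₑ ∂μ) l (𝓝 0) := by
  refine tendsto_of_tendsto_of_tendsto_of_le_of_le tendsto_const_nhds
    (by simpa only [add_zero] using hfg.add hfh) (fun _ => zero_le) fun i => ?_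
  simp only [← edist_eq_enorm_sub]
  calc ∫⁻ x, edist (g i x) (h x) ∂μ
      ≤ ∫⁻ x, edist (g i x) (f i x) ∂μ + ∫⁻ x, edist (h x) (f i x) ∂μ :=
        lintegral_edist_triangle (hg i) (hf i)
    _ = ∫⁻ x, edist (f i x) (g i x) ∂μ + ∫⁻ x, edist (f i x) (h x) ∂μ := by
        simp only [edist_comm (f i _)]

theorem tendsto_setLIntegral_of_tendsto {ι : Type*} {l : Filter ι} {f : ι → X → G} {g : X → G}
    (S : Set X) (h : Tendsto (fun i => ∫⁻ x, ‖f i x - g x‖ₑ ∂μ) l (𝓝 0)) :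
    Tendsto (fun i => ∫⁻ x in S, ‖f i x - g x‖ₑ ∂μ) l (𝓝 0) :=
  tendsto_of_tendsto_of_tendsto_of_le_of_le tendsto_const_nhds h (fun _ => zero_le)
    fun _ => setLIntegral_le_lintegral _ _

theorem ae_eq_zero_of_tendsto {ι : Type*} {l : Filter ι} [l.NeBot] {K : Set X}
    (hK : MeasurableSet K) {f : ι → X → G} {g : X → G} (hg : AEStronglyMeasurable g μ)
    (hfK : ∀ i, ∀ᵐ x ∂μ, x ∉ K → f i x = 0)
    (h : Tendsto (fun i => ∫⁻ x, ‖f i x - g x‖ₑ ∂μ) l (𝓝 0)) : ∀ᵐ x ∂μ, x ∉ K → g x = 0 := by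
  have hzero : ∫⁻ x in Kᶜ, ‖g x‖ₑ ∂μ = 0 := by
    refine tendsto_nhds_unique (tendsto_const_nhds.congr fun i => ?_)
      (tendsto_setLIntegral_of_tendsto Kᶜ h)
    refine setLIntegral_congr_fun_ae hK.compl ?_
    filter_upwards [hfK i] with x hfx hx
    rw [hfx hx, zero_sub, enorm_neg]
  rw [lintegral_eq_zero_iff' hg.enorm.restrict, Filter.EventuallyEq,
    ae_restrict_iff' hK.compl] at hzero
  filter_upwards [hzero] with x hx hxK
  exact enorm_eq_zero.1 (hx hxK)

end MeanConvergence

section WeakDerivatives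

variable {N k ν : ℕ} {Ω U : Opens (𝔼 N)} {E F : Type*} [NormedAddCommGroup E] [NormedSpace ℂ E]
  [NormedAddCommGroup F] [NormedSpace ℂ F] {α : Fin N → ℕ} {g h : (𝔼 N) → E}

theorem integrableOn_smul_of_locallyIntegrableOn {φ : (𝔼 N) → ℂ} (hφ : Continuous φ)
    (hφc : HasCompactSupport φ) (hφU : tsupport φ ⊆ U) (hg : LocallyIntegrableOn g U) :
    IntegrableOn (fun x => φ x • g x) U := by
  obtain ⟨M, hM⟩ := hφ.bounded_above_of_compact_support hφc
  have hsupp : Function.support (fun x => φ x • g x) ⊆ tsupport φ :=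
    (Function.support_smul_subset_left φ g).trans (subset_tsupport φ)
  exact ((integrableOn_iff_integrable_of_support_subset hsupp).1 (integrable_bilin_of_norm_le
    (ContinuousLinearMap.lsmul ℝ ℂ : ℂ →L[ℝ] E →L[ℝ] E) hφ hM
    (hg.integrableOn_compact_subset hφU hφc))).integrableOn

theorem IsWeakDeriv.sub {g' h' : (𝔼 N) → E} (hg : IsWeakDeriv U α g h)
    (hg' : IsWeakDeriv U α g' h') :
    IsWeakDeriv U α (fun x => g x - g' x) (fun x => h x - h' x) := by
  refine ⟨hg.1.sub hg'.1, hg.2.1.sub hg'.2.1, fun φ => ?_⟩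
  have hφ {w : (𝔼 N) → E} (hw : LocallyIntegrableOn w U) :
      IntegrableOn (fun x => φ x • w x) U :=
    integrableOn_smul_of_locallyIntegrableOn φ.continuous φ.hasCompactSupport φ.tsupport_subset hw
  have hφ' {w : (𝔼 N) → E} (hw : LocallyIntegrableOn w U) :
      IntegrableOn (fun x => multiDeriv α φ x • w x) U :=
    integrableOn_smul_of_locallyIntegrableOn (contDiff_multiDeriv φ.contDiff α).continuous
      (hasCompactSupport_multiDeriv φ.hasCompactSupport α)
      ((tsupport_multiDeriv_subset _ α).trans φ.tsupport_subset) hw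
  simp only [smul_sub]
  rw [integral_sub (hφ' hg.1) (hφ' hg'.1), integral_sub (hφ hg.2.1) (hφ hg'.2.1), hg.2.2,
    hg'.2.2, smul_sub]

theorem isWeakDeriv_multiDeriv [CompleteSpace E] {u : (𝔼 N) → E} (hu : ContDiff ℝ ∞ u)
    (huc : HasCompactSupport u) : IsWeakDeriv U α u (multiDeriv α u) := by
  refine ⟨hu.continuous.locallyIntegrable.locallyIntegrableOn _,
    (contDiff_multiDeriv hu α).continuous.locallyIntegrable.locallyIntegrableOn _, fun φ => ?_⟩
  have hzero {φ' : (𝔼 N) → ℂ} (hφ' : tsupport φ' ⊆ U) (w : (𝔼 N) → E) :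
      ∫ x in (U : Set (𝔼 N)), φ' x • w x = ∫ x, φ' x • w x :=
    setIntegral_eq_integral_of_forall_compl_eq_zero fun x hx => by
      rw [image_eq_zero_of_notMem_tsupport fun h => hx (hφ' h), zero_smul]
  have hparts := integral_bilin_multiDeriv (ContinuousLinearMap.lsmul ℝ ℂ : ℂ →L[ℝ] E →L[ℝ] E)
    φ.contDiff hu huc α
  simp only [ContinuousLinearMap.lsmul_apply] at hparts
  rw [hzero ((tsupport_multiDeriv_subset _ α).trans φ.tsupport_subset), hzero φ.tsupport_subset,
    hparts, ← Complex.coe_smul, smul_smul, Complex.ofReal_pow, Complex.ofReal_neg,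
    Complex.ofReal_one, ← mul_pow, neg_one_mul, neg_neg, one_pow, one_smul]

theorem IsWeakDeriv.of_tendsto {ι : Type*} {l : Filter ι} [l.NeBot] {u w : ι → (𝔼 N) → E}
    (huw : ∀ i, IsWeakDeriv U α (u i) (w i)) (hu : ∀ i, IntegrableOn (u i) U)
    (hw : ∀ i, IntegrableOn (w i) U) (hg : IntegrableOn g U) (hh : IntegrableOn h U)
    (hug : Tendsto (fun i => ∫⁻ x in U, ‖u i x - g x‖ₑ) l (𝓝 0))
    (hwh : Tendsto (fun i => ∫⁻ x in U, ‖w i x - h x‖ₑ) l (𝓝 0)) : IsWeakDeriv U α g h := by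
  refine ⟨hg.locallyIntegrableOn, hh.locallyIntegrableOn, fun φ => ?_⟩
  let B : ℂ →L[ℝ] E →L[ℝ] E := ContinuousLinearMap.lsmul ℝ ℂ
  have hleft := tendsto_integral_bilin B (contDiff_multiDeriv φ.contDiff α).continuous
    (hasCompactSupport_multiDeriv φ.hasCompactSupport α) (.of_forall hu) hg hug
  have hright := (tendsto_integral_bilin B φ.continuous φ.hasCompactSupport (.of_forall hw) hh
    hwh).const_smul ((-1 : ℂ) ^ (∑ i, α i))
  exact tendsto_nhds_unique hleft (hright.congr fun i => ((huw i).2.2 φ).symm)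

theorem sobolevSeminorm_one_sub_le {g' : (𝔼 N) → E} {h h' : (Fin N → ℕ) → (𝔼 N) → E}
    (hg : ∀ α ∈ multiIndices N k, IsWeakDeriv U α g (h α))
    (hg' : ∀ α ∈ multiIndices N k, IsWeakDeriv U α g' (h' α)) :
    sobolevSeminorm k 1 U (fun x => g x - g' x) ≤
      ∑ α ∈ multiIndices N k, ∫⁻ x in U, ‖h α x - h' α x‖ₑ := by
  refine Finset.sum_le_sum fun α hα => (iInf₂_le _ ((hg α hα).sub (hg' α hα))).trans_eq ?_
  exact eLpNorm_one_eq_lintegral_enorm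

theorem tendsto_sobolevSeminorm_one_sub {ι : Type*} {l : Filter ι} {f : ι → (𝔼 N) → E}
    {w : ι → (Fin N → ℕ) → (𝔼 N) → E} {h : (Fin N → ℕ) → (𝔼 N) → E}
    (hf : ∀ i, ∀ α ∈ multiIndices N k, IsWeakDeriv U α (f i) (w i α))
    (hg : ∀ α ∈ multiIndices N k, IsWeakDeriv U α g (h α))
    (hwh : ∀ α ∈ multiIndices N k, Tendsto (fun i => ∫⁻ x in U, ‖w i α x - h α x‖ₑ) l (𝓝 0)) :
    Tendsto (fun i => sobolevSeminorm k 1 U (fun x => f i x - g x)) l (𝓝 0) :=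
  tendsto_of_tendsto_of_tendsto_of_le_of_le tendsto_const_nhds
    (by simpa only [Finset.sum_const_zero] using tendsto_finsetSum _ hwh) (fun _ => zero_le)
    fun i => sobolevSeminorm_one_sub_le (hf i) hg

theorem DiffOp.variation_le_of_tendsto (A : DiffOp Ω ν E F) (hU : U ≤ Ω) {ι : Type*}
    {l : Filter ι} [l.NeBot] {f : ι → (𝔼 N) → E} (hf : ∀ i, IntegrableOn (f i) U)
    (hg : IntegrableOn g U) (hfg : Tendsto (fun i => ∫⁻ x in U, ‖f i x - g x‖ₑ) l (𝓝 0))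
    {M : ℝ≥0∞} (hM : ∀ i, A.variation U (f i) ≤ M) : A.variation U g ≤ M := by
  refine iSup₂_le fun v hv => ?_
  have hlim := (tendsto_integral_bilin (conjPairing E)
    (A.contDiff_adjoint v.contDiff (v.tsupport_subset.trans hU)).continuous
    (v.hasCompactSupport.of_isClosed_subset (isClosed_tsupport _) (A.tsupport_adjoint_subset v))
    (.of_forall hf) hg hfg).enorm
  exact le_of_tendsto hlim (.of_forall fun i => (A.enorm_integral_conjPairing_adjoint_le (f i)
    v.contDiff v.hasCompactSupport v.tsupport_subset hv).trans (hM i))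

end WeakDerivatives

/-! ### Compactness for operators with a fractional estimate -/

section Rellich

open scoped SchwartzMap

variable {N k ν : ℕ} {Ω U : Opens (𝔼 N)} {E F : Type*} [NormedAddCommGroup E] [NormedSpace ℂ E]
  [NormedAddCommGroup F] [NormedSpace ℂ F] {K : Set (𝔼 N)} {ι : Type*} {u : ι → (𝔼 N) → E}

theorem DiffOp.SupportsFractional.exists_setLIntegral_besselPow_le {A : DiffOp Ω ν E F} {β : ℝ}
    (hA : A.SupportsFractional U β) :
    ∃ C : ℝ≥0, ∀ u : TestFunction U E ⊤, ∀ α ∈ multiIndices N (ν - 1), ∀ f : 𝓢(𝔼 N, E),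
      ⇑f = multiDeriv α u → ∫⁻ x in (U : Set (𝔼 N)), ‖besselPow ((1 - β) / 2) f x‖ₑ ≤
        C * ∫⁻ x, ‖A.apply u x‖ₑ := by
  obtain ⟨ψ, -, hψ, C, hC⟩ := hA
  simp only [eLpNorm_one_eq_lintegral_enorm] at hC
  refine ⟨C, fun u α hα f hf => ?_⟩
  calc ∫⁻ x in (U : Set (𝔼 N)), ‖besselPow ((1 - β) / 2) f x‖ₑ
      = ∫⁻ x in (U : Set (𝔼 N)), ‖besselOp ψ (1 - β) (multiDeriv α u) x‖ₑ := by
        refine setLIntegral_congr_fun U.isOpen.measurableSet fun x hx => ?_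
        rw [besselOp, hψ x hx, one_smul, coe_besselPow, SchwartzMap.fourier_coe, hf]
        rfl
    _ ≤ ∫⁻ x, ‖besselOp ψ (1 - β) (multiDeriv α u) x‖ₑ := setLIntegral_le_lintegral _ _
    _ ≤ ∑ α ∈ multiIndices N (ν - 1), ∫⁻ x, ‖besselOp ψ (1 - β) (multiDeriv α u) x‖ₑ :=
        Finset.single_le_sum (f := fun α => ∫⁻ x, ‖besselOp ψ (1 - β) (multiDeriv α u) x‖ₑ)
          (fun _ _ => zero_le) hα
    _ ≤ C * ∫⁻ x, ‖A.apply u x‖ₑ := hC u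

theorem DiffOp.exists_finite_net_multiDeriv [FiniteDimensional ℂ E] (A : DiffOp Ω ν E F) {β : ℝ}
    (hβ0 : 0 < β) (hβ1 : β < 1) (hA : A.SupportsFractional U β) (hK : IsCompact K) (hKU : K ⊆ U)
    (hu : ∀ i, ContDiff ℝ ∞ (u i)) (huK : ∀ i, tsupport (u i) ⊆ K) {B : ℝ≥0∞} (hB : B ≠ ⊤)
    (huB : ∀ i, ∫⁻ x, ‖A.apply (u i) x‖ₑ ≤ B) {α : Fin N → ℕ} (hα : α ∈ multiIndices N (ν - 1))
    {η : ℝ≥0∞} (hη : η ≠ 0) :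
    ∃ t : Set ι, t.Finite ∧
      ∀ i, ∃ j ∈ t, ∫⁻ x, ‖multiDeriv α (u i) x - multiDeriv α (u j) x‖ₑ ≤ η := by
  obtain ⟨C, hC⟩ := hA.exists_setLIntegral_besselPow_le
  have huc (i : ι) : HasCompactSupport (u i) :=
    hK.of_isClosed_subset (isClosed_tsupport _) (huK i)
  let f (i : ι) : 𝓢(𝔼 N, E) :=
    (hasCompactSupport_multiDeriv (huc i) α).toSchwartzMap (contDiff_multiDeriv (hu i) α)
  exact exists_finite_net_of_besselPow_le (s := (1 - β) / 2) (f := f) (by linarith) (by linarith)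
    U.isOpen hK hKU (fun i => (tsupport_multiDeriv_subset _ α).trans (huK i))
    (ENNReal.mul_ne_top ENNReal.coe_ne_top hB)
    (fun i => (hC ⟨u i, hu i, huc i, (huK i).trans hKU⟩ α hα (f i) rfl).trans
      (by gcongr; exact huB i)) hη

theorem exists_finite_net_of_forall_multiDeriv [NeZero N] [CompleteSpace E] (hK : IsCompact K)
    (hu : ∀ i, ContDiff ℝ ∞ (u i)) (huK : ∀ i, tsupport (u i) ⊆ K)
    (hnet : ∀ α ∈ multiIndices N k, ∀ η : ℝ≥0∞, η ≠ 0 → ∃ t : Set ι, t.Finite ∧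
      ∀ i, ∃ j ∈ t, ∫⁻ x, ‖multiDeriv α (u i) x - multiDeriv α (u j) x‖ₑ ≤ η)
    {η : ℝ≥0∞} (hη : η ≠ 0) :
    ∃ t : Set ι, t.Finite ∧ ∀ i, ∃ j ∈ t, ∫⁻ x, ‖u i x - u j x‖ₑ ≤ η := by
  obtain ⟨R, hR⟩ := hK.isBounded.subset_closedBall 0
  set D := ENNReal.ofReal (2 * R + 1) ^ k
  set L : List (Fin N) := List.replicate k 0 with hL
  have hLk : (fun i => L.count i) ∈ multiIndices N k := by
    simpa only [hL, List.length_replicate] using count_mem_multiIndices L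
  have hpoincare (i j : ι) : ∫⁻ x, ‖u i x - u j x‖ₑ ≤ D * ∫⁻ x,
      ‖multiDeriv (fun i => L.count i) (u i) x - multiDeriv (fun i => L.count i) (u j) x‖ₑ := by
    have hsupp : tsupport (u i - u j) ⊆ Metric.closedBall 0 R :=
      (tsupport_sub _ _).trans ((Set.union_subset (huK i) (huK j)).trans hR)
    have h := lintegral_enorm_listDeriv_le (f := u i - u j) ((hu i).sub (hu j)) hsupp 0 [] k
    rwa [List.append_nil, ← hL, listDeriv_sub (hu i) (hu j) L, listDeriv_eq_multiDeriv (hu i),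
      listDeriv_eq_multiDeriv (hu j)] at h
  obtain ⟨t, ht, hij⟩ := hnet _ hLk (η / D)
    (ENNReal.div_ne_zero.2 ⟨hη, ENNReal.pow_ne_top ENNReal.ofReal_ne_top⟩)
  refine ⟨t, ht, fun i => (hij i).imp fun j ⟨hj, h⟩ => ⟨hj, (hpoincare i j).trans ?_⟩⟩
  exact (by gcongr : _ ≤ D * (η / D)).trans ENNReal.mul_div_le

theorem multiDeriv_zero (f : (𝔼 N) → E) : multiDeriv 0 f = f := by
  simp [multiDeriv]

theorem DiffOp.exists_subseq_tendsto_multiDeriv [NeZero N] [FiniteDimensional ℂ E]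
    (A : DiffOp Ω ν E F) {β : ℝ} (hβ0 : 0 < β) (hβ1 : β < 1) (hA : A.SupportsFractional U β)
    (hK : IsCompact K) (hKU : K ⊆ U) {u : ℕ → (𝔼 N) → E} (hu : ∀ i, ContDiff ℝ ∞ (u i))
    (huK : ∀ i, tsupport (u i) ⊆ K) {B : ℝ≥0∞} (hB : B ≠ ⊤)
    (huB : ∀ i, ∫⁻ x, ‖A.apply (u i) x‖ₑ ≤ B) :
    ∃ s : ℕ → ℕ, StrictMono s ∧ ∃ h : (Fin N → ℕ) → (𝔼 N) → E,
      ∀ α ∈ insert 0 (multiIndices N (ν - 1)), Integrable (h α) ∧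
        Tendsto (fun k => ∫⁻ x, ‖multiDeriv α (u (s k)) x - h α x‖ₑ) atTop (𝓝 0) := by
  have : CompleteSpace E := FiniteDimensional.complete ℂ E
  refine exists_subseq_tendsto_of_finite_nets _ (f := fun α i => multiDeriv α (u i))
    (fun α _ i => (contDiff_multiDeriv (hu i) α).continuous.integrable_of_hasCompactSupport
      (hasCompactSupport_multiDeriv (hK.of_isClosed_subset (isClosed_tsupport _) (huK i)) α))
    fun α hα η hη => ?_
  have hnet (α) (hα : α ∈ multiIndices N (ν - 1)) (η : ℝ≥0∞) (hη : η ≠ 0) :=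
    A.exists_finite_net_multiDeriv hβ0 hβ1 hA hK hKU hu huK hB huB hα hη
  rcases Finset.mem_insert.1 hα with rfl | hα
  · simp only [multiDeriv_zero]
    exact exists_finite_net_of_forall_multiDeriv hK hu huK hnet hη
  · exact hnet α hα η hη

theorem memSobolev_and_isWeakDeriv_of_tendsto [CompleteSpace E] {u : ℕ → (𝔼 N) → E}
    (hu : ∀ i, ContDiff ℝ ∞ (u i)) (huc : ∀ i, HasCompactSupport (u i))
    {h : (Fin N → ℕ) → (𝔼 N) → E}
    (hh : ∀ α ∈ insert 0 (multiIndices N k), Integrable (h α) ∧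
      Tendsto (fun i => ∫⁻ x, ‖multiDeriv α (u i) x - h α x‖ₑ) atTop (𝓝 0)) :
    MemSobolev k 1 U (h 0) ∧ ∀ α ∈ multiIndices N k, IsWeakDeriv U α (h 0) (h α) := by
  have hderiv (α) (i) : IntegrableOn (multiDeriv α (u i)) U :=
    ((contDiff_multiDeriv (hu i) α).continuous.integrable_of_hasCompactSupport
      (hasCompactSupport_multiDeriv (huc i) α)).integrableOn
  have h0 := hh 0 (Finset.mem_insert_self _ _)
  have hweak (α) (hα : α ∈ multiIndices N k) : IsWeakDeriv U α (h 0) (h α) := by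
    have hhα := hh α (Finset.mem_insert_of_mem hα)
    exact .of_tendsto (u := fun i => multiDeriv 0 (u i)) (w := fun i => multiDeriv α (u i))
      (fun i => by rw [multiDeriv_zero]; exact isWeakDeriv_multiDeriv (hu i) (huc i)) (hderiv 0)
      (hderiv α) h0.1.integrableOn hhα.1.integrableOn
      (tendsto_setLIntegral_of_tendsto _ h0.2) (tendsto_setLIntegral_of_tendsto _ hhα.2)
  exact ⟨⟨memLp_one_iff_integrable.2 h0.1.integrableOn, fun α hα => ⟨h α, hweak α hα,
    memLp_one_iff_integrable.2 (hh α (Finset.mem_insert_of_mem hα)).1.integrableOn⟩⟩, hweak⟩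

end Rellich

section Compactness

variable {N k : ℕ} {Ω U : Opens (𝔼 N)} {E F : Type*} [NormedAddCommGroup E] [NormedSpace ℂ E]
  [NormedAddCommGroup F] [NormedSpace ℂ F] {K : Set (𝔼 N)}

theorem DiffOp.exists_smooth_seq_approx [NeZero N] [CompleteSpace E] [CompleteSpace F]
    (A : DiffOp Ω (k + 1) E F) (hU : U ≤ Ω) (hK : IsCompact K) (hKU : K ⊆ U)
    {g : ℕ → (𝔼 N) → E} (hg : ∀ i, MemSobolev k 1 U (g i)) (hgK : ∀ i, SuppIn U K (g i)) :
    ∃ K', IsCompact K' ∧ K' ⊆ U ∧ ∃ (u : ℕ → (𝔼 N) → E) (h : ℕ → (Fin N → ℕ) → (𝔼 N) → E),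
      (∀ i, ContDiff ℝ ∞ (u i)) ∧ (∀ i, tsupport (u i) ⊆ K') ∧
      Tendsto (fun i => ∫⁻ x in U, ‖u i x - g i x‖ₑ) atTop (𝓝 0) ∧
      (∀ α ∈ multiIndices N k, (∀ i, IsWeakDeriv U α (g i) (h i α)) ∧
        (∀ i, Integrable (h i α)) ∧
        Tendsto (fun i => ∫⁻ x, ‖multiDeriv α (u i) x - h i α x‖ₑ) atTop (𝓝 0)) ∧
      ∀ i, ∫⁻ x, ‖A.apply (u i) x‖ₑ ≤ A.variation U (g i) + 1 := by
  obtain ⟨K', hK', hKU', happrox⟩ := A.exists_smooth_approx hU hK hKU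
  obtain ⟨ε, -, hε, hε0⟩ := exists_seq_strictAnti_tendsto' (zero_lt_one : (0 : ℝ≥0∞) < 1)
  have hnull {c : ℕ → ℝ≥0∞} (hc : ∀ i, c i ≤ ε i) : Tendsto c atTop (𝓝 0) :=
    tendsto_of_tendsto_of_tendsto_of_le_of_le tendsto_const_nhds hε0 (fun _ => zero_le) hc
  choose h hh happrox using fun i => happrox (g i) (hg i) (hgK i)
  choose u hu huK hug huh huA using fun i => happrox i (ε i) (hε i).1.ne'
  exact ⟨K', hK', hKU', u, h, hu, huK, hnull hug, fun α hα => ⟨fun i => (hh i α hα).1,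
    fun i => (hh i α hα).2, hnull fun i => huh i α hα⟩,
    fun i => (huA i).trans (by gcongr; exact (hε i).2.le)⟩

theorem DiffOp.exists_subseq_tendsto_sobolevSeminorm [NeZero N] [FiniteDimensional ℂ E]
    [CompleteSpace F] (A : DiffOp Ω (k + 1) E F) (hU : U ≤ Ω) {β : ℝ} (hβ0 : 0 < β) (hβ1 : β < 1)
    (hA : A.SupportsFractional U β) (hK : IsCompact K) (hKU : K ⊆ U) {g : ℕ → (𝔼 N) → E}
    (hg : ∀ i, MemSobolev k 1 U (g i)) (hgK : ∀ i, SuppIn U K (g i)) {M : ℝ≥0∞} (hM : M ≠ ⊤)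
    (hgM : ∀ i, A.variation U (g i) ≤ M) :
    ∃ s : ℕ → ℕ, StrictMono s ∧ ∃ g₀, MemSobolev k 1 U g₀ ∧
      Tendsto (fun i => ∫⁻ x in U, ‖g (s i) x - g₀ x‖ₑ) atTop (𝓝 0) ∧
      Tendsto (fun i => sobolevSeminorm k 1 U (fun x => g (s i) x - g₀ x)) atTop (𝓝 0) := by
  have : CompleteSpace E := FiniteDimensional.complete ℂ E
  obtain ⟨K', hK', hKU', u, h, hu, huK, hug, huh, huA⟩ :=
    A.exists_smooth_seq_approx hU hK hKU hg hgK
  obtain ⟨s, hs, w, hw⟩ := A.exists_subseq_tendsto_multiDeriv hβ0 hβ1 hA hK' hKU' hu huK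
    (ENNReal.add_ne_top.2 ⟨hM, ENNReal.one_ne_top⟩)
    fun i => (huA i).trans (by gcongr; exact hgM i)
  obtain ⟨hw0, hwα⟩ := memSobolev_and_isWeakDeriv_of_tendsto (U := U) (fun i => hu (s i))
    (fun i => hK'.of_isClosed_subset (isClosed_tsupport _) (huK (s i))) hw
  have huw := (hw 0 (Finset.mem_insert_self _ _)).2
  simp only [multiDeriv_zero] at huw
  refine ⟨s, hs, w 0, hw0, ?_, ?_⟩
  · exact tendsto_lintegral_enorm_sub_of_tendsto
      (fun i => (hu (s i)).continuous.aestronglyMeasurable) (fun i => (hg (s i)).1.1)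
      (hug.comp hs.tendsto_atTop) (tendsto_setLIntegral_of_tendsto _ huw)
  · refine tendsto_sobolevSeminorm_one_sub (fun i α hα => (huh α hα).1 (s i)) hwα fun α hα => ?_
    exact tendsto_setLIntegral_of_tendsto _ (tendsto_lintegral_enorm_sub_of_tendsto
      (fun i => (contDiff_multiDeriv (hu (s i)) α).continuous.aestronglyMeasurable)
      (fun i => ((huh α hα).2.1 (s i)).1) ((huh α hα).2.2.comp hs.tendsto_atTop)
      (hw α (Finset.mem_insert_of_mem hα)).2)

end Compactness

end DiffOpBV

end

open DiffOpBV in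
theorem mainTheorem6_general {N : ℕ} (hN : 0 < N) {ν : ℕ} (hν : 1 ≤ ν)
    {E F : Type*} [NormedAddCommGroup E] [NormedSpace ℂ E] [FiniteDimensional ℂ E]
    [NormedAddCommGroup F] [NormedSpace ℂ F] [CompleteSpace F]
    (Ω : Opens (EuclideanSpace ℝ (Fin N))) (A : DiffOp Ω ν E F)
    (U : Opens (EuclideanSpace ℝ (Fin N))) (hU : U ≤ Ω)
    (hfrac : ∃ β : ℝ, 0 < β ∧ β < 1 ∧ A.SupportsFractional U β)
    (g : ℕ → EuclideanSpace ℝ (Fin N) → E) (hg : ∀ i, A.MemBVc U (g i))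
    (hsupp : ∃ K : Set (EuclideanSpace ℝ (Fin N)), IsCompact K ∧ K ⊆ U ∧
      ∀ i, SuppIn U K (g i))
    (hvar : (⨆ i, A.variation U (g i)) < ⊤) :
    ∃ g₀ : EuclideanSpace ℝ (Fin N) → E, A.MemBVc U g₀ ∧
      ∃ s : ℕ → ℕ, StrictMono s ∧
        Tendsto (fun k => sobolevSeminorm (ν - 1) 1 U (fun x => g (s k) x - g₀ x))
          atTop (𝓝 0) := by
  have : NeZero N := ⟨hN.ne'⟩
  obtain ⟨k, rfl⟩ : ∃ k, ν = k + 1 := ⟨ν - 1, by omega⟩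
  obtain ⟨β, hβ0, hβ1, hβ⟩ := hfrac
  obtain ⟨K, hK, hKU, hgK⟩ := hsupp
  have hgM (i : ℕ) : A.variation U (g i) ≤ ⨆ j, A.variation U (g j) :=
    le_iSup (fun j => A.variation U (g j)) i
  obtain ⟨s, hs, g₀, hg₀, hmean, hseminorm⟩ := A.exists_subseq_tendsto_sobolevSeminorm hU hβ0 hβ1
    hβ hK hKU (fun i => (hg i).memSobolev) hgK hvar.ne hgM
  have hsupp₀ : SuppIn U K g₀ :=
    ae_eq_zero_of_tendsto hK.measurableSet hg₀.1.1 (fun i => hgK (s i)) hmean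
  have hvar₀ : A.variation U g₀ ≤ ⨆ j, A.variation U (g j) :=
    A.variation_le_of_tendsto hU (fun i => memLp_one_iff_integrable.1 (hg (s i)).memSobolev.1)
      (memLp_one_iff_integrable.1 hg₀.1) hmean fun i => hgM (s i)
  exact ⟨g₀, ⟨hg₀, ⟨K, hK, hKU, hsupp₀⟩, hvar₀.trans_lt hvar⟩, s, hs, hseminorm⟩

theorem mainTheorem6 {N : ℕ} (hN : 2 ≤ N) {ν : ℕ} (hν : 1 ≤ ν)
    {E F : Type*} [NormedAddCommGroup E] [NormedSpace ℂ E] [FiniteDimensional ℂ E]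
    [NormedAddCommGroup F] [NormedSpace ℂ F] [FiniteDimensional ℂ F]
    (Ω : Opens (EuclideanSpace ℝ (Fin N))) (A : DiffOpBV.DiffOp Ω ν E F)
    (U : Opens (EuclideanSpace ℝ (Fin N))) (hU : U ≤ Ω)
    (hSGN : A.SupportsSGN U)
    (hfrac : ∃ β : ℝ, 0 < β ∧ β < 1 ∧ A.SupportsFractional U β)
    (g : ℕ → EuclideanSpace ℝ (Fin N) → E)
    (hg : ∀ i, A.MemBVc U (g i))
    (hsupp : ∃ K : Set (EuclideanSpace ℝ (Fin N)), IsCompact K ∧ K ⊆ U ∧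
      ∀ i, DiffOpBV.SuppIn U K (g i))
    (hvar : (⨆ i, A.variation U (g i)) < ⊤) :
    ∃ g₀ : EuclideanSpace ℝ (Fin N) → E, A.MemBVc U g₀ ∧
      ∃ s : ℕ → ℕ, StrictMono s ∧
        Tendsto (fun k => DiffOpBV.sobolevSeminorm (ν - 1) 1 U (fun x => g (s k) x - g₀ x))
          atTop (𝓝 0) := by
  have : CompleteSpace F := FiniteDimensional.complete ℂ F
  exact mainTheorem6_general (by omega) hν Ω A U hU hfrac g hg hsupp hvar
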